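/- Let $0<\delta<1$. For a compact set $E\subset\mathbb{R}$ that is a finite union of nondegenerate closed intervals, let $g_E:\mathbb{C}\to[0,\infty)$ be the Green function of $\overline{\mathbb{C}}\setminus E$ with pole at $\infty$, i.e. the unique continuous function on $\mathbb{C}$ that is harmonic on $\mathbb{C}\setminus E$, vanishes on $E$, and is such that $g_E(z)-\log|z|$ is bounded as $z\to\infty$. Write $G_{\alpha,\delta}=g_{E(\alpha,\delta)}$ with $E(\alpha,\delta)=[-1,1]\setminus(\alpha-\delta,\alpha+\delta)$, $|\alpha|<1-\delta$, and $G_\delta=g_{[-1+2\delta,1]}$, and put $$\Phi_\delta(x)=\sup_{\alpha\in(\delta-1,0]}G_{\alpha,\delta}(x).$$ (i) For $x\in[-1,0]$, $$G_\delta(x)=\log\left(\frac{\delta-x}{1-\delta}+\sqrt{\Big(\frac{\delta-x}{1-\delta}\Big)^2-1}\right)\ \text{ if } x\le -1+2\delta,\qquad G_\delta(x)=0\ \text{ if } x\ge-1+2\delta .$$ (ii) For every $\alpha\in(\delta-1,0]$ the equation $\partial_\alpha G_{\alpha,\delta}(x)=0$ has exactly one solution $x=x_0(\alpha)$ in the gap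 $(\alpha-\delta,\alpha+\delta)$. (iii) On $(-1,0]$ the function $\Phi_\delta$ is the upper envelope of the curve $y=G_\delta(x)$ and of the parametric curve $x=x_0(\alpha)$, $y=G_{\alpha,\delta}(x_0(\alpha))$, $\alpha\in(-1+\delta,0]$; that is, for every $x\in(-1,0]$, $\Phi_\delta(x)$ is the greatest element of $$\{G_\delta(x)\}\cup\{G_{\alpha,\delta}(x_0(\alpha)):\ \alpha\in(-1+\delta,0],\ x_0(\alpha)=x\}.$$ At the end point $x=-1$ this holds in the sense of a limit: $\lim_{x\to-1^+}\Phi_\delta(x)=G_\delta(-1)$. (iv) The end points of the second curve are $\left(0,\frac12\log\frac{1+\delta}{1-\delta}\right)$ and $(-1+2\delta,0)$: one has $x_0(0)=0$ and $G_{0,\delta}(0)=\frac12\log\frac{1+\delta}{1-\delta}$, while $x_0(\alpha)\to-1+2\delta$ and $G_{\alpha,\delta}(x_0(\alpha))\to0$ as $\alpha\to-1+\delta$, $\alpha>-1+\delta$. -/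

import Mathlib

open Set Filter Topology

namespace RemezEnvelope

/-- `g` is the Green function with pole at `∞` of the domain `ℂ̄ ∖ E` (with regular boundary),
extended by `0` to `E`: it is harmonic off `E`, vanishes continuously on `E`, and
`g z - log ‖z‖` stays bounded as `z → ∞`. -/
structure IsGreenFunction (E : Set ℂ) (g : ℂ → ℝ) : Prop where
  harmonic : InnerProductSpace.HarmonicOnNhd g Eᶜ
  continuous : Continuous g
  zero_on : ∀ z ∈ E, g z = 0
  pole : (fun z => g z - Real.log ‖z‖) =O[Bornology.cobounded ℂ] (fun _ => (1 : ℝ))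

open Classical in
/-- The Green function of `ℂ̄ ∖ E` with pole at `∞` (it is unique when it exists;
the value `0` is used when there is none). -/
noncomputable def greenFunction (E : Set ℂ) : ℂ → ℝ :=
  if h : ∃ g, IsGreenFunction E g then h.choose else 0

/-- The set `E(α, δ) = [-1, 1] ∖ (α - δ, α + δ)`. -/
def twoIntervals (α δ : ℝ) : Set ℝ := Icc (-1) 1 \ Ioo (α - δ) (α + δ)

/-- `G_{α,δ}`, on the real line. -/
noncomputable def greenTwo (α δ x : ℝ) : ℝ :=
  greenFunction ((fun t : ℝ => (t : ℂ)) '' twoIntervals α δ) (x : ℂ)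

/-- `G_δ`, the Green function of the complement of `[-1 + 2δ, 1]`, on the real line. -/
noncomputable def greenOne (δ x : ℝ) : ℝ :=
  greenFunction ((fun t : ℝ => (t : ℂ)) '' Icc (-1 + 2 * δ) 1) (x : ℂ)

/-- `Φ_δ(x) = sup_{α ∈ (δ - 1, 0]} G_{α,δ}(x)`. -/
noncomputable def Phi (δ x : ℝ) : ℝ :=
  sSup ((fun α => greenTwo α δ x) '' Ioc (δ - 1) 0)

/-- `x` lies in the gap `(α - δ, α + δ)` and solves `∂_α G_{α,δ}(x) = 0`. -/
def IsGapCritical (δ α x : ℝ) : Prop :=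
  x ∈ Ioo (α - δ) (α + δ) ∧ HasDerivAt (fun β => greenTwo β δ x) 0 α

end RemezEnvelope

namespace RemezEnvelope

open InnerProductSpace

/-! The Green function of two intervals is made explicit. On the upper half plane consider the
differential (z - c) dz / √((z+1)(z-α+δ)(z-α-δ)(z-1)). The real part of a primitive, reflected in
the real axis, is harmonic off E, constant on each of the two intervals, and logarithmic at
infinity. The constants on the two intervals agree for exactly one c, namely `gapCenter`. The
maximum principle gives uniqueness, so this is the Green function. With t = α + δ cos θ it becomes,
at the gap point α + δ cos φ, the integral of (c - t)/√(1 - t²) dθ over [φ, π]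
(`greenTwo_eq_gapGreen`), in which no singular end points remain.

Differentiating in α at a fixed point x gives `gapVariation`. Its φ-derivative is negative, because
c moves at speed at least 1 (`one_le_gapCenterDeriv`) and stays in the gap. So ∂_α G increases
strictly in x, from -∞ at the left end of the gap to +∞ at the right end, and vanishes at exactly
one point x₀(α).

For the envelope, fix x in (-1, 0]. As α → δ - 1 the left interval shrinks to a point and G_{α,δ}(x)
→ G_δ(x) when x < -1 + 2δ (`tendsto_greenTwo`); otherwise G_δ(x) = 0. Hence G_δ ≤ Φ_δ. If Φ_δ(x) >
G_δ(x), then `greenTwo_le_greenOne` keeps maximising α away from δ - 1, so the supremum is attained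
(`exists_greenTwo_eq_Phi`). At an interior maximiser ∂_α G vanishes. At α = 0 the one-sided
derivative is nonnegative, while the symmetric gap has x₀(0) = 0, so monotonicity in x rules out x <
0. Either way x = x₀(α).

The value at α = 0 is an elementary integral. The limit x₀(α) → -1 + 2δ needs ∂_α G to become
negative at every fixed point of (-1, -1 + 2δ). This follows from the speed of c tending to infinity
(`le_gapCenterDeriv`), which comes from the logarithmic divergence of the integral of 1/√(1 - t²)
over the gap. -/

/-! ### The maximum principle and uniqueness of Green functions -/

/-- A harmonic function is constant near a local maximum. -/
theorem eventually_eq_of_isLocalMax_of_harmonicAt {u : ℂ → ℝ} {z : ℂ} (hu : HarmonicAt u z)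
    (hz : IsLocalMax u z) : ∀ᶠ w in 𝓝 z, u w = u z := by
  obtain ⟨r, hr, hball⟩ := Metric.eventually_nhds_iff_ball.1 hu.eventually
  obtain ⟨F, hF, hFu⟩ := HarmonicOnNhd.exists_analyticOnNhd_ball_re_eq
    (f := u) (z := z) (R := r) hball
  have hmem : ∀ᶠ w in 𝓝 z, w ∈ Metric.ball z r := Metric.ball_mem_nhds z hr
  -- Locally u = Re F, so |exp F| = exp u and the maximum modulus principle applies to exp F.
  have hd : ∀ᶠ w in 𝓝 z, DifferentiableAt ℂ (fun w => Complex.exp (F w)) w := by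
    filter_upwards [hmem] with w hw
    exact (hF w hw).differentiableAt.cexp
  have hnorm : ∀ w ∈ Metric.ball z r, ‖Complex.exp (F w)‖ = Real.exp (u w) := fun w hw => by
    rw [Complex.norm_exp, ← hFu hw]
  have hzb : z ∈ Metric.ball z r := Metric.mem_ball_self hr
  have hmax : IsLocalMax (norm ∘ fun w => Complex.exp (F w)) z := by
    filter_upwards [hmem, hz] with w hw hwz
    simp only [Function.comp_apply]
    rw [hnorm w hw, hnorm z hzb]
    exact Real.exp_le_exp.2 hwz
  filter_upwards [Complex.norm_eventually_eq_of_isLocalMax hd hmax, hmem] with w hw hwb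
  rw [hnorm w hwb, hnorm z hzb] at hw
  exact Real.exp_injective hw

/-- The maximum principle on the complement of a set, with control at infinity. -/
theorem nonpos_of_harmonicOnNhd_compl {E : Set ℂ} {u : ℂ → ℝ} (hc : Continuous u)
    (hu : HarmonicOnNhd u Eᶜ) (hE : ∀ z ∈ E, u z ≤ 0)
    (hinf : ∀ᶠ z in Bornology.cobounded ℂ, u z ≤ 0) (z : ℂ) : u z ≤ 0 := by
  by_contra! hz
  have hK : IsCompact {w | u z ≤ u w} := by
    refine Metric.isCompact_of_isClosed_isBounded (isClosed_le continuous_const hc) ?_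
    rw [← Bornology.isCobounded_compl_iff]
    filter_upwards [hinf] with w hw
    simp only [mem_compl_iff, mem_ofPred_eq, not_le]
    linarith
  obtain ⟨m, hm, hmax⟩ := hK.exists_isMaxOn ⟨z, le_refl (u z)⟩ hc.continuousOn
  have hmax' : ∀ w, u w ≤ u m := fun w => by
    by_cases hw : u z ≤ u w
    · exact hmax hw
    · exact (not_le.1 hw).le.trans hm
  -- The maximum is positive, so its level set avoids E and is clopen in all of ℂ; no connectedness
  -- of the complement of E is needed.
  have hclopen : IsClopen {w | u w = u m} := by
    refine ⟨isClosed_eq hc continuous_const, isOpen_iff_mem_nhds.2 fun w hw => ?_⟩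
    have hw' : u w = u m := hw
    have hwE : w ∈ Eᶜ := fun h => by
      have := hE w h
      have hm' : u z ≤ u m := hm
      linarith
    have hl : IsLocalMax u w := Eventually.of_forall fun v => hw'.symm ▸ hmax' v
    filter_upwards [eventually_eq_of_isLocalMax_of_harmonicAt (hu w hwE) hl] with v hv
    exact hv.trans hw'
  have huniv := hclopen.eq_univ ⟨m, rfl⟩
  obtain ⟨w, hw⟩ := hinf.exists
  have h1 : w ∈ {w | u w = u m} := huniv ▸ mem_univ w
  have h2 : u w = u m := h1
  have hm' : u z ≤ u m := hm
  linarith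

namespace IsGreenFunction

variable {E E₁ E₂ : Set ℂ} {g g₁ g₂ : ℂ → ℝ}

theorem tendsto_atTop (h : IsGreenFunction E g) :
    Tendsto g (Bornology.cobounded ℂ) atTop := by
  obtain ⟨C, hC⟩ := h.pole.bound
  have hlog : Tendsto (fun z : ℂ => -C + Real.log ‖z‖) (Bornology.cobounded ℂ) atTop :=
    tendsto_atTop_add_const_left _ _
      (Real.tendsto_log_atTop.comp tendsto_norm_cobounded_atTop)
  refine tendsto_atTop_mono' _ ?_ hlog
  filter_upwards [hC] with z hz
  simp only [Real.norm_eq_abs, abs_one, mul_one] at hz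
  linarith [(abs_le.1 hz).1]

theorem nonneg (h : IsGreenFunction E g) (z : ℂ) : 0 ≤ g z := by
  have := nonpos_of_harmonicOnNhd_compl (E := E) (u := -g) h.continuous.neg h.harmonic.neg
    (fun z hz => by simp [h.zero_on z hz])
    ((h.tendsto_atTop.eventually_ge_atTop 0).mono fun z hz => by simpa using hz) z
  simpa using this

/-- Green functions decrease when the set increases. -/
theorem le_of_subset (h₁ : IsGreenFunction E₁ g₁) (h₂ : IsGreenFunction E₂ g₂)
    (hE : E₁ ⊆ E₂) (z : ℂ) : g₂ z ≤ g₁ z := by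
  -- With equal poles g₂ - g₁ is only known to be bounded at infinity. The factor 1 + ε forces the
  -- difference to -∞ there, and ε → 0 at the end.
  have key : ∀ ε > 0, g₂ z - (1 + ε) * g₁ z ≤ 0 := by
    intro ε hε
    refine nonpos_of_harmonicOnNhd_compl (E := E₂) (u := fun w => g₂ w - (1 + ε) * g₁ w)
      (h₂.continuous.sub (continuous_const.mul h₁.continuous)) ?_ ?_ ?_ z
    · exact h₂.harmonic.sub
        ((h₁.harmonic.mono (compl_subset_compl.2 hE)).const_smul (c := 1 + ε))
    · intro w hw
      rw [h₂.zero_on w hw]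
      have := h₁.nonneg w
      nlinarith
    · obtain ⟨C₁, hC₁⟩ := h₁.pole.bound
      obtain ⟨C₂, hC₂⟩ := h₂.pole.bound
      filter_upwards [hC₁, hC₂, h₁.tendsto_atTop.eventually_ge_atTop ((C₁ + C₂) / ε)]
        with w hw₁ hw₂ hw
      simp only [Real.norm_eq_abs, abs_one, mul_one] at hw₁ hw₂
      rw [div_le_iff₀ hε] at hw
      linarith [(abs_le.1 hw₁).1, (abs_le.1 hw₂).2]
  have hlim : Tendsto (fun ε : ℝ => g₂ z - (1 + ε) * g₁ z) (𝓝[>] 0)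
      (𝓝 (g₂ z - (1 + 0) * g₁ z)) :=
    (Continuous.tendsto (by fun_prop) 0).mono_left nhdsWithin_le_nhds
  have := le_of_tendsto hlim (eventually_mem_nhdsWithin.mono fun ε hε => key ε hε)
  linarith

/-- Monotonicity applied twice with equal sets is uniqueness, so the choice in `greenFunction` can
be replaced by any explicit construction. -/
theorem greenFunction_eq (h : IsGreenFunction E g) : greenFunction E = g := by
  have hex : ∃ g, IsGreenFunction E g := ⟨g, h⟩
  rw [greenFunction, dif_pos hex]
  funext z
  exact le_antisymm (h.le_of_subset hex.choose_spec subset_rfl z)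
    (hex.choose_spec.le_of_subset h subset_rfl z)

end IsGreenFunction

/-! ### A branch of the square root on the closed upper half plane -/

/-- The branch of the square root with cut along the negative imaginary axis. -/
noncomputable def upperSqrt (z : ℂ) : ℂ :=
  -- Multiplication by -i turns the upper half plane into the right one, where the principal root is
  -- holomorphic; the prefactor is a square root of i and undoes the rotation.
  (1 + Complex.I) / (√2 : ℝ) * (-Complex.I * z) ^ (2⁻¹ : ℂ)

theorem one_add_I_div_sqrt_two_sq : ((1 + Complex.I) / (√2 : ℝ)) ^ 2 = Complex.I := by
  rw [div_pow, ← Complex.ofReal_pow, Real.sq_sqrt zero_le_two]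
  have : (1 + Complex.I) ^ 2 = 2 * Complex.I := by
    linear_combination Complex.I_sq
  rw [this]
  simp

theorem upperSqrt_sq (z : ℂ) : upperSqrt z ^ 2 = z := by
  rw [upperSqrt, mul_pow, one_add_I_div_sqrt_two_sq, Complex.cpow_ofNat_inv_pow]
  linear_combination (-z) * Complex.I_sq

theorem upperSqrt_ne_zero {z : ℂ} (hz : z ≠ 0) : upperSqrt z ≠ 0 := fun h => by
  apply hz
  rw [← upperSqrt_sq z, h]
  simp

theorem norm_upperSqrt (z : ℂ) : ‖upperSqrt z‖ = √‖z‖ := by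
  rw [← Real.sqrt_sq (norm_nonneg (upperSqrt z)), ← norm_pow, upperSqrt_sq]

theorem re_upperSqrt (z : ℂ) : (upperSqrt z).re =
    (((-Complex.I * z) ^ (2⁻¹ : ℂ)).re - ((-Complex.I * z) ^ (2⁻¹ : ℂ)).im) / √2 := by
  rw [upperSqrt, div_mul_eq_mul_div, Complex.div_ofReal_re]
  simp [Complex.mul_re]

theorem im_upperSqrt (z : ℂ) : (upperSqrt z).im =
    (((-Complex.I * z) ^ (2⁻¹ : ℂ)).im + ((-Complex.I * z) ^ (2⁻¹ : ℂ)).re) / √2 := by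
  rw [upperSqrt, div_mul_eq_mul_div, Complex.div_ofReal_im]
  simp [Complex.mul_im]

/-- The principal root of a number in the right half plane has argument at most π/4 in absolute
value. Rotating by π/4 then puts `upperSqrt` in the first quadrant. -/
theorem abs_im_cpow_le {z : ℂ} (hz : 0 ≤ z.im) :
    |((-Complex.I * z) ^ (2⁻¹ : ℂ)).im| ≤ ((-Complex.I * z) ^ (2⁻¹ : ℂ)).re := by
  rw [Complex.abs_cpow_inv_two_im, Complex.cpow_inv_two_re]
  apply Real.sqrt_le_sqrt
  have : (-Complex.I * z).re = z.im := by simp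
  rw [this]
  linarith

theorem abs_im_cpow_lt {z : ℂ} (hz : 0 < z.im) :
    |((-Complex.I * z) ^ (2⁻¹ : ℂ)).im| < ((-Complex.I * z) ^ (2⁻¹ : ℂ)).re := by
  rw [Complex.abs_cpow_inv_two_im, Complex.cpow_inv_two_re]
  have : (-Complex.I * z).re = z.im := by simp
  have h2 := Complex.re_le_norm (-Complex.I * z)
  apply Real.sqrt_lt_sqrt <;> rw [this] at *
  · linarith
  · linarith

theorem re_upperSqrt_nonneg {z : ℂ} (hz : 0 ≤ z.im) : 0 ≤ (upperSqrt z).re := by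
  rw [re_upperSqrt]
  have := abs_le.1 (abs_im_cpow_le hz)
  exact div_nonneg (by linarith [this.2]) (Real.sqrt_nonneg _)

theorem im_upperSqrt_nonneg {z : ℂ} (hz : 0 ≤ z.im) : 0 ≤ (upperSqrt z).im := by
  rw [im_upperSqrt]
  have := abs_le.1 (abs_im_cpow_le hz)
  exact div_nonneg (by linarith [this.1]) (Real.sqrt_nonneg _)

theorem re_upperSqrt_pos {z : ℂ} (hz : 0 < z.im) : 0 < (upperSqrt z).re := by
  rw [re_upperSqrt]
  have := abs_lt.1 (abs_im_cpow_lt hz)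
  exact div_pos (by linarith [this.2]) (Real.sqrt_pos.2 two_pos)

theorem im_upperSqrt_pos {z : ℂ} (hz : 0 < z.im) : 0 < (upperSqrt z).im := by
  rw [im_upperSqrt]
  have := abs_lt.1 (abs_im_cpow_lt hz)
  exact div_pos (by linarith [this.1]) (Real.sqrt_pos.2 two_pos)

/-- `upperSqrt z` is the only square root of `z` in the closed first quadrant. -/
theorem upperSqrt_eq_of_sq_eq {z v : ℂ} (hz : 0 ≤ z.im) (hv : v ^ 2 = z) (hre : 0 ≤ v.re)
    (him : 0 ≤ v.im) : upperSqrt z = v := by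
  have h : upperSqrt z ^ 2 = v ^ 2 := by rw [upperSqrt_sq, hv]
  rcases sq_eq_sq_iff_eq_or_eq_neg.1 h with h | h
  · exact h
  · have h1 := re_upperSqrt_nonneg hz
    have h2 := im_upperSqrt_nonneg hz
    rw [h] at h1 h2 ⊢
    simp only [Complex.neg_re, Complex.neg_im, Left.nonneg_neg_iff] at h1 h2
    have : v = 0 := Complex.ext (le_antisymm h1 hre) (le_antisymm h2 him)
    simp [this]

theorem upperSqrt_ofReal_of_nonneg {x : ℝ} (hx : 0 ≤ x) : upperSqrt x = (√x : ℝ) := by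
  apply upperSqrt_eq_of_sq_eq
  · simp
  · rw [← Complex.ofReal_pow, Real.sq_sqrt hx]
  · simp [Real.sqrt_nonneg]
  · simp

theorem upperSqrt_ofReal_of_nonpos {x : ℝ} (hx : x ≤ 0) :
    upperSqrt x = Complex.I * (√(-x) : ℝ) := by
  apply upperSqrt_eq_of_sq_eq
  · simp
  · rw [mul_pow, ← Complex.ofReal_pow, Real.sq_sqrt (by linarith), Complex.I_sq]
    simp
  · simp
  · simp [Real.sqrt_nonneg]

/-- The condition places z off the cut and includes full neighbourhoods of nonzero real points. The
value of the derivative comes from differentiating the identity `upperSqrt_sq`. -/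
theorem hasDerivAt_upperSqrt {z : ℂ} (hz : 0 < z.im ∨ z.re ≠ 0) :
    HasDerivAt upperSqrt (1 / (2 * upperSqrt z)) z := by
  have hslit : -Complex.I * z ∈ Complex.slitPlane := by
    rw [Complex.mem_slitPlane_iff]
    simpa using hz
  have h1 : HasDerivAt (fun z : ℂ => -Complex.I * z) (-Complex.I) z := by
    simpa using (hasDerivAt_id z).const_mul (-Complex.I)
  have h2 : DifferentiableAt ℂ upperSqrt z :=
    ((h1.cpow_const (c := (2⁻¹ : ℂ)) hslit).const_mul _).differentiableAt
  have hz0 : z ≠ 0 := by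
    rintro rfl
    simp at hz
  have hne := upperSqrt_ne_zero hz0
  have h3 : HasDerivAt (fun w => upperSqrt w ^ 2) (2 * upperSqrt z * deriv upperSqrt z) z := by
    simpa using h2.hasDerivAt.fun_pow 2
  have h4 : HasDerivAt (fun w => upperSqrt w ^ 2) 1 z :=
    (hasDerivAt_id z).congr_of_eventuallyEq (Eventually.of_forall fun w => upperSqrt_sq w)
  have h5 := h3.unique h4
  have : deriv upperSqrt z = 1 / (2 * upperSqrt z) := by
    rw [eq_div_iff (by simpa using hne)]
    linear_combination h5
  rw [← this]
  exact h2.hasDerivAt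

theorem continuousAt_upperSqrt_zero : ContinuousAt upperSqrt 0 := by
  have h0 : upperSqrt 0 = 0 := by simp [upperSqrt]
  rw [ContinuousAt, h0, tendsto_zero_iff_norm_tendsto_zero]
  simp only [norm_upperSqrt]
  have : Continuous fun z : ℂ => √‖z‖ := by fun_prop
  simpa using this.tendsto 0

/-- The asymptotic behaviour of `upperSqrt` at infinity. -/
theorem upperSqrt_sub_eq {z : ℂ} (hz : 0 < z.im) (e : ℝ) :
    upperSqrt (z - e) = upperSqrt z * (1 - e / z) ^ (2⁻¹ : ℂ) := by
  have hz0 : z ≠ 0 := by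
    rintro rfl
    simp at hz
  have hze : 0 < (z - e).im := by simpa using hz
  have hne := upperSqrt_ne_zero hz0
  have hsq : (upperSqrt (z - e)) ^ 2 = (upperSqrt z * (1 - e / z) ^ (2⁻¹ : ℂ)) ^ 2 := by
    rw [mul_pow, upperSqrt_sq, upperSqrt_sq, Complex.cpow_ofNat_inv_pow]
    field_simp
  rcases sq_eq_sq_iff_eq_or_eq_neg.1 hsq with h | h
  · exact h
  -- With the wrong sign, a principal root, of nonnegative real part, would be minus a quotient of
  -- two numbers in the open first quadrant, and such a quotient has positive real part.
  · exfalso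
    have hre : 0 ≤ ((1 - e / z) ^ (2⁻¹ : ℂ)).re := by
      rw [Complex.cpow_inv_two_re]
      exact Real.sqrt_nonneg _
    have hq : (1 - e / z) ^ (2⁻¹ : ℂ) = -(upperSqrt (z - e) / upperSqrt z) := by
      rw [h]
      field_simp
    rw [hq, Complex.neg_re, Complex.div_re] at hre
    have a1 := re_upperSqrt_pos hz
    have a2 := im_upperSqrt_pos hz
    have b1 := re_upperSqrt_pos hze
    have b2 := im_upperSqrt_pos hze
    have hn : 0 < Complex.normSq (upperSqrt z) := Complex.normSq_pos.2 hne
    have p1 : 0 < (upperSqrt (z - e)).re * (upperSqrt z).re / Complex.normSq (upperSqrt z) := by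
      positivity
    have p2 : 0 < (upperSqrt (z - e)).im * (upperSqrt z).im / Complex.normSq (upperSqrt z) := by
      positivity
    linarith

/-! ### Boundary values of primitives on the upper half plane -/

/-- The open upper half plane, as a subset of `ℂ`. -/
def upperHalf : Set ℂ := {z | 0 < z.im}

theorem mem_upperHalf {z : ℂ} : z ∈ upperHalf ↔ 0 < z.im := Iff.rfl

theorem isOpen_upperHalf : IsOpen upperHalf := isOpen_lt continuous_const Complex.continuous_im

theorem convex_upperHalf : Convex ℝ upperHalf := convex_halfSpace_im_gt 0

theorem mem_closure_upperHalf {z : ℂ} (hz : 0 ≤ z.im) : z ∈ closure upperHalf := by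
  have h : Tendsto (fun ε : ℝ => z + ε * Complex.I) (𝓝[>] 0) (𝓝 (z + (0 : ℝ) * Complex.I)) :=
    (Continuous.tendsto (by fun_prop) 0).mono_left nhdsWithin_le_nhds
  simp only [Complex.ofReal_zero, zero_mul, add_zero] at h
  refine mem_closure_of_tendsto h ?_
  filter_upwards [self_mem_nhdsWithin] with ε hε
  have hε' : (0 : ℝ) < ε := hε
  simp only [upperHalf, mem_ofPred_eq, Complex.add_im, Complex.mul_im, Complex.ofReal_re,
    Complex.I_im, mul_one, Complex.ofReal_im, Complex.I_re, mul_zero, add_zero]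
  linarith

/-- Two functions with the same derivative on a convex open set differ by a constant. -/
theorem exists_eq_add_const_of_hasDerivAt {U : Set ℂ} (hU : IsOpen U) (hc : Convex ℝ U)
    {F P f : ℂ → ℂ} (hF : ∀ z ∈ U, HasDerivAt F (f z) z) (hP : ∀ z ∈ U, HasDerivAt P (f z) z) :
    ∃ k, ∀ z ∈ U, F z = P z + k := by
  obtain ⟨k, hk⟩ := hU.exists_is_const_of_deriv_eq_zero (f := F - P) hc.isPreconnected
    (fun z hz => ((hF z hz).sub (hP z hz)).differentiableAt.differentiableWithinAt)
    (fun z hz => by simpa using ((hF z hz).sub (hP z hz)).deriv)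
  exact ⟨k, fun z hz => by rw [← hk z hz]; simp⟩

/-- A holomorphic function on the upper half plane has a primitive. -/
theorem exists_primitive_upperHalf {R : ℂ → ℂ} (hR : DifferentiableOn ℂ R upperHalf) :
    ∃ F : ℂ → ℂ, ∀ z ∈ upperHalf, HasDerivAt F (R z) z := by
  -- The Cayley transform carries R dz to a differential on the unit disc, where primitives exist.
  have hψ : ∀ w ∈ Metric.ball (0 : ℂ) 1, Complex.I * (1 + w) / (1 - w) ∈ upperHalf := by
    intro w hw
    rw [mem_ball_zero_iff] at hw
    have hn : Complex.normSq w < 1 := by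
      rw [Complex.normSq_eq_norm_sq]
      nlinarith [norm_nonneg w]
    have hne : 1 - w ≠ 0 := fun h => by
      have : w = 1 := by linear_combination -h
      rw [this] at hw
      simp at hw
    have hpos : 0 < Complex.normSq (1 - w) := Complex.normSq_pos.2 hne
    have : (Complex.I * (1 + w) / (1 - w)).im
        = (1 - Complex.normSq w) / Complex.normSq (1 - w) := by
      rw [Complex.div_im, ← sub_div]
      congr 1
      simp [Complex.normSq_apply]
      ring
    rw [mem_upperHalf, this]
    exact div_pos (by linarith) hpos
  have hne : ∀ w ∈ Metric.ball (0 : ℂ) 1, 1 - w ≠ 0 := by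
    intro w hw h
    have : w = 1 := by linear_combination -h
    rw [this] at hw
    simp at hw
  have hd : DifferentiableOn ℂ
      (fun w => R (Complex.I * (1 + w) / (1 - w)) * (2 * Complex.I / (1 - w) ^ 2))
      (Metric.ball 0 1) := by
    intro w hw
    have h0 := hne w hw
    have h1 : DifferentiableAt ℂ (fun w : ℂ => Complex.I * (1 + w) / (1 - w)) w := by
      fun_prop (disch := assumption)
    have h2 : DifferentiableAt ℂ R (Complex.I * (1 + w) / (1 - w)) :=
      hR.differentiableAt (isOpen_upperHalf.mem_nhds (hψ w hw))
    have h3 : DifferentiableAt ℂ (fun w : ℂ => 2 * Complex.I / (1 - w) ^ 2) w := by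
      fun_prop (disch := exact pow_ne_zero 2 h0)
    exact ((DifferentiableAt.comp w h2 h1).mul h3).differentiableWithinAt
  obtain ⟨P, hP⟩ := hd.isExactOn_ball
  refine ⟨fun z => P ((z - Complex.I) / (z + Complex.I)), fun z hz => ?_⟩
  have hz' : 0 < z.im := hz
  have hzI : z + Complex.I ≠ 0 := fun h => by
    have := congrArg Complex.im h
    simp at this
    linarith
  have hmem : (z - Complex.I) / (z + Complex.I) ∈ Metric.ball (0 : ℂ) 1 := by
    rw [mem_ball_zero_iff, norm_div, div_lt_one (norm_pos_iff.2 hzI)]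
    rw [← sq_lt_sq₀ (norm_nonneg _) (norm_nonneg _), ← Complex.normSq_eq_norm_sq,
      ← Complex.normSq_eq_norm_sq]
    simp [Complex.normSq_apply]
    nlinarith
  have hq : HasDerivAt (fun z => (z - Complex.I) / (z + Complex.I))
      (2 * Complex.I / (z + Complex.I) ^ 2) z := by
    have := ((hasDerivAt_id z).sub_const Complex.I).div ((hasDerivAt_id z).add_const Complex.I) hzI
    refine this.congr_deriv ?_
    simp only [id]
    ring
  have := (hP _ hmem).comp z hq
  refine this.congr_deriv ?_
  have e1 : 1 - (z - Complex.I) / (z + Complex.I) = 2 * Complex.I / (z + Complex.I) := by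
    field_simp
    ring
  have e2 : Complex.I * (1 + (z - Complex.I) / (z + Complex.I)) /
      (1 - (z - Complex.I) / (z + Complex.I)) = z := by
    rw [e1]
    field_simp
    ring
  simp only [e2]
  rw [e1]
  field_simp

/-- At a point near which `R` is holomorphic, a primitive of `R` on the upper half plane extends
holomorphically. -/
theorem exists_primitive_eqOn_ball {R F : ℂ → ℂ} (hF : ∀ z ∈ upperHalf, HasDerivAt F (R z) z)
    {x : ℂ} {r : ℝ} (hR : DifferentiableOn ℂ R (Metric.ball x r)) :
    ∃ P : ℂ → ℂ, (∀ z ∈ Metric.ball x r, HasDerivAt P (R z) z) ∧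
      EqOn F P (Metric.ball x r ∩ upperHalf) := by
  obtain ⟨P, hP⟩ := hR.isExactOn_ball
  obtain ⟨k, hk⟩ := exists_eq_add_const_of_hasDerivAt (U := Metric.ball x r ∩ upperHalf)
    (Metric.isOpen_ball.inter isOpen_upperHalf) ((convex_ball x r).inter convex_upperHalf)
    (fun z hz => hF z hz.2) (fun z hz => hP z hz.1)
  exact ⟨fun z => P z + k, fun z hz => (hP z hz).add_const k, hk⟩

/-- At an inverse square root singularity of `R`, a primitive of `R` has a limit. -/
theorem exists_tendsto_of_singularity {R F : ℂ → ℂ}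
    (hF : ∀ z ∈ upperHalf, HasDerivAt F (R z) z) {e : ℝ} {A : ℂ → ℂ} (hA : AnalyticAt ℂ A e)
    (hRA : ∀ z ∈ upperHalf, R z = A z / upperSqrt (z - e)) :
    ∃ y, Tendsto F (𝓝[upperHalf] (e : ℂ)) (𝓝 y) := by
  obtain ⟨ρ, hρ, hball⟩ := Metric.eventually_nhds_iff_ball.1 hA.eventually_analyticAt
  have hmap : ∀ u ∈ Metric.ball (0 : ℂ) √ρ, (e : ℂ) + u ^ 2 ∈ Metric.ball (e : ℂ) ρ := by
    intro u hu
    rw [mem_ball_zero_iff] at hu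
    rw [mem_ball_iff_norm, add_sub_cancel_left, norm_pow]
    have := Real.sq_sqrt hρ.le
    nlinarith [norm_nonneg u]
  -- Putting z = e + u² turns A(z) dz / √(z - e) into 2 A(e + u²) du, which is regular at u = 0.
  have hd : DifferentiableOn ℂ (fun u => 2 * A (e + u ^ 2)) (Metric.ball 0 √ρ) := by
    intro u hu
    have h1 : DifferentiableAt ℂ A (e + u ^ 2) := (hball _ (hmap u hu)).differentiableAt
    have h2 : DifferentiableAt ℂ (fun u : ℂ => (e : ℂ) + u ^ 2) u := by fun_prop
    exact ((DifferentiableAt.comp u h1 h2).const_mul 2).differentiableWithinAt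
  obtain ⟨Q, hQ⟩ := hd.isExactOn_ball
  have hσ : ∀ z ∈ Metric.ball (e : ℂ) ρ, upperSqrt (z - e) ∈ Metric.ball (0 : ℂ) √ρ := by
    intro z hz
    rw [mem_ball_zero_iff, norm_upperSqrt]
    rw [mem_ball_iff_norm] at hz
    exact Real.sqrt_lt_sqrt (norm_nonneg _) hz
  have hP : ∀ z ∈ Metric.ball (e : ℂ) ρ ∩ upperHalf,
      HasDerivAt (fun z => Q (upperSqrt (z - e))) (R z) z := by
    rintro z ⟨hz, hzu⟩
    have hzu' : 0 < z.im := hzu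
    have h1 : HasDerivAt (fun z : ℂ => upperSqrt (z - e)) (1 / (2 * upperSqrt (z - e))) z :=
      (hasDerivAt_upperSqrt (z := z - e) (Or.inl (by simpa using hzu'))).comp_sub_const z e
    have h2 := (hQ _ (hσ z hz)).comp z h1
    refine h2.congr_deriv ?_
    simp only [hRA z hzu, upperSqrt_sq, add_sub_cancel]
    have hne : upperSqrt (z - e) ≠ 0 := upperSqrt_ne_zero fun h => by
      have := congrArg Complex.im h
      simp at this
      linarith
    field_simp
  obtain ⟨k, hk⟩ := exists_eq_add_const_of_hasDerivAt (U := Metric.ball (e : ℂ) ρ ∩ upperHalf)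
    (Metric.isOpen_ball.inter isOpen_upperHalf) ((convex_ball _ ρ).inter convex_upperHalf)
    (fun z hz => hF z hz.2) hP
  refine ⟨Q 0 + k, ?_⟩
  have h0 : upperSqrt 0 = 0 := by simp [upperSqrt]
  have hσc : Tendsto (fun z : ℂ => upperSqrt (z - e)) (𝓝 (e : ℂ)) (𝓝 0) := by
    have h1 : Tendsto (fun z : ℂ => z - e) (𝓝 (e : ℂ)) (𝓝 0) := by
      simpa using (continuous_id.sub continuous_const).tendsto (e : ℂ) (f := fun z : ℂ => z - e)
    have := continuousAt_upperSqrt_zero.tendsto.comp h1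
    rwa [h0] at this
  have hQc : Tendsto Q (𝓝 0) (𝓝 (Q 0)) :=
    (hQ 0 (Metric.mem_ball_self (Real.sqrt_pos.2 hρ))).continuousAt
  have hlim : Tendsto (fun z : ℂ => Q (upperSqrt (z - e)) + k) (𝓝[upperHalf] (e : ℂ))
      (𝓝 (Q 0 + k)) :=
    ((hQc.comp hσc).add_const k).mono_left nhdsWithin_le_nhds
  refine hlim.congr' ?_
  filter_upwards [mem_nhdsWithin_of_mem_nhds (Metric.ball_mem_nhds (e : ℂ) hρ),
    self_mem_nhdsWithin] with z hz hzu
  exact (hk z ⟨hz, hzu⟩).symm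

/-- The logarithmic behaviour at infinity of a primitive of `R`, when `R z ∼ 1 / z`. -/
theorem exists_bound_re_sub_log {R F : ℂ → ℂ} (hF : ∀ z ∈ upperHalf, HasDerivAt F (R z) z)
    {A : ℂ → ℂ} (hA : AnalyticAt ℂ A 0) (hA0 : A 0 = 1)
    (hRA : ∀ᶠ u in 𝓝[upperHalf] 0, R (-1 / u) = -u * A u) :
    ∃ C ρ : ℝ, ∀ z ∈ upperHalf, ρ < ‖z‖ → |(F z).re - Real.log ‖z‖| ≤ C := by
  obtain ⟨r₁, hr₁, hball₁⟩ := Metric.eventually_nhds_iff_ball.1 hA.eventually_analyticAt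
  obtain ⟨r₂, hr₂, hball₂⟩ := Metric.eventually_nhds_iff_ball.1 (eventually_nhdsWithin_iff.1 hRA)
  set r := min r₁ r₂ with hr
  have hr0 : 0 < r := lt_min hr₁ hr₂
  have hAd : DifferentiableOn ℂ A (Metric.ball 0 r) := fun u hu =>
    (hball₁ u (Metric.ball_subset_ball (min_le_left _ _) hu)).differentiableAt
      |>.differentiableWithinAt
  -- In u = -1/z the differential is -A(u) du/u. Since A 0 = 1 it splits as -du/u, the source of the
  -- logarithm, minus the regular part `dslope A 0`.
  have hds : DifferentiableOn ℂ (dslope A 0) (Metric.ball 0 r) :=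
    (Complex.differentiableOn_dslope (Metric.ball_mem_nhds 0 hr0)).2 hAd
  obtain ⟨Q, hQ⟩ := hds.isExactOn_ball
  have hU0 : ∀ u ∈ upperHalf, u ≠ 0 := by
    rintro u hu rfl
    simp [upperHalf] at hu
  have hinv : ∀ u ∈ upperHalf, -1 / u ∈ upperHalf := by
    intro u hu
    have hu' : 0 < u.im := hu
    have : (-1 / u).im = u.im / Complex.normSq u := by
      rw [Complex.div_im]
      simp [neg_div]
    rw [mem_upperHalf, this]
    exact div_pos hu' (Complex.normSq_pos.2 (hU0 u hu))
  have h1 : ∀ u ∈ Metric.ball (0 : ℂ) r ∩ upperHalf,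
      HasDerivAt (fun u => F (-1 / u)) (-u * A u / u ^ 2) u := by
    rintro u ⟨hu, huu⟩
    have hu0 := hU0 u huu
    have hi : HasDerivAt (fun u : ℂ => -1 / u) (1 / u ^ 2) u := by
      have := (hasDerivAt_const u (-1 : ℂ)).div (hasDerivAt_id u) hu0
      refine this.congr_deriv ?_
      simp
    have := (hF _ (hinv u huu)).comp u hi
    refine this.congr_deriv ?_
    rw [hball₂ u (Metric.ball_subset_ball (min_le_right _ _) hu) huu]
    ring
  have h2 : ∀ u ∈ Metric.ball (0 : ℂ) r ∩ upperHalf,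
      HasDerivAt (fun u => -Complex.log u - Q u) (-u * A u / u ^ 2) u := by
    rintro u ⟨hu, huu⟩
    have hu0 := hU0 u huu
    have hslit : u ∈ Complex.slitPlane := by
      rw [Complex.mem_slitPlane_iff]
      have hu' : 0 < u.im := huu
      exact Or.inr hu'.ne'
    have := ((Complex.hasDerivAt_log hslit).neg).sub (hQ u hu)
    refine this.congr_deriv ?_
    rw [dslope_of_ne _ hu0, slope_def_field, hA0]
    field_simp
    ring
  obtain ⟨k, hk⟩ := exists_eq_add_const_of_hasDerivAt (U := Metric.ball (0 : ℂ) r ∩ upperHalf)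
    (Metric.isOpen_ball.inter isOpen_upperHalf) ((convex_ball _ r).inter convex_upperHalf) h1 h2
  have hQc : ContinuousAt Q 0 := (hQ 0 (Metric.mem_ball_self hr0)).continuousAt
  have hQb : ∀ᶠ u in 𝓝 (0 : ℂ), ‖Q u‖ < ‖Q 0‖ + 1 :=
    hQc.norm.eventually (gt_mem_nhds (by linarith))
  obtain ⟨r₃, hr₃, hball₃⟩ := Metric.eventually_nhds_iff_ball.1 hQb
  refine ⟨‖Q 0‖ + 1 + ‖k‖, 1 / min r r₃, fun z hz hzn => ?_⟩
  have hz0 := hU0 z hz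
  have hm : 0 < min r r₃ := lt_min hr0 hr₃
  have hnz : 0 < ‖z‖ := norm_pos_iff.2 hz0
  have hu : ‖-1 / z‖ < min r r₃ := by
    rw [norm_div, norm_neg, norm_one, div_lt_comm₀ hnz hm]
    exact hzn
  have huu := hinv z hz
  have hk' := hk (-1 / z) ⟨by simpa using hu.trans_le (min_le_left _ _), huu⟩
  have hzz : -1 / (-1 / z) = z := by field_simp
  simp only [hzz] at hk'
  have hlog : (Complex.log (-1 / z)).re = -Real.log ‖z‖ := by
    rw [Complex.log_re, norm_div, norm_neg, norm_one, one_div, Real.log_inv]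
  have hQu := hball₃ (-1 / z) (by simpa using hu.trans_le (min_le_right _ _))
  have hQre := Complex.abs_re_le_norm (Q (-1 / z))
  have hkre := Complex.abs_re_le_norm k
  rw [hk']
  simp only [Complex.add_re, Complex.sub_re, Complex.neg_re, hlog]
  have e : - -Real.log ‖z‖ - (Q (-1 / z)).re + k.re - Real.log ‖z‖
      = k.re - (Q (-1 / z)).re := by ring
  rw [e]
  refine (abs_sub _ _).trans ?_
  linarith

/-! ### Green functions from differentials -/

/-- `R z dz` is a holomorphic differential on the upper half plane, with inverse square root
singularities at the points of `s`, real on the real line off `E`, and asymptotic to `dz / z`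
at infinity. -/
structure IsGreenDifferential (E : Set ℝ) (s : Finset ℝ) (R : ℂ → ℂ) : Prop where
  isClosed : IsClosed E
  subset : (s : Set ℝ) ⊆ E
  differentiableAt : ∀ z : ℂ, (0 < z.im ∨ z.re ∉ s) → DifferentiableAt ℂ R z
  singular : ∀ e ∈ s, ∃ A : ℂ → ℂ, AnalyticAt ℂ A e ∧
    ∀ z ∈ upperHalf, R z = A z / upperSqrt (z - e)
  real : ∀ x : ℝ, x ∉ E → (R x).im = 0
  infinity : ∃ A : ℂ → ℂ, AnalyticAt ℂ A 0 ∧ A 0 = 1 ∧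
    ∀ᶠ u in 𝓝[upperHalf] 0, R (-1 / u) = -u * A u

/-- The reflection of the plane onto the closed upper half plane. -/
noncomputable def fold (z : ℂ) : ℂ := ⟨z.re, |z.im|⟩

theorem continuous_fold : Continuous fold := by
  have : fold = fun z : ℂ => ((z.re : ℝ) : ℂ) + ((|z.im| : ℝ) : ℂ) * Complex.I := by
    funext z
    apply Complex.ext <;> simp [fold]
  rw [this]
  fun_prop

theorem fold_of_nonneg {z : ℂ} (hz : 0 ≤ z.im) : fold z = z :=
  Complex.ext rfl (abs_of_nonneg hz)

theorem fold_of_nonpos {z : ℂ} (hz : z.im ≤ 0) : fold z = (starRingEnd ℂ) z :=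
  Complex.ext rfl (by simpa [fold] using abs_of_nonpos hz)

theorem norm_fold (z : ℂ) : ‖fold z‖ = ‖z‖ := by
  rcases le_total 0 z.im with h | h
  · rw [fold_of_nonneg h]
  · rw [fold_of_nonpos h, Complex.norm_conj]

theorem isOpen_regular (s : Finset ℝ) : IsOpen {z : ℂ | 0 < z.im ∨ z.re ∉ s} := by
  have h : IsOpen ((s : Set ℝ)ᶜ) := s.finite_toSet.isClosed.isOpen_compl
  exact (isOpen_lt continuous_const Complex.continuous_im).union
    (h.preimage Complex.continuous_re)

/-- A holomorphic function on a disc centred on the real line that is real on the diameter has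
primitives symmetric in the diameter. -/
theorem re_conj_eq_of_real {P R : ℂ → ℂ} {x r : ℝ} (hr : 0 < r)
    (hP : ∀ z ∈ Metric.ball (x : ℂ) r, HasDerivAt P (R z) z)
    (hR : DifferentiableOn ℂ R (Metric.ball (x : ℂ) r))
    (hreal : ∀ᶠ t : ℝ in 𝓝 x, (R t).im = 0) {z : ℂ} (hz : z ∈ Metric.ball (x : ℂ) r) :
    (P ((starRingEnd ℂ) z)).re = (P z).re := by
  have hconj : ∀ z ∈ Metric.ball (x : ℂ) r, (starRingEnd ℂ) z ∈ Metric.ball (x : ℂ) r := by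
    intro z hz
    rw [mem_ball_iff_norm] at hz ⊢
    rw [← Complex.norm_conj]
    simpa using hz
  have hP' : ∀ z ∈ Metric.ball (x : ℂ) r,
      HasDerivAt ((starRingEnd ℂ) ∘ P ∘ (starRingEnd ℂ))
        ((starRingEnd ℂ) (R ((starRingEnd ℂ) z))) z := by
    intro z hz
    have := (hP _ (hconj z hz)).conj_conj
    simpa using this
  have hR' : DifferentiableOn ℂ (fun z => (starRingEnd ℂ) (R ((starRingEnd ℂ) z)))
      (Metric.ball (x : ℂ) r) := by
    intro z hz
    have h1 : DifferentiableAt ℂ R ((starRingEnd ℂ) z) :=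
      hR.differentiableAt (Metric.isOpen_ball.mem_nhds (hconj z hz))
    have := h1.conj_conj
    simp only [Complex.conj_conj] at this
    exact this.differentiableWithinAt
  -- R and its reflection agree on the diameter, hence on the disc by the identity theorem. So P and
  -- its reflection differ by a constant, whose real part vanishes on evaluating at the real centre.
  have heq : EqOn R (fun z => (starRingEnd ℂ) (R ((starRingEnd ℂ) z)))
      (Metric.ball (x : ℂ) r) := by
    refine AnalyticOnNhd.eqOn_of_preconnected_of_frequently_eq
      (hR.analyticOnNhd Metric.isOpen_ball) (hR'.analyticOnNhd Metric.isOpen_ball)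
      (convex_ball _ _).isPreconnected (Metric.mem_ball_self hr) ?_
    have ht : Tendsto (fun t : ℝ => (t : ℂ)) (𝓝[≠] x) (𝓝[≠] (x : ℂ)) := by
      refine tendsto_nhdsWithin_iff.2 ⟨Complex.continuous_ofReal.continuousAt.tendsto.mono_left
        nhdsWithin_le_nhds, ?_⟩
      filter_upwards [self_mem_nhdsWithin] with t ht
      simpa using ht
    have hev : ∀ᶠ t : ℝ in 𝓝[≠] x,
        R (t : ℂ) = (starRingEnd ℂ) (R ((starRingEnd ℂ) (t : ℂ))) := by
      filter_upwards [mem_nhdsWithin_of_mem_nhds hreal] with t ht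
      rw [Complex.conj_ofReal]
      exact (Complex.conj_eq_iff_im.2 ht).symm
    exact ht.frequently hev.frequently
  obtain ⟨k, hk⟩ := exists_eq_add_const_of_hasDerivAt Metric.isOpen_ball (convex_ball (x : ℂ) r)
    hP (fun z hz => by rw [heq hz]; exact hP' z hz)
  have hx := hk x (Metric.mem_ball_self hr)
  have hkre : k.re = 0 := by
    have := congrArg Complex.re hx
    simp at this
    exact this
  have := congrArg Complex.re (hk z hz)
  simp [hkre] at this
  exact this.symm

/-- The potential is the real part of a primitive on the upper half plane, extended continuously to
the real line and made even under conjugation. At real points off E evenness is harmless: R is real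
there, so the primitive already continues across the axis with symmetric real part. -/
theorem IsGreenDifferential.exists_potential {E : Set ℝ} {s : Finset ℝ} {R : ℂ → ℂ}
    (h : IsGreenDifferential E s R) :
    ∃ g : ℂ → ℝ, Continuous g ∧ HarmonicOnNhd g (((fun t : ℝ => (t : ℂ)) '' E)ᶜ) ∧
      (fun z => g z - Real.log ‖z‖) =O[Bornology.cobounded ℂ] (fun _ => (1 : ℝ)) ∧
      ∀ x : ℝ, x ∉ s → HasDerivAt (fun t : ℝ => g t) (R x).re x := by
  have hRU : DifferentiableOn ℂ R upperHalf := fun z hz =>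
    (h.differentiableAt z (Or.inl hz)).differentiableWithinAt
  obtain ⟨F, hF⟩ := exists_primitive_upperHalf hRU
  have hloc : ∀ x : ℝ, x ∉ s → ∃ r > 0, DifferentiableOn ℂ R (Metric.ball (x : ℂ) r) ∧
      ∃ P : ℂ → ℂ, (∀ z ∈ Metric.ball (x : ℂ) r, HasDerivAt P (R z) z) ∧
        EqOn F P (Metric.ball (x : ℂ) r ∩ upperHalf) := by
    intro x hx
    obtain ⟨r, hr, hball⟩ := Metric.isOpen_iff.1 (isOpen_regular s) (x : ℂ)
      (Or.inr (by simpa using hx))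
    have hd : DifferentiableOn ℂ R (Metric.ball (x : ℂ) r) := fun z hz =>
      (h.differentiableAt z (hball hz)).differentiableWithinAt
    exact ⟨r, hr, hd, exists_primitive_eqOn_ball hF hd⟩
  have hlimP : ∀ {x : ℂ} {r : ℝ} {P : ℂ → ℂ}, EqOn F P (Metric.ball x r ∩ upperHalf) →
      ∀ z ∈ Metric.ball x r, ContinuousAt P z → Tendsto F (𝓝[upperHalf] z) (𝓝 (P z)) := by
    intro x r P heq z hz hc
    refine (hc.tendsto.mono_left nhdsWithin_le_nhds).congr' ?_
    filter_upwards [mem_nhdsWithin_of_mem_nhds (Metric.isOpen_ball.mem_nhds hz),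
      self_mem_nhdsWithin] with w hw hwu
    exact (heq ⟨hw, hwu⟩).symm
  have hlim : ∀ z ∈ {z : ℂ | 0 ≤ z.im}, ∃ y, Tendsto F (𝓝[upperHalf] z) (𝓝 y) := by
    intro z hz
    rcases (show 0 ≤ z.im from hz).lt_or_eq with hz | hz
    · exact ⟨F z, (hF z hz).continuousAt.tendsto.mono_left nhdsWithin_le_nhds⟩
    · have hzr : z = (z.re : ℂ) := Complex.ext rfl (by simpa using hz.symm)
      by_cases hs : z.re ∈ s
      · obtain ⟨A, hA, hRA⟩ := h.singular _ hs
        rw [hzr]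
        exact exists_tendsto_of_singularity hF hA hRA
      · obtain ⟨r, hr, -, P, hP, heq⟩ := hloc _ hs
        have hm := Metric.mem_ball_self (x := (z.re : ℂ)) hr
        rw [hzr]
        exact ⟨_, hlimP heq _ hm (hP _ hm).continuousAt⟩
  -- F has a limit at every boundary point, including the branch points, so the extension by limits
  -- is continuous on the closed half plane.
  set G := extendFrom upperHalf F with hG
  have hGc : ContinuousOn G {z : ℂ | 0 ≤ z.im} :=
    continuousOn_extendFrom (fun z hz => mem_closure_upperHalf hz) hlim
  have hGF : ∀ z ∈ upperHalf, G z = F z :=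
    extendFrom_extends fun z hz => (hF z hz).continuousAt.continuousWithinAt
  have hGP : ∀ {x : ℂ} {r : ℝ} {P : ℂ → ℂ}, EqOn F P (Metric.ball x r ∩ upperHalf) →
      ∀ z ∈ Metric.ball x r, ContinuousAt P z → 0 ≤ z.im → G z = P z :=
    fun heq z hz hc hzi => extendFrom_eq (mem_closure_upperHalf hzi) (hlimP heq z hz hc)
  have hgc : Continuous fun z => (G (fold z)).re :=
    Complex.continuous_re.comp (hGc.comp_continuous continuous_fold fun z => abs_nonneg z.im)
  refine ⟨fun z => (G (fold z)).re, hgc, ?_, ?_, ?_⟩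
  · intro z hz
    have hanal : ∀ w ∈ upperHalf, AnalyticAt ℂ F w := fun w hw =>
      DifferentiableOn.analyticAt (s := upperHalf)
        (fun v hv => (hF v hv).differentiableAt.differentiableWithinAt)
        (isOpen_upperHalf.mem_nhds hw)
    rcases lt_trichotomy z.im 0 with hzi | hzi | hzi
    · have hlow : IsOpen {w : ℂ | w.im < 0} := isOpen_lt Complex.continuous_im continuous_const
      have hA : AnalyticAt ℂ ((starRingEnd ℂ) ∘ F ∘ (starRingEnd ℂ)) z := by
        refine DifferentiableOn.analyticAt (s := {w : ℂ | w.im < 0}) (fun v hv => ?_)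
          (hlow.mem_nhds hzi)
        have hv' : v.im < 0 := hv
        have h1 : DifferentiableAt ℂ F ((starRingEnd ℂ) v) :=
          (hF _ (by rw [mem_upperHalf, Complex.conj_im]; linarith)).differentiableAt
        have := h1.conj_conj
        simp only [Complex.conj_conj] at this
        exact this.differentiableWithinAt
      refine (harmonicAt_congr_nhds ?_).1 hA.harmonicAt_re
      filter_upwards [hlow.mem_nhds hzi] with w hw
      have hw' : w.im < 0 := hw
      rw [fold_of_nonpos hw'.le, hGF _ (by rw [mem_upperHalf, Complex.conj_im]; linarith)]
      simp
    · have hzr : z = (z.re : ℂ) := Complex.ext rfl (by simpa using hzi)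
      have hzE : z.re ∉ E := fun hE => hz ⟨z.re, hE, hzr.symm⟩
      obtain ⟨r, hr, hd, P, hP, heq⟩ := hloc z.re (fun hs => hzE (h.subset hs))
      have hball : Metric.ball (z.re : ℂ) r ∈ 𝓝 z := by
        refine Metric.isOpen_ball.mem_nhds ?_
        rw [mem_ball_iff_norm, sub_eq_zero.2 hzr, norm_zero]
        exact hr
      have hPA : AnalyticAt ℂ P z := DifferentiableOn.analyticAt
        (fun v hv => (hP v hv).differentiableAt.differentiableWithinAt) hball
      have hreal : ∀ᶠ t : ℝ in 𝓝 z.re, (R t).im = 0 := by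
        filter_upwards [h.isClosed.isOpen_compl.mem_nhds hzE] with t ht
        exact h.real t ht
      refine (harmonicAt_congr_nhds ?_).1 hPA.harmonicAt_re
      filter_upwards [hball] with w hw
      rcases le_total 0 w.im with hwi | hwi
      · rw [fold_of_nonneg hwi, hGP heq w hw (hP w hw).continuousAt hwi]
      · rw [fold_of_nonpos hwi, ← re_conj_eq_of_real hr hP hd hreal hw]
        have hw' : (starRingEnd ℂ) w ∈ Metric.ball (z.re : ℂ) r := by
          rw [mem_ball_iff_norm] at hw ⊢
          rw [← Complex.norm_conj]
          simpa using hw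
        rw [hGP heq _ hw' (hP _ hw').continuousAt (by rw [Complex.conj_im]; linarith)]
    · refine (harmonicAt_congr_nhds ?_).1 (hanal z hzi).harmonicAt_re
      filter_upwards [isOpen_upperHalf.mem_nhds hzi] with w hw
      rw [fold_of_nonneg (le_of_lt hw), hGF w hw]
  · obtain ⟨A, hA, hA0, hRA⟩ := h.infinity
    obtain ⟨C, ρ, hC⟩ := exists_bound_re_sub_log hF hA hA0 hRA
    -- The bound is known in the open half plane only; it passes to the real line by continuity.
    have hC' : ∀ z : ℂ, 0 ≤ z.im → max ρ 0 < ‖z‖ → |(G z).re - Real.log ‖z‖| ≤ C := by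
      intro z hz hzn
      have hz0 : ‖z‖ ≠ 0 := ((le_max_right ρ 0).trans_lt hzn).ne'
      have hcl := mem_closure_iff_nhdsWithin_neBot.1 (mem_closure_upperHalf hz)
      have hGz : Tendsto G (𝓝[upperHalf] z) (𝓝 (G z)) :=
        (hGc z hz).mono fun w hw => le_of_lt (mem_upperHalf.1 hw)
      have hnz : Tendsto (fun w : ℂ => ‖w‖) (𝓝[upperHalf] z) (𝓝 ‖z‖) :=
        continuous_norm.continuousAt.tendsto.mono_left nhdsWithin_le_nhds
      have ht : Tendsto (fun w => |(G w).re - Real.log ‖w‖|) (𝓝[upperHalf] z)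
          (𝓝 |(G z).re - Real.log ‖z‖|) :=
        (((Complex.continuous_re.tendsto _).comp hGz).sub (hnz.log hz0)).abs
      refine le_of_tendsto ht ?_
      filter_upwards [self_mem_nhdsWithin, hnz.eventually (lt_mem_nhds hzn)] with w hw hwn
      rw [hGF w hw]
      exact hC w hw ((le_max_left _ _).trans_lt hwn)
    refine Asymptotics.IsBigO.of_bound C ?_
    filter_upwards [tendsto_norm_cobounded_atTop.eventually (eventually_gt_atTop (max ρ 0))]
      with z hz
    have := hC' (fold z) (abs_nonneg z.im) (by rwa [norm_fold])
    rw [norm_fold] at this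
    simpa using this
  · intro x hx
    obtain ⟨r, hr, -, P, hP, heq⟩ := hloc x hx
    have hre : HasDerivAt (fun t : ℝ => (P t).re) (R x).re x :=
      (hP x (Metric.mem_ball_self hr)).real_of_complex
    refine hre.congr_of_eventuallyEq ?_
    have hball : ∀ᶠ t : ℝ in 𝓝 x, (t : ℂ) ∈ Metric.ball (x : ℂ) r :=
      Complex.continuous_ofReal.continuousAt.eventually (Metric.ball_mem_nhds _ hr)
    filter_upwards [hball] with t ht
    have ht0 : (0 : ℝ) ≤ ((t : ℂ)).im := by simp
    rw [fold_of_nonneg ht0, hGP heq _ ht (hP _ ht).continuousAt ht0]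

/-- A differential that is imaginary on `E` and has vanishing real periods gives the Green
function. -/
theorem IsGreenDifferential.exists_isGreenFunction {E : Set ℝ} {s : Finset ℝ} {R : ℂ → ℂ}
    (h : IsGreenDifferential E s R)
    (hE : ∀ f : ℝ → ℝ, Continuous f → (∀ x ∉ s, HasDerivAt f (R x).re x) →
      ∃ k, ∀ x ∈ E, f x = k) :
    ∃ g : ℂ → ℝ, IsGreenFunction ((fun t : ℝ => (t : ℂ)) '' E) g ∧
      ∀ x : ℝ, x ∉ s → HasDerivAt (fun t : ℝ => g t) (R x).re x := by
  obtain ⟨g, hgc, hgh, hgp, hgd⟩ := h.exists_potential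
  obtain ⟨k, hk⟩ := hE (fun t : ℝ => g t) (hgc.comp Complex.continuous_ofReal) hgd
  refine ⟨fun z => g z - k, ⟨?_, hgc.sub continuous_const, ?_, ?_⟩, fun x hx => ?_⟩
  · exact hgh.sub (harmonicOnNhd_const k)
  · rintro _ ⟨x, hx, rfl⟩
    simp [hk x hx]
  · have := hgp.sub (Asymptotics.isBigO_const_const k (one_ne_zero (α := ℝ))
      (Bornology.cobounded ℂ))
    refine this.congr_left fun z => ?_
    ring
  · exact (hgd x hx).sub_const k

/-! ### Differentials with prescribed branch points -/

/-- The differential `p z / ∏ √(z - e)`. -/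
noncomputable def branchDifferential (s : Finset ℝ) (p : ℂ → ℂ) (z : ℂ) : ℂ :=
  p z / ∏ e ∈ s, upperSqrt (z - e)

theorem differentiableAt_branchDifferential {s : Finset ℝ} {p : ℂ → ℂ} (hp : Differentiable ℂ p)
    {z : ℂ} (hz : 0 < z.im ∨ z.re ∉ s) : DifferentiableAt ℂ (branchDifferential s p) z := by
  have hz' : ∀ e ∈ s, 0 < (z - e).im ∨ (z - e).re ≠ 0 := by
    intro e he
    simp only [Complex.sub_im, Complex.ofReal_im, sub_zero, Complex.sub_re, Complex.ofReal_re,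
      sub_ne_zero]
    exact hz.imp id fun h h' => h (h' ▸ he)
  have hd : DifferentiableAt ℂ (fun z => ∏ e ∈ s, upperSqrt (z - e)) z :=
    DifferentiableAt.fun_finsetProd fun e he =>
      ((hasDerivAt_upperSqrt (hz' e he)).comp_sub_const z e).differentiableAt
  refine (hp z).div hd (Finset.prod_ne_zero_iff.2 fun e he => upperSqrt_ne_zero fun h => ?_)
  have := hz' e he
  simp [h] at this

/-- `hpq` and `hq0` say that p behaves like z ^ m at infinity, read in the coordinate u = -1/z. With
2(m + 1) branch points the denominator grows like z ^ (m + 1), so the quotient is asymptotic to 1/z.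
-/
theorem isGreenDifferential_branchDifferential {E : Set ℝ} {s : Finset ℝ} {p q : ℂ → ℂ} {m : ℕ}
    (hE : IsClosed E) (hs : (s : Set ℝ) ⊆ E) (hcard : s.card = 2 * (m + 1))
    (hp : Differentiable ℂ p) (hq : Differentiable ℂ q) (hq0 : q 0 = 1)
    (hpq : ∀ u : ℂ, u ≠ 0 → p (-1 / u) = (-1 / u) ^ m * q u)
    (hreal : ∀ x : ℝ, x ∉ E → (branchDifferential s p x).im = 0) :
    IsGreenDifferential E s (branchDifferential s p) where
  isClosed := hE
  subset := hs
  differentiableAt z hz := differentiableAt_branchDifferential hp hz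
  singular e he := by
    refine ⟨branchDifferential (s.erase e) p, ?_, fun z _ => ?_⟩
    · refine DifferentiableOn.analyticAt (s := {z : ℂ | 0 < z.im ∨ z.re ∉ s.erase e})
        (fun z hz => (differentiableAt_branchDifferential hp hz).differentiableWithinAt)
        ((isOpen_regular _).mem_nhds (Or.inr ?_))
      simp
    · rw [branchDifferential, branchDifferential, div_div, Finset.prod_erase_mul _ _ he]
  real := hreal
  infinity := by
    refine ⟨fun u => q u / ∏ e ∈ s, (1 + e * u) ^ (2⁻¹ : ℂ), ?_, ?_, ?_⟩
    · refine (hq.analyticAt 0).div (Finset.analyticAt_fun_prod _ fun e _ => ?_) ?_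
      · refine AnalyticAt.cpow ?_ analyticAt_const (by simp)
        fun_prop
      · simp
    · simp [hq0]
    · filter_upwards [self_mem_nhdsWithin] with u hu
      have hu' : 0 < u.im := hu
      have hu0 : u ≠ 0 := by
        rintro rfl
        simp at hu'
      have hz : 0 < (-1 / u).im := by
        have : (-1 / u).im = u.im / Complex.normSq u := by
          rw [Complex.div_im]
          simp [neg_div]
        rw [this]
        exact div_pos hu' (Complex.normSq_pos.2 hu0)
      -- Each root factors as √z times the principal root of 1 - e/z = 1 + e u, which is analytic at
      -- u = 0.
      have hprod : ∏ e ∈ s, upperSqrt (-1 / u - e)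
          = (-1 / u) ^ (m + 1) * ∏ e ∈ s, (1 + e * u) ^ (2⁻¹ : ℂ) := by
        rw [← upperSqrt_sq (-1 / u), ← pow_mul, ← hcard, ← Finset.prod_const,
          ← Finset.prod_mul_distrib]
        refine Finset.prod_congr rfl fun e _ => ?_
        rw [upperSqrt_sq, upperSqrt_sub_eq hz e]
        congr 2
        field_simp
        ring
      rw [branchDifferential, hprod, hpq u hu0, pow_succ, mul_assoc,
        mul_div_mul_left _ _ (pow_ne_zero _ (by simpa using hu0)), div_mul_eq_div_div]
      field_simp

/-! ### The complement of one interval -/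

theorem branchDifferential_pair {B : ℝ} (hB : B < 1) (p : ℂ → ℂ) (z : ℂ) :
    branchDifferential {B, 1} p z = p z / (upperSqrt (z - B) * upperSqrt (z - 1)) := by
  rw [branchDifferential, Finset.prod_pair hB.ne]
  simp

theorem upperSqrt_sub_of_le {x e : ℝ} (h : e ≤ x) :
    upperSqrt ((x : ℂ) - e) = (√(x - e) : ℝ) := by
  rw [← Complex.ofReal_sub, upperSqrt_ofReal_of_nonneg (by linarith)]

theorem upperSqrt_sub_of_ge {x e : ℝ} (h : x ≤ e) :
    upperSqrt ((x : ℂ) - e) = Complex.I * (√(e - x) : ℝ) := by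
  rw [← Complex.ofReal_sub, upperSqrt_ofReal_of_nonpos (by linarith), neg_sub]

theorem oneInterval_of_lt {B x : ℝ} (hB : B < 1) (hx : x < B) :
    branchDifferential {B, 1} (fun _ => 1) x = ((-1 / (√(B - x) * √(1 - x)) : ℝ) : ℂ) := by
  have h1 := upperSqrt_sub_of_ge hx.le
  have h2 := upperSqrt_sub_of_ge (e := 1) (hx.trans hB).le
  rw [Complex.ofReal_one] at h2
  rw [branchDifferential_pair hB, h1, h2,
    show Complex.I * ((√(B - x) : ℝ) : ℂ) * (Complex.I * ((√(1 - x) : ℝ) : ℂ))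
      = -(((√(B - x) : ℝ) : ℂ) * ((√(1 - x) : ℝ) : ℂ)) by
        linear_combination ((√(B - x) : ℝ) : ℂ) * ((√(1 - x) : ℝ) : ℂ) * Complex.I_sq]
  push_cast
  rw [div_neg, neg_div]

theorem constant_on_Icc_of_hasDerivAt_zero {f : ℝ → ℝ} (hf : Continuous f) {a b : ℝ}
    (hd : ∀ x ∈ Ioo a b, HasDerivAt f 0 x) {x : ℝ} (hx : x ∈ Icc a b) : f x = f a := by
  rcases hx.1.eq_or_lt with rfl | hax
  · rfl
  obtain ⟨y, hy, hfy⟩ := exists_hasDerivAt_eq_slope f (fun _ => 0) hax hf.continuousOn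
    fun y hy => hd y ⟨hy.1, hy.2.trans_le hx.2⟩
  rw [eq_div_iff (sub_ne_zero.2 hax.ne')] at hfy
  linarith

/-- On (B, 1) exactly one root is imaginary, so the differential is imaginary and the potential is
constant there. With a single interval there is no period to adjust, and the numerator 1 suffices.
-/
theorem exists_greenFunction_Icc {B : ℝ} (hB : B < 1) :
    ∃ g : ℂ → ℝ, IsGreenFunction ((fun t : ℝ => (t : ℂ)) '' Icc B 1) g ∧
      ∀ x < B, HasDerivAt (fun t : ℝ => g t) (-1 / (√(B - x) * √(1 - x))) x := by
  have h : IsGreenDifferential (Icc B 1) {B, 1} (branchDifferential {B, 1} fun _ => 1) := by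
    refine isGreenDifferential_branchDifferential (m := 0) (q := fun _ => 1) isClosed_Icc ?_ ?_
      (differentiable_const 1) (differentiable_const 1) rfl (by simp) ?_
    · intro e he
      simp only [Finset.coe_insert, Finset.coe_singleton, mem_insert_iff, mem_singleton_iff] at he
      rcases he with rfl | rfl
      · exact ⟨le_rfl, hB.le⟩
      · exact ⟨hB.le, le_rfl⟩
    · rw [Finset.card_pair hB.ne]
    · intro x hx
      rcases lt_or_ge x B with hxB | hxB
      · rw [oneInterval_of_lt hB hxB, Complex.ofReal_im]
      · have hx1 : 1 < x := by
          by_contra! h1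
          exact hx ⟨hxB, h1⟩
        have h2 := upperSqrt_sub_of_le hx1.le
        rw [Complex.ofReal_one] at h2
        rw [branchDifferential_pair hB, upperSqrt_sub_of_le hxB, h2, ← Complex.ofReal_mul,
          ← Complex.ofReal_one, ← Complex.ofReal_div, Complex.ofReal_im]
  obtain ⟨g, hg, hd⟩ := h.exists_isGreenFunction fun f hf hd => ⟨f B, fun x hx =>
    constant_on_Icc_of_hasDerivAt_zero hf (fun y hy => by
      have h1 := hd y (by simp [hy.1.ne', hy.2.ne])
      have h2 := upperSqrt_sub_of_ge hy.2.le
      rw [Complex.ofReal_one] at h2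
      rw [branchDifferential_pair hB, upperSqrt_sub_of_le hy.1.le, h2,
        show ((√(y - B) : ℝ) : ℂ) * (Complex.I * ((√(1 - y) : ℝ) : ℂ))
          = ((√(y - B) * √(1 - y) : ℝ) : ℂ) * Complex.I by push_cast; ring,
        ← div_div, Complex.div_I, ← Complex.ofReal_one, ← Complex.ofReal_div] at h1
      simpa using h1) hx⟩
  refine ⟨g, hg, fun x hx => ?_⟩
  have := hd x (by simp [hx.ne, (hx.trans hB).ne])
  rwa [oneInterval_of_lt hB hx, Complex.ofReal_re] at this

/-- The Green function of the complement of `[-1 + 2δ, 1]` on `(-∞, 1]`. -/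
theorem greenOne_eq {δ x : ℝ} (hδ : δ < 1) (hx : x ≤ 1) :
    greenOne δ x = Real.arcosh (max 1 ((δ - x) / (1 - δ))) := by
  have hB : -1 + 2 * δ < 1 := by linarith
  obtain ⟨g, hg, hd⟩ := exists_greenFunction_Icc hB
  rw [greenOne, hg.greenFunction_eq]
  have hδ' : 0 < 1 - δ := by linarith
  rcases le_total (-1 + 2 * δ) x with hxB | hxB
  · rw [hg.zero_on _ ⟨x, ⟨hxB, hx⟩, rfl⟩, max_eq_left, Real.arcosh_zero]
    rw [div_le_one hδ']
    linarith
  · have h1 : 1 ≤ (δ - x) / (1 - δ) := by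
      rw [one_le_div hδ']
      linarith
    rw [max_eq_right h1]
    set τ := Real.arcosh ((δ - x) / (1 - δ)) with hτ
    have hτ0 : 0 ≤ τ := Real.arcosh_nonneg h1
    have hxτ : x = δ - (1 - δ) * Real.cosh τ := by
      rw [hτ, Real.cosh_arcosh h1]
      field_simp
      ring
    have hgc : Continuous fun t : ℝ => g (t : ℂ) := hg.continuous.comp Complex.continuous_ofReal
    -- The interval has midpoint δ and half length 1 - δ. Along x = δ - (1 - δ) cosh t the Green
    -- function grows at unit speed, so it equals t.
    have hconst : ∀ y ∈ Icc 0 τ, (fun t => g ((δ - (1 - δ) * Real.cosh t : ℝ) : ℂ) - t) y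
        = (fun t => g ((δ - (1 - δ) * Real.cosh t : ℝ) : ℂ) - t) 0 := by
      intro y hy
      refine constant_on_Icc_of_hasDerivAt_zero (b := τ)
        (f := fun t => g ((δ - (1 - δ) * Real.cosh t : ℝ) : ℂ) - t) ?_ ?_ hy
      · have : Continuous fun t : ℝ => δ - (1 - δ) * Real.cosh t := by fun_prop
        exact (hgc.comp this).sub continuous_id
      · intro t ht
        have hsinh : 0 < Real.sinh t := Real.sinh_pos_iff.2 ht.1
        have hcosh : 1 < Real.cosh t := Real.one_lt_cosh.2 ht.1.ne'
        have hsq := Real.cosh_sq t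
        have h2 := hd (δ - (1 - δ) * Real.cosh t) (by nlinarith)
        have h3 : HasDerivAt (fun t : ℝ => δ - (1 - δ) * Real.cosh t)
            (-((1 - δ) * Real.sinh t)) t :=
          ((Real.hasDerivAt_cosh t).const_mul (1 - δ)).const_sub δ
        have h4 := (h2.comp t h3).sub (hasDerivAt_id t)
        refine h4.congr_deriv ?_
        rw [← Real.sqrt_mul (by nlinarith)]
        have e : (-1 + 2 * δ - (δ - (1 - δ) * Real.cosh t)) * (1 - (δ - (1 - δ) * Real.cosh t))
            = ((1 - δ) * Real.sinh t) ^ 2 := by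
          linear_combination (1 - δ) ^ 2 * hsq
        rw [e, Real.sqrt_sq (by positivity)]
        field_simp
        ring
    have h0 := hconst τ ⟨hτ0, le_rfl⟩
    have hz : g ((δ - (1 - δ) * Real.cosh 0 : ℝ) : ℂ) = 0 := by
      refine hg.zero_on _ ⟨_, ⟨?_, ?_⟩, rfl⟩ <;> simp <;> linarith
    simp only [hz, ← hxτ] at h0
    linarith

/-! ### The complement of two intervals -/

/-- The arcsine weight `1 / √(1 - t²)`. -/
noncomputable def arcWeight (t : ℝ) : ℝ := (√(1 - t ^ 2))⁻¹

/-- The integral of `v (α + δ cos θ)` over `[φ, π]`. -/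
noncomputable def arcIntegral (v : ℝ → ℝ) (δ α φ : ℝ) : ℝ :=
  ∫ θ in φ..Real.pi, v (α + δ * Real.cos θ)

/-- The critical point of the Green function in the gap. -/
noncomputable def gapCenter (δ α : ℝ) : ℝ :=
  arcIntegral (fun t => t * arcWeight t) δ α 0 / arcIntegral arcWeight δ α 0

/-- The Green function in the gap, at the point `α + δ cos φ`. -/
noncomputable def gapGreen (δ α φ : ℝ) : ℝ :=
  gapCenter δ α * arcIntegral arcWeight δ α φ - arcIntegral (fun t => t * arcWeight t) δ α φ

theorem add_mul_cos_mem_Icc {δ : ℝ} (hδ : 0 < δ) (α θ : ℝ) :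
    α + δ * Real.cos θ ∈ Icc (α - δ) (α + δ) := by
  have h1 := Real.neg_one_le_cos θ
  have h2 := Real.cos_le_one θ
  constructor <;> nlinarith

theorem add_mul_cos_mem_Ioo {δ α : ℝ} (hδ : 0 < δ) (h₁ : -1 < α - δ) (h₂ : α + δ < 1) (θ : ℝ) :
    α + δ * Real.cos θ ∈ Ioo (-1 : ℝ) 1 :=
  Icc_subset_Ioo h₁ h₂ (add_mul_cos_mem_Icc hδ α θ)

theorem one_sub_sq_pos {t : ℝ} (ht : t ∈ Ioo (-1 : ℝ) 1) : 0 < 1 - t ^ 2 := by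
  nlinarith [ht.1, ht.2]

theorem arcWeight_pos {t : ℝ} (ht : t ∈ Ioo (-1 : ℝ) 1) : 0 < arcWeight t :=
  inv_pos.2 (Real.sqrt_pos.2 (one_sub_sq_pos ht))

theorem continuousOn_arcWeight : ContinuousOn arcWeight (Ioo (-1) 1) := by
  refine ContinuousOn.inv₀ (by fun_prop) fun t ht => ?_
  exact (Real.sqrt_pos.2 (one_sub_sq_pos ht)).ne'

theorem continuousOn_id_mul_arcWeight : ContinuousOn (fun t => t * arcWeight t) (Ioo (-1) 1) :=
  continuousOn_id.mul continuousOn_arcWeight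

theorem continuous_comp_arc {v : ℝ → ℝ} (hv : ContinuousOn v (Ioo (-1) 1)) {δ α : ℝ} (hδ : 0 < δ)
    (h₁ : -1 < α - δ) (h₂ : α + δ < 1) : Continuous fun θ => v (α + δ * Real.cos θ) :=
  hv.comp_continuous (by fun_prop) fun θ => add_mul_cos_mem_Ioo hδ h₁ h₂ θ

theorem arcIntegral_arcWeight_pos {δ α φ : ℝ} (hδ : 0 < δ) (h₁ : -1 < α - δ) (h₂ : α + δ < 1)
    (hφ : φ < Real.pi) : 0 < arcIntegral arcWeight δ α φ :=
  intervalIntegral.intervalIntegral_pos_of_pos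
    ((continuous_comp_arc continuousOn_arcWeight hδ h₁ h₂).intervalIntegrable _ _)
    (fun θ => arcWeight_pos (add_mul_cos_mem_Ioo hδ h₁ h₂ θ)) hφ

/-- This vanishing period across the whole gap is what determines `gapCenter`. -/
theorem gapGreen_zero {δ α : ℝ} (hδ : 0 < δ) (h₁ : -1 < α - δ) (h₂ : α + δ < 1) :
    gapGreen δ α 0 = 0 := by
  rw [gapGreen, gapCenter, div_mul_cancel₀ _
    (arcIntegral_arcWeight_pos hδ h₁ h₂ Real.pi_pos).ne', sub_self]

theorem gapGreen_pi (δ α : ℝ) : gapGreen δ α Real.pi = 0 := by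
  simp [gapGreen, arcIntegral]

theorem gapGreen_eq_integral {δ α : ℝ} (hδ : 0 < δ) (h₁ : -1 < α - δ) (h₂ : α + δ < 1) (φ : ℝ) :
    gapGreen δ α φ = ∫ θ in φ..Real.pi,
      (gapCenter δ α - (α + δ * Real.cos θ)) * arcWeight (α + δ * Real.cos θ) := by
  rw [gapGreen, arcIntegral, arcIntegral, ← intervalIntegral.integral_const_mul,
    ← intervalIntegral.integral_sub]
  · congr 1
    funext θ
    ring
  · exact ((continuous_comp_arc continuousOn_arcWeight hδ h₁ h₂).intervalIntegrable _ _).const_mul _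
  · exact (continuous_comp_arc continuousOn_id_mul_arcWeight hδ h₁ h₂).intervalIntegrable _ _

/-- The differential of the Green function of two intervals. -/
noncomputable def twoDifferential (δ α : ℝ) : ℂ → ℂ :=
  branchDifferential {-1, α - δ, α + δ, 1} (fun z => z - gapCenter δ α)

theorem twoDifferential_apply {δ α : ℝ} (hδ : 0 < δ) (h₁ : -1 < α - δ) (h₂ : α + δ < 1) (z : ℂ) :
    twoDifferential δ α z = (z - gapCenter δ α) /
      (upperSqrt (z - (-1 : ℝ)) * (upperSqrt (z - (α - δ : ℝ)) *
        (upperSqrt (z - (α + δ : ℝ)) * upperSqrt (z - (1 : ℝ))))) := by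
  rw [twoDifferential, branchDifferential, Finset.prod_insert, Finset.prod_insert,
    Finset.prod_pair h₂.ne]
  · simp only [Finset.mem_insert, Finset.mem_singleton, not_or]
    constructor <;> apply ne_of_lt <;> linarith
  · simp only [Finset.mem_insert, Finset.mem_singleton, not_or]
    refine ⟨?_, ?_, ?_⟩ <;> apply ne_of_lt <;> linarith

theorem re_div_I_mul (y r : ℝ) : ((y : ℂ) / (Complex.I * r)).re = 0 := by
  rw [mul_comm, ← div_div, Complex.div_I, ← Complex.ofReal_div]
  simp

/-- Each branch point to the right of x contributes a factor i. On the left interval there are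
three, on the right one; an odd number makes the denominator imaginary. -/
theorem re_twoDifferential_of_mem {δ α : ℝ} (hδ : 0 < δ) (h₁ : -1 < α - δ) (h₂ : α + δ < 1)
    {x : ℝ} (hx : x ∈ Icc (-1) (α - δ) ∪ Icc (α + δ) 1) : (twoDifferential δ α x).re = 0 := by
  rw [twoDifferential_apply hδ h₁ h₂, ← Complex.ofReal_sub]
  rcases hx with hx | hx
  · rw [upperSqrt_sub_of_le hx.1, upperSqrt_sub_of_ge hx.2,
      upperSqrt_sub_of_ge (by linarith [hx.2] : x ≤ α + δ),
      upperSqrt_sub_of_ge (by linarith [hx.2] : x ≤ 1)]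
    have : ((√(x - -1) : ℝ) : ℂ) * (Complex.I * (√(α - δ - x) : ℝ) *
        (Complex.I * (√(α + δ - x) : ℝ) * (Complex.I * (√(1 - x) : ℝ))))
        = Complex.I * ((-(√(x - -1) * √(α - δ - x) * √(α + δ - x) * √(1 - x)) : ℝ) : ℂ) := by
      push_cast
      linear_combination (((√(x - -1) : ℝ) : ℂ) * (√(α - δ - x) : ℝ) * (√(α + δ - x) : ℝ) *
        (√(1 - x) : ℝ) * Complex.I) * Complex.I_sq
    rw [this, re_div_I_mul]
  · rw [upperSqrt_sub_of_le (by linarith [hx.1] : -1 ≤ x),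
      upperSqrt_sub_of_le (by linarith [hx.1] : α - δ ≤ x), upperSqrt_sub_of_le hx.1,
      upperSqrt_sub_of_ge hx.2]
    have : ((√(x - -1) : ℝ) : ℂ) * ((√(x - (α - δ)) : ℝ) *
        ((√(x - (α + δ)) : ℝ) * (Complex.I * (√(1 - x) : ℝ))))
        = Complex.I * ((√(x - -1) * √(x - (α - δ)) * √(x - (α + δ)) * √(1 - x) : ℝ) : ℂ) := by
      push_cast
      ring
    rw [this, re_div_I_mul]

/-- Two branch points lie to the right, so i² = -1 reverses the sign of the numerator. -/
theorem twoDifferential_of_mem_gap {δ α : ℝ} (hδ : 0 < δ) (h₁ : -1 < α - δ) (h₂ : α + δ < 1)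
    {x : ℝ} (hx : x ∈ Icc (α - δ) (α + δ)) : twoDifferential δ α x =
      (((gapCenter δ α - x) /
        (√(x - -1) * √(x - (α - δ)) * (√(α + δ - x) * √(1 - x))) : ℝ) : ℂ) := by
  rw [twoDifferential_apply hδ h₁ h₂, upperSqrt_sub_of_le (by linarith [hx.1] : -1 ≤ x),
    upperSqrt_sub_of_le hx.1, upperSqrt_sub_of_ge hx.2,
    upperSqrt_sub_of_ge (by linarith [hx.2] : x ≤ 1)]
  have : ((√(x - -1) : ℝ) : ℂ) * ((√(x - (α - δ)) : ℝ) *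
      (Complex.I * (√(α + δ - x) : ℝ) * (Complex.I * (√(1 - x) : ℝ))))
      = -((√(x - -1) * √(x - (α - δ)) * (√(α + δ - x) * √(1 - x)) : ℝ) : ℂ) := by
    push_cast
    linear_combination (((√(x - -1) : ℝ) : ℂ) * (√(x - (α - δ)) : ℝ) * (√(α + δ - x) : ℝ) *
      (√(1 - x) : ℝ)) * Complex.I_sq
  rw [this, div_neg, ← neg_div, neg_sub]
  push_cast
  rfl

theorem im_twoDifferential_of_notMem {δ α : ℝ} (hδ : 0 < δ) (h₁ : -1 < α - δ) (h₂ : α + δ < 1)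
    {x : ℝ} (hx : x ∉ twoIntervals α δ) : (twoDifferential δ α x).im = 0 := by
  rcases lt_or_ge x (-1) with hx1 | hx1
  · rw [twoDifferential_apply hδ h₁ h₂, upperSqrt_sub_of_ge hx1.le,
      upperSqrt_sub_of_ge (by linarith : x ≤ α - δ), upperSqrt_sub_of_ge (by linarith : x ≤ α + δ),
      upperSqrt_sub_of_ge (by linarith : x ≤ 1)]
    have : Complex.I * ((√(-1 - x) : ℝ) : ℂ) * (Complex.I * (√(α - δ - x) : ℝ) *
        (Complex.I * (√(α + δ - x) : ℝ) * (Complex.I * (√(1 - x) : ℝ))))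
        = ((√(-1 - x) * √(α - δ - x) * √(α + δ - x) * √(1 - x) : ℝ) : ℂ) := by
      push_cast
      linear_combination (((√(-1 - x) : ℝ) : ℂ) * (√(α - δ - x) : ℝ) * (√(α + δ - x) : ℝ) *
        (√(1 - x) : ℝ)) * Complex.I_pow_four
    rw [this, ← Complex.ofReal_sub, ← Complex.ofReal_div, Complex.ofReal_im]
  rcases lt_or_ge 1 x with hx2 | hx2
  · rw [twoDifferential_apply hδ h₁ h₂, upperSqrt_sub_of_le hx1,
      upperSqrt_sub_of_le (by linarith : α - δ ≤ x), upperSqrt_sub_of_le (by linarith : α + δ ≤ x),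
      upperSqrt_sub_of_le hx2.le]
    simp only [← Complex.ofReal_sub, ← Complex.ofReal_mul, ← Complex.ofReal_div, Complex.ofReal_im]
  · have hgap : x ∈ Ioo (α - δ) (α + δ) := by
      by_contra h
      exact hx ⟨⟨hx1, hx2⟩, h⟩
    rw [twoDifferential_of_mem_gap hδ h₁ h₂ (Ioo_subset_Icc_self hgap), Complex.ofReal_im]

theorem twoIntervals_eq {δ α : ℝ} (h₁ : -1 < α - δ) (h₂ : α + δ < 1) (hδ : 0 < δ) :
    twoIntervals α δ = Icc (-1) (α - δ) ∪ Icc (α + δ) 1 := by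
  ext x
  simp only [twoIntervals, Set.mem_sdiff, mem_Icc, mem_Ioo, mem_union, not_and, not_lt]
  constructor
  · rintro ⟨⟨h3, h4⟩, h5⟩
    rcases le_or_gt x (α - δ) with h | h
    · exact Or.inl ⟨h3, h⟩
    · exact Or.inr ⟨h5 h, h4⟩
  · rintro (⟨h3, h4⟩ | ⟨h3, h4⟩)
    · exact ⟨⟨h3, by linarith⟩, fun h => by linarith⟩
    · exact ⟨⟨by linarith, h4⟩, fun _ => h3⟩

/-- A primitive on the real line of the differential of two intervals, in the gap. -/
theorem sub_eq_gapGreen {δ α : ℝ} (hδ : 0 < δ) (h₁ : -1 < α - δ) (h₂ : α + δ < 1) {f : ℝ → ℝ}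
    (hf : Continuous f)
    (hd : ∀ x ∉ ({-1, α - δ, α + δ, 1} : Finset ℝ), HasDerivAt f (twoDifferential δ α x).re x)
    {φ : ℝ} (hφ : φ ∈ Icc 0 Real.pi) :
    f (α + δ * Real.cos φ) - f (α - δ) = gapGreen δ α φ := by
  have hcont : Continuous fun θ =>
      (gapCenter δ α - (α + δ * Real.cos θ)) * arcWeight (α + δ * Real.cos θ) :=
    (by fun_prop : Continuous fun θ => gapCenter δ α - (α + δ * Real.cos θ)).mul
      (continuous_comp_arc continuousOn_arcWeight hδ h₁ h₂)
  have hcomp : Continuous fun θ => -f (α + δ * Real.cos θ) :=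
    (hf.comp (by fun_prop)).neg
  rw [gapGreen_eq_integral hδ h₁ h₂, intervalIntegral.integral_eq_sub_of_hasDerivAt_of_le hφ.2
    hcomp.continuousOn (f' := fun θ =>
      (gapCenter δ α - (α + δ * Real.cos θ)) * arcWeight (α + δ * Real.cos θ)) ?_
    (hcont.intervalIntegrable _ _)]
  · rw [Real.cos_pi]
    ring_nf
  · intro θ hθ
    have hsin : 0 < Real.sin θ := Real.sin_pos_of_pos_of_lt_pi (hφ.1.trans_lt hθ.1) hθ.2
    have hsq := Real.sin_sq_add_cos_sq θ
    have hc1 : Real.cos θ < 1 := by nlinarith [Real.cos_le_one θ]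
    have hc2 : -1 < Real.cos θ := by nlinarith [Real.neg_one_le_cos θ]
    set t := α + δ * Real.cos θ with ht
    have hta : α - δ < t := by nlinarith
    have htb : t < α + δ := by nlinarith
    have ht1 : t ∈ Ioo (-1 : ℝ) 1 := ⟨by linarith, by linarith⟩
    have hd' := hd t (by
      simp only [Finset.mem_insert, Finset.mem_singleton, not_or]
      exact ⟨ht1.1.ne', hta.ne', htb.ne, ht1.2.ne⟩)
    rw [twoDifferential_of_mem_gap hδ h₁ h₂ ⟨hta.le, htb.le⟩, Complex.ofReal_re] at hd'
    have hcos : HasDerivAt (fun θ => α + δ * Real.cos θ) (δ * -Real.sin θ) θ :=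
      ((Real.hasDerivAt_cos θ).const_mul δ).const_add α
    refine ((hd'.comp θ hcos).neg).congr_deriv ?_
    -- The roots at the two ends of the gap cancel against dt = -δ sin θ dθ, leaving only the weight
    -- 1/√(1 - t²).
    have e1 : √(t - (α - δ)) * √(α + δ - t) = δ * Real.sin θ := by
      rw [← Real.sqrt_mul (by linarith)]
      have : (t - (α - δ)) * (α + δ - t) = (δ * Real.sin θ) ^ 2 := by
        rw [ht]
        linear_combination (-δ ^ 2) * hsq
      rw [this, Real.sqrt_sq (by positivity)]
    have e2 : √(t - -1) * √(1 - t) = √(1 - t ^ 2) := by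
      rw [← Real.sqrt_mul (by linarith [ht1.1])]
      congr 1
      ring
    have e3 : √(t - -1) * √(t - (α - δ)) * (√(α + δ - t) * √(1 - t))
        = (δ * Real.sin θ) * √(1 - t ^ 2) := by
      rw [← e1, ← e2]
      ring
    have hw : √(1 - t ^ 2) ≠ 0 := (Real.sqrt_pos.2 (one_sub_sq_pos ht1)).ne'
    rw [e3, arcWeight]
    field_simp

/-- The potential is constant on each interval because the differential is imaginary there, and the
two constants agree by `gapGreen_zero`. Inside the gap the potential is found by integrating from
the left end, φ = π. -/
theorem exists_greenFunction_twoIntervals {δ α : ℝ} (hδ : 0 < δ) (h₁ : -1 < α - δ)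
    (h₂ : α + δ < 1) :
    ∃ g : ℂ → ℝ, IsGreenFunction ((fun t : ℝ => (t : ℂ)) '' twoIntervals α δ) g ∧
      ∀ φ ∈ Icc 0 Real.pi, g ((α + δ * Real.cos φ : ℝ) : ℂ) = gapGreen δ α φ := by
  have hE := twoIntervals_eq h₁ h₂ hδ
  have h : IsGreenDifferential (twoIntervals α δ) {-1, α - δ, α + δ, 1}
      (twoDifferential δ α) := by
    refine isGreenDifferential_branchDifferential (m := 1) (q := fun u => 1 + gapCenter δ α * u)
      (hE ▸ isClosed_Icc.union isClosed_Icc) ?_ ?_ (by fun_prop) (by fun_prop) (by simp) ?_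
      fun x hx => im_twoDifferential_of_notMem hδ h₁ h₂ hx
    · rw [hE]
      intro e he
      simp only [Finset.coe_insert, Finset.coe_singleton, mem_insert_iff, mem_singleton_iff] at he
      rcases he with rfl | rfl | rfl | rfl
      · exact Or.inl ⟨le_rfl, h₁.le⟩
      · exact Or.inl ⟨h₁.le, le_rfl⟩
      · exact Or.inr ⟨le_rfl, h₂.le⟩
      · exact Or.inr ⟨h₂.le, le_rfl⟩
    · rw [Finset.card_insert_of_notMem, Finset.card_insert_of_notMem, Finset.card_pair h₂.ne]
      · simp only [Finset.mem_insert, Finset.mem_singleton, not_or]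
        constructor <;> apply ne_of_lt <;> linarith
      · simp only [Finset.mem_insert, Finset.mem_singleton, not_or]
        refine ⟨?_, ?_, ?_⟩ <;> apply ne_of_lt <;> linarith
    · intro u hu
      field_simp
      ring
  have hmem : ∀ x, x ≠ -1 → x ≠ α - δ → x ≠ α + δ → x ≠ 1 →
      x ∉ ({-1, α - δ, α + δ, 1} : Finset ℝ) := by
    intro x a b c d
    simp [a, b, c, d]
  obtain ⟨g, hg, hd⟩ := h.exists_isGreenFunction fun f hf hd => by
    have hgap := sub_eq_gapGreen hδ h₁ h₂ hf hd ⟨le_rfl, Real.pi_pos.le⟩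
    rw [gapGreen_zero hδ h₁ h₂, Real.cos_zero, mul_one, sub_eq_zero] at hgap
    have hleft : ∀ x ∈ Icc (-1) (α - δ), f x = f (-1) := fun x hx =>
      constant_on_Icc_of_hasDerivAt_zero hf (fun y hy => by
        have := hd y (hmem y hy.1.ne' hy.2.ne (by linarith [hy.2]) (by linarith [hy.2]))
        rwa [re_twoDifferential_of_mem hδ h₁ h₂ (Or.inl (Ioo_subset_Icc_self hy))] at this) hx
    have hright : ∀ x ∈ Icc (α + δ) 1, f x = f (α + δ) := fun x hx =>
      constant_on_Icc_of_hasDerivAt_zero hf (fun y hy => by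
        have := hd y (hmem y (by linarith [hy.1]) (by linarith [hy.1]) hy.1.ne' hy.2.ne)
        rwa [re_twoDifferential_of_mem hδ h₁ h₂ (Or.inr (Ioo_subset_Icc_self hy))] at this) hx
    refine ⟨f (-1), fun x hx => ?_⟩
    rw [hE] at hx
    rcases hx with hx | hx
    · exact hleft x hx
    · rw [hright x hx, hgap, hleft _ ⟨h₁.le, le_rfl⟩]
  refine ⟨g, hg, fun φ hφ => ?_⟩
  rw [← sub_eq_gapGreen hδ h₁ h₂ (f := fun t : ℝ => g t)
    (hg.continuous.comp Complex.continuous_ofReal) hd hφ,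
    hg.zero_on ((α - δ : ℝ) : ℂ) ⟨α - δ, hE ▸ Or.inl ⟨h₁.le, le_rfl⟩, rfl⟩, sub_zero]

/-- Outside the gap `Real.arccos` is clamped to 0 or π, where `gapGreen` vanishes. One formula thus
serves all of [-1, 1], and continuity in α needs no separate case when x enters or leaves the gap.
-/
theorem greenTwo_eq_gapGreen {δ α x : ℝ} (hδ : 0 < δ) (h₁ : -1 < α - δ) (h₂ : α + δ < 1)
    (hx : x ∈ Icc (-1 : ℝ) 1) :
    greenTwo α δ x = gapGreen δ α (Real.arccos ((x - α) / δ)) := by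
  obtain ⟨g, hg, hgap⟩ := exists_greenFunction_twoIntervals hδ h₁ h₂
  rw [greenTwo, hg.greenFunction_eq]
  rcases le_or_gt x (α - δ) with hl | hl
  · rw [Real.arccos_of_le_neg_one, gapGreen_pi]
    · refine hg.zero_on _ ⟨x, ⟨hx, fun h => ?_⟩, rfl⟩
      linarith [h.1]
    · rw [div_le_iff₀ hδ]
      linarith
  rcases le_or_gt (α + δ) x with hr | hr
  · rw [Real.arccos_of_one_le, gapGreen_zero hδ h₁ h₂]
    · refine hg.zero_on _ ⟨x, ⟨hx, fun h => ?_⟩, rfl⟩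
      linarith [h.2]
    · rw [le_div_iff₀ hδ]
      linarith
  · rw [← hgap _ ⟨Real.arccos_nonneg _, Real.arccos_le_pi _⟩, Real.cos_arccos,
      mul_div_cancel₀ _ hδ.ne']
    · simp
    · rw [le_div_iff₀ hδ]
      linarith
    · rw [div_le_iff₀ hδ]
      linarith

theorem greenTwo_nonneg {δ α : ℝ} (hδ : 0 < δ) (h₁ : -1 < α - δ) (h₂ : α + δ < 1) (x : ℝ) :
    0 ≤ greenTwo α δ x := by
  obtain ⟨g, hg, -⟩ := exists_greenFunction_twoIntervals hδ h₁ h₂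
  rw [greenTwo, hg.greenFunction_eq]
  exact hg.nonneg _

theorem greenTwo_eq_zero {δ α x : ℝ} (hδ : 0 < δ) (h₁ : -1 < α - δ) (h₂ : α + δ < 1)
    (hx : x ∈ twoIntervals α δ) : greenTwo α δ x = 0 := by
  obtain ⟨g, hg, -⟩ := exists_greenFunction_twoIntervals hδ h₁ h₂
  rw [greenTwo, hg.greenFunction_eq]
  exact hg.zero_on _ ⟨x, hx, rfl⟩

/-- The Green function of two intervals is at most that of the right hand one. -/
theorem greenTwo_le_greenOne {δ α : ℝ} (hδ : 0 < δ) (h₁ : -1 < α - δ) (h₂ : α + δ < 1) (x : ℝ) :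
    greenTwo α δ x ≤ greenOne ((1 + α + δ) / 2) x := by
  obtain ⟨g, hg, -⟩ := exists_greenFunction_twoIntervals hδ h₁ h₂
  obtain ⟨g', hg', -⟩ := exists_greenFunction_Icc h₂
  have e : -1 + 2 * ((1 + α + δ) / 2) = α + δ := by ring
  rw [greenTwo, greenOne, hg.greenFunction_eq, e, hg'.greenFunction_eq]
  refine hg'.le_of_subset hg (image_mono fun t ht => ?_) _
  rw [twoIntervals_eq h₁ h₂ hδ]
  exact Or.inr ht

/-! ### Integrals over arcs as functions of the centre and the angle -/

theorem continuous_arcIntegral {v : ℝ → ℝ} (hv : Continuous v) (δ : ℝ) :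
    Continuous fun p : ℝ × ℝ => arcIntegral v δ p.1 p.2 := by
  have h : (fun p : ℝ × ℝ => arcIntegral v δ p.1 p.2)
      = fun p : ℝ × ℝ => -∫ θ in Real.pi..p.2, v (p.1 + δ * Real.cos θ) := by
    funext p
    rw [arcIntegral, intervalIntegral.integral_symm]
  rw [h]
  refine (intervalIntegral.continuous_parametric_intervalIntegral_of_continuous
    (f := fun (p : ℝ × ℝ) θ => v (p.1 + δ * Real.cos θ)) ?_ continuous_snd).neg
  simp only [Function.uncurry_def]
  fun_prop

/-- In the angular variable the range of integration does not move with the centre, so only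
differentiation under the integral is involved. -/
theorem hasDerivAt_arcIntegral_center {v v' : ℝ → ℝ} (hv : ∀ t, HasDerivAt v (v' t) t)
    (hv' : Continuous v') (δ α φ : ℝ) :
    HasDerivAt (fun β => arcIntegral v δ β φ) (arcIntegral v' δ α φ) α := by
  have hvc : Continuous v := continuous_iff_continuousAt.2 fun t => (hv t).continuousAt
  obtain ⟨M, hM⟩ := (isCompact_Icc (a := α - 1 - |δ|)
    (b := α + 1 + |δ|)).exists_bound_of_continuousOn hv'.continuousOn
  refine (intervalIntegral.hasDerivAt_integral_of_dominated_loc_of_deriv_le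
    (F := fun β θ => v (β + δ * Real.cos θ)) (F' := fun β θ => v' (β + δ * Real.cos θ))
    (bound := fun _ => M) (Metric.ball_mem_nhds α one_pos) ?_ ?_ ?_ ?_ ?_ ?_).2
  · exact Eventually.of_forall fun β =>
      (by fun_prop : Continuous fun θ => v (β + δ * Real.cos θ)).aestronglyMeasurable
  · exact (by fun_prop : Continuous fun θ => v (α + δ * Real.cos θ)).intervalIntegrable _ _
  · exact (by fun_prop : Continuous fun θ => v' (α + δ * Real.cos θ)).aestronglyMeasurable
  · refine Eventually.of_forall fun θ _ β hβ => hM _ ?_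
    rw [Metric.mem_ball, Real.dist_eq, abs_lt] at hβ
    have h1 : |δ * Real.cos θ| ≤ |δ| := by
      rw [abs_mul]
      exact mul_le_of_le_one_right (abs_nonneg δ) (Real.abs_cos_le_one θ)
    rw [abs_le] at h1
    constructor <;> linarith [h1.1, h1.2, hβ.1, hβ.2]
  · exact intervalIntegrable_const
  · exact Eventually.of_forall fun θ _ β _ => (hv _).comp_add_const β _

theorem hasDerivAt_arcIntegral_angle {v : ℝ → ℝ} (hv : Continuous v) (δ α φ : ℝ) :
    HasDerivAt (fun ψ => arcIntegral v δ α ψ) (-v (α + δ * Real.cos φ)) φ := by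
  have hc : Continuous fun θ => v (α + δ * Real.cos θ) := by fun_prop
  exact intervalIntegral.integral_hasDerivAt_left (hc.intervalIntegrable _ _)
    hc.aestronglyMeasurable.stronglyMeasurableAtFilter hc.continuousAt

theorem hasDerivAt_arcIntegral_of_global {v v' : ℝ → ℝ} (hv : ∀ t, HasDerivAt v (v' t) t)
    (hv' : Continuous v') {δ α φ' : ℝ} {φ : ℝ → ℝ} (hφ : HasDerivAt φ φ' α) :
    HasDerivAt (fun β => arcIntegral v δ β (φ β))
      (arcIntegral v' δ α (φ α) - φ' * v (α + δ * Real.cos (φ α))) α := by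
  have hvc : Continuous v := continuous_iff_continuousAt.2 fun t => (hv t).continuousAt
  have h := hasStrictFDerivAt_uncurry_coprod (𝕜 := ℝ) (u := (α, φ α))
    (f := fun β ψ => arcIntegral v δ β ψ)
    (f₁ := fun β ψ => ContinuousLinearMap.toSpanSingleton ℝ (arcIntegral v' δ β ψ))
    (f₂ := fun β ψ => ContinuousLinearMap.toSpanSingleton ℝ (-v (β + δ * Real.cos ψ)))
    (Eventually.of_forall fun p => (hasDerivAt_arcIntegral_center hv hv' δ p.1 p.2).hasFDerivAt)
    (Eventually.of_forall fun p => (hasDerivAt_arcIntegral_angle hvc δ p.1 p.2).hasFDerivAt)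
    (((ContinuousLinearMap.toSpanSingletonCLE (𝕜 := ℝ) (E := ℝ)).continuous.comp
      (continuous_arcIntegral hv' δ)).continuousAt)
    (((ContinuousLinearMap.toSpanSingletonCLE (𝕜 := ℝ) (E := ℝ)).continuous.comp
      (by fun_prop : Continuous fun p : ℝ × ℝ => -v (p.1 + δ * Real.cos p.2))).continuousAt)
  have h2 := h.hasFDerivAt.comp_hasDerivAt α ((hasDerivAt_id α).prodMk hφ)
  refine h2.congr_deriv ?_
  simp [Function.HasUncurry.uncurry]
  ring

theorem arcIntegral_congr {v V : ℝ → ℝ} {lo hi : ℝ} (hV : EqOn V v (Icc lo hi)) {δ β : ℝ}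
    (hδ : 0 < δ) (h₁ : lo ≤ β - δ) (h₂ : β + δ ≤ hi) (φ : ℝ) :
    arcIntegral v δ β φ = arcIntegral V δ β φ := by
  rw [arcIntegral, arcIntegral]
  congr 1
  funext θ
  exact (hV (Icc_subset_Icc h₁ h₂ (add_mul_cos_mem_Icc hδ β θ))).symm

theorem continuousAt_arcIntegral {v : ℝ → ℝ} (hv : ContinuousOn v (Ioo (-1) 1)) {δ α : ℝ}
    (hδ : 0 < δ) (h₁ : -1 < α - δ) (h₂ : α + δ < 1) (φ : ℝ) :
    ContinuousAt (fun p : ℝ × ℝ => arcIntegral v δ p.1 p.2) (α, φ) := by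
  obtain ⟨lo, hlo, hlo'⟩ := exists_between h₁
  obtain ⟨hi, hhi, hhi'⟩ := exists_between h₂
  have hle : lo ≤ hi := by linarith
  -- The integrals see only values in [lo, hi] for centres near α, so v may be replaced by a
  -- globally continuous extension.
  set V := IccExtend hle ((Icc lo hi).domRestrict v) with hV
  have hVc : Continuous V :=
    (continuousOn_iff_continuous_domRestrict.1 (hv.mono (Icc_subset_Ioo hlo hhi'))).Icc_extend'
  have hVv : EqOn V v (Icc lo hi) := fun t ht => by
    rw [hV, IccExtend_of_mem hle _ ht]
    rfl
  refine (continuous_arcIntegral hVc δ).continuousAt.congr ?_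
  have e1 : ∀ᶠ p : ℝ × ℝ in 𝓝 (α, φ), lo < p.1 - δ :=
    (by fun_prop : Continuous fun p : ℝ × ℝ => p.1 - δ).continuousAt.eventually (lt_mem_nhds hlo')
  have e2 : ∀ᶠ p : ℝ × ℝ in 𝓝 (α, φ), p.1 + δ < hi :=
    (by fun_prop : Continuous fun p : ℝ × ℝ => p.1 + δ).continuousAt.eventually (gt_mem_nhds hhi)
  filter_upwards [e1, e2] with p hp1 hp2
  exact (arcIntegral_congr hVv hδ hp1.le hp2.le p.2).symm

theorem hasDerivAt_arcIntegral {v v' : ℝ → ℝ} (hv : ∀ t ∈ Ioo (-1 : ℝ) 1, HasDerivAt v (v' t) t)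
    (hv' : ContinuousOn v' (Ioo (-1) 1)) {δ α φ' : ℝ} {φ : ℝ → ℝ} (hδ : 0 < δ) (h₁ : -1 < α - δ)
    (h₂ : α + δ < 1) (hφ : HasDerivAt φ φ' α) :
    HasDerivAt (fun β => arcIntegral v δ β (φ β))
      (arcIntegral v' δ α (φ α) - φ' * v (α + δ * Real.cos (φ α))) α := by
  obtain ⟨lo, hlo, hlo'⟩ := exists_between h₁
  obtain ⟨hi, hhi, hhi'⟩ := exists_between h₂
  have hle : lo ≤ hi := by linarith
  have hsub : Icc lo hi ⊆ Ioo (-1 : ℝ) 1 := Icc_subset_Ioo hlo hhi'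
  set V' := IccExtend hle ((Icc lo hi).domRestrict v') with hV'
  have hVc' : Continuous V' :=
    (continuousOn_iff_continuous_domRestrict.1 (hv'.mono hsub)).Icc_extend'
  have hVv' : EqOn V' v' (Icc lo hi) := fun t ht => by
    rw [hV', IccExtend_of_mem hle _ ht]
    rfl
  -- Extending v itself by constants would lose differentiability at lo and hi. Extending v' and
  -- integrating gives a globally C¹ function equal to v on [lo, hi].
  set V := fun t => v lo + ∫ r in lo..t, V' r with hV
  have hVd : ∀ t, HasDerivAt V (V' t) t := fun t =>
    (intervalIntegral.integral_hasDerivAt_right (hVc'.intervalIntegrable _ _)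
      hVc'.aestronglyMeasurable.stronglyMeasurableAtFilter hVc'.continuousAt).const_add _
  have hVv : EqOn V v (Icc lo hi) := by
    intro t ht
    have h_integral : ∫ r in lo..t, V' r = v t - v lo := by
      refine intervalIntegral.integral_eq_sub_of_hasDerivAt (fun r hr => ?_)
        (hVc'.intervalIntegrable _ _)
      rw [uIcc_of_le ht.1] at hr
      have hr' : r ∈ Icc lo hi := ⟨hr.1, hr.2.trans ht.2⟩
      rw [hVv' hr']
      exact hv r (hsub hr')
    simp only [hV, h_integral]
    ring
  have h := hasDerivAt_arcIntegral_of_global (δ := δ) hVd hVc' hφ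
  rw [← arcIntegral_congr hVv' hδ hlo'.le hhi.le,
    hVv (Icc_subset_Icc hlo'.le hhi.le (add_mul_cos_mem_Icc hδ α _))] at h
  refine h.congr_of_eventuallyEq ?_
  have e1 : ∀ᶠ β : ℝ in 𝓝 α, lo < β - δ :=
    (by fun_prop : Continuous fun β : ℝ => β - δ).continuousAt.eventually (lt_mem_nhds hlo')
  have e2 : ∀ᶠ β : ℝ in 𝓝 α, β + δ < hi :=
    (by fun_prop : Continuous fun β : ℝ => β + δ).continuousAt.eventually (gt_mem_nhds hhi)
  filter_upwards [e1, e2] with β hβ1 hβ2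
  exact arcIntegral_congr hVv hδ hβ1.le hβ2.le (φ β)

/-! ### Variation of the Green function with the gap -/

/-- The derivative of the arcsine weight. -/
noncomputable def arcWeightDeriv (t : ℝ) : ℝ := t * arcWeight t ^ 3

theorem arcWeight_sq {t : ℝ} (ht : t ∈ Ioo (-1 : ℝ) 1) : arcWeight t ^ 2 = (1 - t ^ 2)⁻¹ := by
  rw [arcWeight, inv_pow, Real.sq_sqrt (one_sub_sq_pos ht).le]

theorem hasDerivAt_arcWeight {t : ℝ} (ht : t ∈ Ioo (-1 : ℝ) 1) :
    HasDerivAt arcWeight (arcWeightDeriv t) t := by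
  have hpos := one_sub_sq_pos ht
  have hs : √(1 - t ^ 2) ≠ 0 := (Real.sqrt_pos.2 hpos).ne'
  have h1 : HasDerivAt (fun t : ℝ => 1 - t ^ 2) (-(2 * t)) t := by
    simpa using ((hasDerivAt_id t).fun_pow 2).const_sub 1
  have h2 := (h1.sqrt hpos.ne').inv hs
  refine h2.congr_deriv ?_
  rw [arcWeightDeriv, arcWeight]
  field_simp

theorem hasDerivAt_id_mul_arcWeight {t : ℝ} (ht : t ∈ Ioo (-1 : ℝ) 1) :
    HasDerivAt (fun t => t * arcWeight t) (arcWeight t + t * arcWeightDeriv t) t := by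
  simpa using (hasDerivAt_id t).fun_mul (hasDerivAt_arcWeight ht)

theorem continuousOn_arcWeightDeriv : ContinuousOn arcWeightDeriv (Ioo (-1) 1) :=
  continuousOn_id.mul (continuousOn_arcWeight.pow 3)

theorem continuousOn_id_mul_arcWeightDeriv :
    ContinuousOn (fun t => t * arcWeightDeriv t) (Ioo (-1) 1) :=
  continuousOn_id.mul continuousOn_arcWeightDeriv

section

variable {δ α : ℝ}

theorem arcIntegral_add {u v : ℝ → ℝ} (hu : ContinuousOn u (Ioo (-1) 1))
    (hv : ContinuousOn v (Ioo (-1) 1)) (hδ : 0 < δ) (h₁ : -1 < α - δ) (h₂ : α + δ < 1) (φ : ℝ) :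
    arcIntegral (fun t => u t + v t) δ α φ = arcIntegral u δ α φ + arcIntegral v δ α φ :=
  intervalIntegral.integral_add ((continuous_comp_arc hu hδ h₁ h₂).intervalIntegrable _ _)
    ((continuous_comp_arc hv hδ h₁ h₂).intervalIntegrable _ _)

theorem arcIntegral_const_mul (v : ℝ → ℝ) (k δ α φ : ℝ) :
    arcIntegral (fun t => k * v t) δ α φ = k * arcIntegral v δ α φ :=
  intervalIntegral.integral_const_mul _ _

theorem arcIntegral_add_const_mul {u v : ℝ → ℝ} (hu : ContinuousOn u (Ioo (-1) 1))
    (hv : ContinuousOn v (Ioo (-1) 1)) (hδ : 0 < δ) (h₁ : -1 < α - δ) (h₂ : α + δ < 1) (k φ : ℝ) :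
    arcIntegral (fun t => u t + k * v t) δ α φ = arcIntegral u δ α φ + k * arcIntegral v δ α φ := by
  rw [arcIntegral_add (v := fun t => k * v t) hu (continuousOn_const.mul hv) hδ h₁ h₂,
    arcIntegral_const_mul]

theorem arcIntegral_mono {u v : ℝ → ℝ} (hu : ContinuousOn u (Ioo (-1) 1))
    (hv : ContinuousOn v (Ioo (-1) 1)) (hδ : 0 < δ) (h₁ : -1 < α - δ) (h₂ : α + δ < 1)
    (huv : ∀ t ∈ Icc (α - δ) (α + δ), u t ≤ v t) {φ : ℝ} (hφ : φ ≤ Real.pi) :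
    arcIntegral u δ α φ ≤ arcIntegral v δ α φ :=
  intervalIntegral.integral_mono hφ ((continuous_comp_arc hu hδ h₁ h₂).intervalIntegrable _ _)
    ((continuous_comp_arc hv hδ h₁ h₂).intervalIntegrable _ _)
    fun θ => huv _ (add_mul_cos_mem_Icc hδ α θ)

theorem arcIntegral_pos {v : ℝ → ℝ} (hv : ContinuousOn v (Ioo (-1) 1)) (hδ : 0 < δ)
    (h₁ : -1 < α - δ) (h₂ : α + δ < 1) (hpos : ∀ t ∈ Ioo (α - δ) (α + δ), 0 < v t) :
    0 < arcIntegral v δ α 0 := by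
  refine intervalIntegral.intervalIntegral_pos_of_pos_on
    ((continuous_comp_arc hv hδ h₁ h₂).intervalIntegrable _ _) (fun θ hθ => hpos _ ?_) Real.pi_pos
  have hsin : 0 < Real.sin θ := Real.sin_pos_of_pos_of_lt_pi hθ.1 hθ.2
  have hsq := Real.sin_sq_add_cos_sq θ
  have hc1 : Real.cos θ < 1 := by nlinarith [Real.cos_le_one θ]
  have hc2 : -1 < Real.cos θ := by nlinarith [Real.neg_one_le_cos θ]
  constructor <;> nlinarith

theorem gapCenter_mul (hδ : 0 < δ) (h₁ : -1 < α - δ) (h₂ : α + δ < 1) :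
    gapCenter δ α * arcIntegral arcWeight δ α 0 = arcIntegral (fun t => t * arcWeight t) δ α 0 :=
  div_mul_cancel₀ _ (arcIntegral_arcWeight_pos hδ h₁ h₂ Real.pi_pos).ne'

/-- The number c is the mean of t over the gap with respect to a positive weight. -/
theorem gapCenter_mem (hδ : 0 < δ) (h₁ : -1 < α - δ) (h₂ : α + δ < 1) :
    gapCenter δ α ∈ Ioo (α - δ) (α + δ) := by
  have hW := arcIntegral_arcWeight_pos hδ h₁ h₂ Real.pi_pos
  have hc := gapCenter_mul hδ h₁ h₂
  have hlin : ∀ k : ℝ, arcIntegral (fun t => t * arcWeight t + k * arcWeight t) δ α 0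
      = (gapCenter δ α + k) * arcIntegral arcWeight δ α 0 := by
    intro k
    rw [arcIntegral_add_const_mul continuousOn_id_mul_arcWeight continuousOn_arcWeight hδ h₁ h₂,
      ← hc]
    ring
  have hsub : Ioo (α - δ) (α + δ) ⊆ Ioo (-1 : ℝ) 1 := Ioo_subset_Ioo h₁.le h₂.le
  constructor
  · have hp := arcIntegral_pos (v := fun t => t * arcWeight t + -(α - δ) * arcWeight t)
      (continuousOn_id_mul_arcWeight.add (continuousOn_const.mul continuousOn_arcWeight)) hδ h₁ h₂
      fun t ht => by
        have := mul_pos (sub_pos.2 ht.1) (arcWeight_pos (hsub ht))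
        linarith
    rw [hlin] at hp
    linarith [pos_of_mul_pos_left hp hW.le]
  · have hp := arcIntegral_pos
      (v := fun t => -1 * (t * arcWeight t + -(α + δ) * arcWeight t))
      (continuousOn_const.mul
        (continuousOn_id_mul_arcWeight.add (continuousOn_const.mul continuousOn_arcWeight)))
      hδ h₁ h₂ fun t ht => by
        have := mul_pos (sub_pos.2 ht.2) (arcWeight_pos (hsub ht))
        linarith
    rw [arcIntegral_const_mul, hlin] at hp
    have hp' : 0 < (α + δ - gapCenter δ α) * arcIntegral arcWeight δ α 0 := by linarith
    linarith [pos_of_mul_pos_left hp' hW.le]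

/-- The derivative of `gapCenter` with respect to the centre of the gap. -/
noncomputable def gapCenterDeriv (δ α : ℝ) : ℝ :=
  1 + (arcIntegral (fun t => t * arcWeightDeriv t) δ α 0 -
    gapCenter δ α * arcIntegral arcWeightDeriv δ α 0) / arcIntegral arcWeight δ α 0

theorem hasDerivAt_gapCenter (hδ : 0 < δ) (h₁ : -1 < α - δ) (h₂ : α + δ < 1) :
    HasDerivAt (gapCenter δ) (gapCenterDeriv δ α) α := by
  have hW := arcIntegral_arcWeight_pos hδ h₁ h₂ Real.pi_pos
  have hc := gapCenter_mul hδ h₁ h₂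
  have hN' := hasDerivAt_arcIntegral (fun t ht => hasDerivAt_id_mul_arcWeight ht)
    (continuousOn_arcWeight.add continuousOn_id_mul_arcWeightDeriv) hδ h₁ h₂
    (hasDerivAt_const α (0 : ℝ))
  have hW' := hasDerivAt_arcIntegral (fun t ht => hasDerivAt_arcWeight ht)
    continuousOn_arcWeightDeriv hδ h₁ h₂ (hasDerivAt_const α (0 : ℝ))
  refine (hN'.div hW' hW.ne').congr_deriv ?_
  rw [arcIntegral_add continuousOn_arcWeight continuousOn_id_mul_arcWeightDeriv hδ h₁ h₂, ← hc,
    gapCenterDeriv]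
  field_simp
  ring

/-- The centre of the gap moves slower than the critical point of the Green function. -/
theorem one_le_gapCenterDeriv (hδ : 0 < δ) (h₁ : -1 < α - δ) (h₂ : α + δ < 1) :
    1 ≤ gapCenterDeriv δ α := by
  have hW := arcIntegral_arcWeight_pos hδ h₁ h₂ Real.pi_pos
  have hc := gapCenter_mul hδ h₁ h₂
  have hcm := gapCenter_mem hδ h₁ h₂
  set c := gapCenter δ α with hcdef
  have hc1 : c ∈ Ioo (-1 : ℝ) 1 := ⟨by linarith [hcm.1], by linarith [hcm.2]⟩
  -- A covariance argument: w'/w = t/(1 - t²) is increasing on (-1, 1), so (t - c)(w'/w) is at least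
  -- (t - c) times the value of w'/w at c. The lower bound integrates to zero against w, since c is
  -- the mean.
  have hpt : ∀ t ∈ Icc (α - δ) (α + δ),
      c / (1 - c ^ 2) * (t * arcWeight t + -c * arcWeight t)
        ≤ t * arcWeightDeriv t + -c * arcWeightDeriv t := by
    intro t ht
    have ht1 : t ∈ Ioo (-1 : ℝ) 1 := ⟨by linarith [ht.1], by linarith [ht.2]⟩
    have hw := arcWeight_pos ht1
    have hd : arcWeightDeriv t = t / (1 - t ^ 2) * arcWeight t := by
      rw [arcWeightDeriv, pow_succ, arcWeight_sq ht1]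
      ring
    have p1 := one_sub_sq_pos ht1
    have p2 := one_sub_sq_pos hc1
    have p3 : 0 < 1 + t * c := by
      nlinarith [ht1.1, ht1.2, hc1.1, hc1.2]
    have : t * arcWeightDeriv t + -c * arcWeightDeriv t
        - c / (1 - c ^ 2) * (t * arcWeight t + -c * arcWeight t)
        = (t - c) ^ 2 * (1 + t * c) / ((1 - t ^ 2) * (1 - c ^ 2)) * arcWeight t := by
      rw [hd]
      field_simp
      ring
    have h0 : 0 ≤ (t - c) ^ 2 * (1 + t * c) / ((1 - t ^ 2) * (1 - c ^ 2)) * arcWeight t := by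
      positivity
    linarith
  have h_integral := arcIntegral_mono
    (u := fun t => c / (1 - c ^ 2) * (t * arcWeight t + -c * arcWeight t))
    (v := fun t => t * arcWeightDeriv t + -c * arcWeightDeriv t)
    (continuousOn_const.mul
      (continuousOn_id_mul_arcWeight.add (continuousOn_const.mul continuousOn_arcWeight)))
    (continuousOn_id_mul_arcWeightDeriv.add (continuousOn_const.mul continuousOn_arcWeightDeriv))
    hδ h₁ h₂ hpt Real.pi_pos.le
  rw [arcIntegral_const_mul,
    arcIntegral_add_const_mul continuousOn_id_mul_arcWeight continuousOn_arcWeight hδ h₁ h₂,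
    arcIntegral_add_const_mul continuousOn_id_mul_arcWeightDeriv continuousOn_arcWeightDeriv
      hδ h₁ h₂, ← hc] at h_integral
  rw [gapCenterDeriv, le_add_iff_nonneg_right]
  refine div_nonneg ?_ hW.le
  linarith

/-- The derivative of the Green function with respect to the centre of the gap, at the point
`α + δ cos φ`. -/
noncomputable def gapVariation (δ α φ : ℝ) : ℝ :=
  (α + δ * Real.cos φ - gapCenter δ α) * arcWeight (α + δ * Real.cos φ) / (δ * Real.sin φ) +
    ((gapCenterDeriv δ α - 1) * arcIntegral arcWeight δ α φ +
      gapCenter δ α * arcIntegral arcWeightDeriv δ α φ -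
      arcIntegral (fun t => t * arcWeightDeriv t) δ α φ)

/-- The prescribed φ' makes the derivative of β + δ cos φ(β) vanish at α: the point x stays fixed
while the gap moves. -/
theorem hasDerivAt_gapGreen {φ : ℝ → ℝ} {φ' : ℝ} (hδ : 0 < δ) (h₁ : -1 < α - δ) (h₂ : α + δ < 1)
    (hφ : HasDerivAt φ φ' α) (hφ' : φ' = 1 / (δ * Real.sin (φ α))) :
    HasDerivAt (fun β => gapGreen δ β (φ β)) (gapVariation δ α (φ α)) α := by
  have hN := hasDerivAt_arcIntegral (fun t ht => hasDerivAt_id_mul_arcWeight ht)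
    (continuousOn_arcWeight.add continuousOn_id_mul_arcWeightDeriv) hδ h₁ h₂ hφ
  have hW := hasDerivAt_arcIntegral (fun t ht => hasDerivAt_arcWeight ht)
    continuousOn_arcWeightDeriv hδ h₁ h₂ hφ
  refine (((hasDerivAt_gapCenter hδ h₁ h₂).mul hW).sub hN).congr_deriv ?_
  rw [arcIntegral_add continuousOn_arcWeight continuousOn_id_mul_arcWeightDeriv hδ h₁ h₂,
    gapVariation, hφ']
  ring

theorem neg_one_lt_and_lt_one_of_mem_gap {x : ℝ} (hδ : 0 < δ) (hx : x ∈ Ioo (α - δ) (α + δ)) :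
    -1 < (x - α) / δ ∧ (x - α) / δ < 1 := by
  rw [lt_div_iff₀ hδ, div_lt_iff₀ hδ]
  constructor <;> linarith [hx.1, hx.2]

theorem hasDerivAt_greenTwo {x : ℝ} (hδ : 0 < δ) (h₁ : -1 < α - δ) (h₂ : α + δ < 1)
    (hx : x ∈ Ioo (α - δ) (α + δ)) :
    HasDerivAt (fun β => greenTwo β δ x)
      (gapVariation δ α (Real.arccos ((x - α) / δ))) α := by
  obtain ⟨hy1, hy2⟩ := neg_one_lt_and_lt_one_of_mem_gap hδ hx
  have hlin : HasDerivAt (fun β => (x - β) / δ) (-1 / δ) α :=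
    ((hasDerivAt_id α).const_sub x).div_const δ
  have hφ : HasDerivAt (fun β => Real.arccos ((x - β) / δ))
      (1 / (δ * Real.sin (Real.arccos ((x - α) / δ)))) α := by
    refine ((Real.hasDerivAt_arccos hy1.ne' hy2.ne).comp α hlin).congr_deriv ?_
    rw [Real.sin_arccos]
    ring
  refine (hasDerivAt_gapGreen hδ h₁ h₂ hφ rfl).congr_of_eventuallyEq ?_
  have e1 : ∀ᶠ β : ℝ in 𝓝 α, -1 < β - δ :=
    (by fun_prop : Continuous fun β : ℝ => β - δ).continuousAt.eventually (lt_mem_nhds h₁)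
  have e2 : ∀ᶠ β : ℝ in 𝓝 α, β + δ < 1 :=
    (by fun_prop : Continuous fun β : ℝ => β + δ).continuousAt.eventually (gt_mem_nhds h₂)
  filter_upwards [e1, e2] with β hβ1 hβ2
  exact greenTwo_eq_gapGreen hδ hβ1 hβ2 ⟨by linarith [hx.1], by linarith [hx.2]⟩

theorem hasDerivAt_arcIntegral_angle_of_continuousOn {v : ℝ → ℝ}
    (hv : ContinuousOn v (Ioo (-1) 1)) (hδ : 0 < δ) (h₁ : -1 < α - δ) (h₂ : α + δ < 1) (φ : ℝ) :
    HasDerivAt (arcIntegral v δ α) (-v (α + δ * Real.cos φ)) φ := by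
  have hc := continuous_comp_arc hv hδ h₁ h₂
  exact intervalIntegral.integral_hasDerivAt_left (hc.intervalIntegrable _ _)
    hc.aestronglyMeasurable.stronglyMeasurableAtFilter hc.continuousAt

/-- All terms containing the derivative of the weight cancel, which leaves an expression whose sign
can be read off. -/
theorem hasDerivAt_gapVariation (hδ : 0 < δ) (h₁ : -1 < α - δ) (h₂ : α + δ < 1) {φ : ℝ}
    (hφ : φ ∈ Ioo 0 Real.pi) :
    HasDerivAt (gapVariation δ α)
      (-(arcWeight (α + δ * Real.cos φ) / (δ * Real.sin φ) ^ 2 *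
        (gapCenterDeriv δ α * (δ * Real.sin φ) ^ 2 +
          (α + δ * Real.cos φ - gapCenter δ α) * (δ * Real.cos φ)))) φ := by
  have hsin : 0 < Real.sin φ := Real.sin_pos_of_pos_of_lt_pi hφ.1 hφ.2
  have hcos : HasDerivAt (fun φ => α + δ * Real.cos φ) (δ * -Real.sin φ) φ :=
    ((Real.hasDerivAt_cos φ).const_mul δ).const_add α
  have hw := (hasDerivAt_arcWeight (add_mul_cos_mem_Ioo hδ h₁ h₂ φ)).comp φ hcos
  have hsd : HasDerivAt (fun φ => δ * Real.sin φ) (δ * Real.cos φ) φ :=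
    (Real.hasDerivAt_sin φ).const_mul δ
  have hfirst := ((hcos.sub_const (gapCenter δ α)).mul hw).div hsd (by positivity)
  have hrest := (((hasDerivAt_arcIntegral_angle_of_continuousOn continuousOn_arcWeight hδ h₁ h₂
    φ).const_mul (gapCenterDeriv δ α - 1)).add
    ((hasDerivAt_arcIntegral_angle_of_continuousOn continuousOn_arcWeightDeriv hδ h₁ h₂
    φ).const_mul (gapCenter δ α))).sub
    (hasDerivAt_arcIntegral_angle_of_continuousOn continuousOn_id_mul_arcWeightDeriv hδ h₁ h₂ φ)
  refine (hfirst.add hrest).congr_deriv ?_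
  simp only [Pi.mul_apply, Function.comp_apply]
  field_simp
  ring

/-- Since c' ≥ 1, the bracket in the derivative is at least δ(δ + (α - c) cos φ), which is positive
because |c - α| < δ. This gives the uniqueness of x₀(α). -/
theorem strictAntiOn_gapVariation (hδ : 0 < δ) (h₁ : -1 < α - δ) (h₂ : α + δ < 1) :
    StrictAntiOn (gapVariation δ α) (Ioo 0 Real.pi) := by
  refine strictAntiOn_of_hasDerivWithinAt_neg (convex_Ioo _ _)
    (fun φ hφ => (hasDerivAt_gapVariation hδ h₁ h₂ hφ).continuousAt.continuousWithinAt)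
    (fun φ hφ => (hasDerivAt_gapVariation hδ h₁ h₂
      (interior_subset hφ)).hasDerivWithinAt) fun φ hφ => ?_
  have hφ' : φ ∈ Ioo 0 Real.pi := interior_subset hφ
  have hsin : 0 < Real.sin φ := Real.sin_pos_of_pos_of_lt_pi hφ'.1 hφ'.2
  have hw := arcWeight_pos (add_mul_cos_mem_Ioo hδ h₁ h₂ φ)
  have hc := gapCenter_mem hδ h₁ h₂
  have hc' := one_le_gapCenterDeriv hδ h₁ h₂
  have hsq := Real.sin_sq_add_cos_sq φ
  have hkey : 0 < gapCenterDeriv δ α * (δ * Real.sin φ) ^ 2 +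
      (α + δ * Real.cos φ - gapCenter δ α) * (δ * Real.cos φ) := by
    have e1 : (δ * Real.sin φ) ^ 2 ≤ gapCenterDeriv δ α * (δ * Real.sin φ) ^ 2 :=
      le_mul_of_one_le_left (sq_nonneg _) hc'
    have e2 : (δ * Real.sin φ) ^ 2 + (α + δ * Real.cos φ - gapCenter δ α) * (δ * Real.cos φ)
        = δ * (δ + (α - gapCenter δ α) * Real.cos φ) := by
      linear_combination δ ^ 2 * hsq
    have e3 : |(α - gapCenter δ α) * Real.cos φ| < δ := by
      rw [abs_mul]
      refine (mul_le_of_le_one_right (abs_nonneg _) (Real.abs_cos_le_one φ)).trans_lt ?_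
      rw [abs_lt]
      constructor <;> linarith [hc.1, hc.2]
    have e4 : 0 < δ * (δ + (α - gapCenter δ α) * Real.cos φ) :=
      mul_pos hδ (by linarith [(abs_lt.1 e3).1])
    linarith
  have : 0 < arcWeight (α + δ * Real.cos φ) / (δ * Real.sin φ) ^ 2 *
        (gapCenterDeriv δ α * (δ * Real.sin φ) ^ 2 +
          (α + δ * Real.cos φ - gapCenter δ α) * (δ * Real.cos φ)) := by positivity
  linarith

/-- The part of `gapVariation` that is continuous up to the end points of the gap. -/
theorem continuous_gapVariation_regular (hδ : 0 < δ) (h₁ : -1 < α - δ) (h₂ : α + δ < 1) :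
    Continuous fun φ => (gapCenterDeriv δ α - 1) * arcIntegral arcWeight δ α φ +
      gapCenter δ α * arcIntegral arcWeightDeriv δ α φ -
      arcIntegral (fun t => t * arcWeightDeriv t) δ α φ := by
  have h : ∀ {v : ℝ → ℝ}, ContinuousOn v (Ioo (-1) 1) → Continuous (arcIntegral v δ α) :=
    fun hv => continuous_iff_continuousAt.2 fun φ =>
      (hasDerivAt_arcIntegral_angle_of_continuousOn hv hδ h₁ h₂ φ).continuousAt
  exact ((continuous_const.mul (h continuousOn_arcWeight)).add
    (continuous_const.mul (h continuousOn_arcWeightDeriv))).sub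
    (h continuousOn_id_mul_arcWeightDeriv)

/-- At an end of the gap the term (t - c) w / (δ sin φ) dominates and has the sign of t - c. It is
positive here, at the right end, and negative at φ = π. -/
theorem tendsto_gapVariation_zero (hδ : 0 < δ) (h₁ : -1 < α - δ) (h₂ : α + δ < 1) :
    Tendsto (gapVariation δ α) (𝓝[>] 0) atTop := by
  have hc := gapCenter_mem hδ h₁ h₂
  have hreg := (continuous_gapVariation_regular hδ h₁ h₂).continuousAt.tendsto.mono_left
    (nhdsWithin_le_nhds (a := (0 : ℝ)) (s := Ioi 0))
  have hnum : Continuous fun φ =>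
      (α + δ * Real.cos φ - gapCenter δ α) * arcWeight (α + δ * Real.cos φ) / δ :=
    ((by fun_prop : Continuous fun φ => α + δ * Real.cos φ - gapCenter δ α).mul
      (continuous_comp_arc continuousOn_arcWeight hδ h₁ h₂)).div_const δ
  have hnum0 := hnum.continuousAt.tendsto.mono_left
    (nhdsWithin_le_nhds (a := (0 : ℝ)) (s := Ioi 0))
  have hpos : 0 < (α + δ * Real.cos 0 - gapCenter δ α) * arcWeight (α + δ * Real.cos 0) / δ := by
    have := arcWeight_pos (add_mul_cos_mem_Ioo hδ h₁ h₂ 0)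
    have h3 : 0 < α + δ * Real.cos 0 - gapCenter δ α := by
      rw [Real.cos_zero]
      linarith [hc.2]
    positivity
  have hsin : Tendsto Real.sin (𝓝[>] 0) (𝓝[>] 0) := by
    refine tendsto_nhdsWithin_iff.2 ⟨?_, ?_⟩
    · simpa using Real.continuous_sin.continuousAt.tendsto.mono_left
        (nhdsWithin_le_nhds (a := (0 : ℝ)) (s := Ioi 0))
    · filter_upwards [Ioo_mem_nhdsGT Real.pi_pos] with φ hφ
      exact Real.sin_pos_of_pos_of_lt_pi hφ.1 hφ.2
  have hinv := tendsto_inv_nhdsGT_zero.comp hsin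
  refine ((hnum0.pos_mul_atTop hpos hinv).atTop_add hreg).congr fun φ => ?_
  simp only [gapVariation, Function.comp_apply]
  congr 1
  field_simp

theorem tendsto_gapVariation_pi (hδ : 0 < δ) (h₁ : -1 < α - δ) (h₂ : α + δ < 1) :
    Tendsto (gapVariation δ α) (𝓝[<] Real.pi) atBot := by
  have hc := gapCenter_mem hδ h₁ h₂
  have hreg := (continuous_gapVariation_regular hδ h₁ h₂).continuousAt.tendsto.mono_left
    (nhdsWithin_le_nhds (a := Real.pi) (s := Iio Real.pi))
  have hnum : Continuous fun φ =>
      (α + δ * Real.cos φ - gapCenter δ α) * arcWeight (α + δ * Real.cos φ) / δ :=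
    ((by fun_prop : Continuous fun φ => α + δ * Real.cos φ - gapCenter δ α).mul
      (continuous_comp_arc continuousOn_arcWeight hδ h₁ h₂)).div_const δ
  have hnum0 := hnum.continuousAt.tendsto.mono_left
    (nhdsWithin_le_nhds (a := Real.pi) (s := Iio Real.pi))
  have hneg : (α + δ * Real.cos Real.pi - gapCenter δ α) * arcWeight (α + δ * Real.cos Real.pi) / δ
      < 0 := by
    have := arcWeight_pos (add_mul_cos_mem_Ioo hδ h₁ h₂ Real.pi)
    have h3 : α + δ * Real.cos Real.pi - gapCenter δ α < 0 := by
      rw [Real.cos_pi]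
      linarith [hc.1]
    exact div_neg_of_neg_of_pos (mul_neg_of_neg_of_pos h3 this) hδ
  have hsin : Tendsto Real.sin (𝓝[<] Real.pi) (𝓝[>] 0) := by
    refine tendsto_nhdsWithin_iff.2 ⟨?_, ?_⟩
    · simpa using Real.continuous_sin.continuousAt.tendsto.mono_left
        (nhdsWithin_le_nhds (a := Real.pi) (s := Iio Real.pi))
    · filter_upwards [Ioo_mem_nhdsLT Real.pi_pos] with φ hφ
      exact Real.sin_pos_of_pos_of_lt_pi hφ.1 hφ.2
  have hinv := tendsto_inv_nhdsGT_zero.comp hsin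
  refine ((hnum0.neg_mul_atTop hneg hinv).atBot_add hreg).congr fun φ => ?_
  simp only [gapVariation, Function.comp_apply]
  congr 1
  field_simp

theorem exists_gapVariation_eq_zero (hδ : 0 < δ) (h₁ : -1 < α - δ) (h₂ : α + δ < 1) :
    ∃ φ ∈ Ioo 0 Real.pi, gapVariation δ α φ = 0 := by
  have hpi := Real.pi_pos
  obtain ⟨φ₁, hφ₁, hm₁⟩ := ((tendsto_gapVariation_zero hδ h₁ h₂).eventually_ge_atTop 0 |>.and
    (Ioo_mem_nhdsGT (half_pos hpi))).exists
  obtain ⟨φ₂, hφ₂, hm₂⟩ := ((tendsto_gapVariation_pi hδ h₁ h₂).eventually_le_atBot 0 |>.and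
    (Ioo_mem_nhdsLT (half_lt_self hpi))).exists
  have hle : φ₁ ≤ φ₂ := (hm₁.2.trans hm₂.1).le
  have hsub : Icc φ₁ φ₂ ⊆ Ioo 0 Real.pi := Icc_subset_Ioo hm₁.1 hm₂.2
  obtain ⟨φ, hφ, h⟩ := intermediate_value_Icc' hle (f := gapVariation δ α)
    (fun ψ hψ => (hasDerivAt_gapVariation hδ h₁ h₂ (hsub hψ)).continuousAt.continuousWithinAt)
    ⟨hφ₂, hφ₁⟩
  exact ⟨φ, hsub hφ, h⟩

end

/-! ### The limit of a gap reaching the left end point -/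

section

variable {δ α : ℝ}

theorem one_le_arcWeight {t : ℝ} (ht : t ∈ Ioo (-1 : ℝ) 1) : 1 ≤ arcWeight t := by
  rw [arcWeight]
  refine (one_le_inv₀ (Real.sqrt_pos.2 (one_sub_sq_pos ht))).2 ?_
  exact Real.sqrt_le_iff.2 ⟨zero_le_one, by nlinarith [sq_nonneg t]⟩

/-- Let η² be the length of the left interval. Near θ = π the quantity 1 + t is at most η² + δ(π -
θ)²/2, so the weight is at least 1/(2(η + π - θ)), whose integral diverges logarithmically as η → 0.
-/
theorem arcIntegral_arcWeight_ge (hδ : 0 < δ) (h₁ : -1 < α - δ) (h₂ : α + δ < 1) :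
    -(1 / 2 * Real.log √(α - δ + 1)) ≤ arcIntegral arcWeight δ α 0 := by
  set η := √(α - δ + 1) with hη
  have hη0 : 0 < η := Real.sqrt_pos.2 (by linarith)
  have hη2 : η ^ 2 = α - δ + 1 := Real.sq_sqrt (by linarith)
  have hpi := Real.pi_pos
  have hcont : ContinuousOn (fun θ => 1 / (2 * (η + Real.pi - θ))) (uIcc 0 Real.pi) := by
    rw [uIcc_of_le hpi.le]
    refine continuousOn_const.div (by fun_prop) fun θ hθ => ?_
    have : 0 < η + Real.pi - θ := by linarith [hθ.2]
    positivity
  have h_integral : ∫ θ in (0 : ℝ)..Real.pi, 1 / (2 * (η + Real.pi - θ))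
      = -(1 / 2 * Real.log (η + Real.pi - Real.pi)) - -(1 / 2 * Real.log (η + Real.pi - 0)) := by
    refine intervalIntegral.integral_eq_sub_of_hasDerivAt
      (f := fun θ => -(1 / 2 * Real.log (η + Real.pi - θ))) (fun θ hθ => ?_)
      hcont.intervalIntegrable
    rw [uIcc_of_le hpi.le] at hθ
    have hpos : 0 < η + Real.pi - θ := by linarith [hθ.2]
    have h3 := ((((hasDerivAt_id θ).const_sub (η + Real.pi)).log hpos.ne').const_mul (1 / 2)).neg
    refine h3.congr_deriv ?_
    simp only [id]
    field_simp
  have hmono : ∫ θ in (0 : ℝ)..Real.pi, 1 / (2 * (η + Real.pi - θ))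
      ≤ arcIntegral arcWeight δ α 0 := by
    refine intervalIntegral.integral_mono_on hpi.le hcont.intervalIntegrable
      ((continuous_comp_arc continuousOn_arcWeight hδ h₁ h₂).intervalIntegrable _ _)
      fun θ hθ => ?_
    have hpos : 0 < η + Real.pi - θ := by linarith [hθ.2]
    have ht := add_mul_cos_mem_Ioo hδ h₁ h₂ θ
    rw [arcWeight, one_div]
    refine inv_anti₀ (Real.sqrt_pos.2 (one_sub_sq_pos ht)) ?_
    rw [Real.sqrt_le_left (by positivity)]
    have hcos := Real.one_sub_sq_div_two_le_cos (x := Real.pi - θ)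
    rw [Real.cos_pi_sub] at hcos
    set t := α + δ * Real.cos θ with htdef
    have h3 : 1 + t ≤ η ^ 2 + δ * ((Real.pi - θ) ^ 2 / 2) := by
      rw [hη2, htdef]
      nlinarith
    have h4 : 1 - t ^ 2 ≤ 2 * (1 + t) := by nlinarith [ht.1, ht.2]
    have hδ1 : δ < 1 := by linarith
    nlinarith [sq_nonneg (Real.pi - θ), mul_nonneg hη0.le (sub_nonneg.2 hθ.2)]
  rw [h_integral] at hmono
  have hlog : 0 ≤ Real.log (η + Real.pi - 0) :=
    Real.log_nonneg (by linarith [Real.pi_gt_three])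
  have e : η + Real.pi - Real.pi = η := by ring
  rw [e] at hmono
  linarith

theorem eventually_center_mem (hδ₁ : δ < 1) : ∀ᶠ α in 𝓝[>] (δ - 1), α ∈ Ioo (δ - 1) 0 :=
  Ioo_mem_nhdsGT (by linarith)

theorem tendsto_arcIntegral_arcWeight (hδ : 0 < δ) (hδ₁ : δ < 1) :
    Tendsto (fun α => arcIntegral arcWeight δ α 0) (𝓝[>] (δ - 1)) atTop := by
  have hη : Tendsto (fun α => √(α - δ + 1)) (𝓝[>] (δ - 1)) (𝓝[>] 0) := by
    refine tendsto_nhdsWithin_iff.2 ⟨?_, ?_⟩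
    · have : Continuous fun α => √(α - δ + 1) := by fun_prop
      have h0 := this.tendsto (δ - 1)
      have e : δ - 1 - δ + 1 = 0 := by ring
      rw [e, Real.sqrt_zero] at h0
      exact h0.mono_left nhdsWithin_le_nhds
    · filter_upwards [eventually_center_mem hδ₁] with α hα
      exact Real.sqrt_pos.2 (by linarith [hα.1])
  have hlog := (Real.tendsto_log_nhdsGT_zero.comp hη).const_mul_atBot
    (show (0 : ℝ) < 1 / 2 by norm_num)
  refine tendsto_atTop_mono' _ ?_ (tendsto_neg_atBot_atTop.comp hlog)
  filter_upwards [eventually_center_mem hδ₁] with α hα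
  exact arcIntegral_arcWeight_ge hδ (by linarith [hα.1]) (by linarith [hα.2])

theorem arcIntegral_const (k δ α : ℝ) : arcIntegral (fun _ => k) δ α 0 = Real.pi * k := by
  simp [arcIntegral]

theorem gapCenter_add_one_mul (hδ : 0 < δ) (h₁ : -1 < α - δ) (h₂ : α + δ < 1) :
    (gapCenter δ α + 1) * arcIntegral arcWeight δ α 0
      = arcIntegral (fun t => t * arcWeight t + 1 * arcWeight t) δ α 0 := by
  rw [arcIntegral_add_const_mul continuousOn_id_mul_arcWeight continuousOn_arcWeight hδ h₁ h₂,
    ← gapCenter_mul hδ h₁ h₂]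
  ring

/-- The factor 1 + t removes the singularity at -1: (1 + t) w = √((1 + t)/(1 - t)), and t ≤ δ in the
gap. Hence c + 1 is at most a constant over the diverging integral of w, and c → -1. -/
theorem gapCenter_add_one_mul_le (hδ : 0 < δ) (h₁ : -1 < α - δ) (h₂ : α + δ < 1) (hα : α ≤ 0) :
    (gapCenter δ α + 1) * arcIntegral arcWeight δ α 0 ≤ Real.pi * (2 / (1 - δ)) := by
  have hδ1 : 0 < 1 - δ := by linarith
  rw [gapCenter_add_one_mul hδ h₁ h₂, ← arcIntegral_const _ δ α]
  refine arcIntegral_mono (u := fun t => t * arcWeight t + 1 * arcWeight t) (v := fun _ => _)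
    (continuousOn_id_mul_arcWeight.add (continuousOn_const.mul continuousOn_arcWeight))
    continuousOn_const hδ h₁ h₂ (fun t ht => ?_) Real.pi_pos.le
  have ht1 : t ∈ Ioo (-1 : ℝ) 1 := ⟨by linarith [ht.1], by linarith [ht.2]⟩
  have hw := arcWeight_pos ht1
  refine abs_le_of_sq_le_sq' ?_ (by positivity) |>.2
  have e : (t * arcWeight t + 1 * arcWeight t) ^ 2 = (1 + t) / (1 - t) := by
    have p1 : 0 < 1 - t := by linarith [ht1.2]
    have p2 : 0 < 1 + t := by linarith [ht1.1]
    rw [show (t * arcWeight t + 1 * arcWeight t) ^ 2 = (1 + t) ^ 2 * arcWeight t ^ 2 by ring,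
      arcWeight_sq ht1, show 1 - t ^ 2 = (1 - t) * (1 + t) by ring]
    field_simp
  rw [e, div_pow]
  have hle : 1 - δ ≤ 1 - t := by linarith [ht.2]
  have h3 : (1 + t) / (1 - t) ≤ 2 / (1 - δ) :=
    div_le_div₀ zero_le_two (by linarith [ht1.2]) hδ1 hle
  refine h3.trans ?_
  rw [div_le_div_iff₀ hδ1 (by positivity)]
  nlinarith

/-- From w ≥ 1. This says that c + 1 decays no faster than the reciprocal of the integral of w, as
needed to make c' large in `le_gapCenterDeriv`. -/
theorem le_gapCenter_add_one_mul (hδ : 0 < δ) (h₁ : -1 < α - δ) (h₂ : α + δ < 1) :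
    Real.pi * δ ≤ (gapCenter δ α + 1) * arcIntegral arcWeight δ α 0 := by
  have h_integral : arcIntegral (fun t => t + 1) δ α 0 = Real.pi * (α + 1) := by
    rw [arcIntegral, intervalIntegral.integral_add, intervalIntegral.integral_add,
      intervalIntegral.integral_const_mul, integral_cos]
    · simp
      ring
    all_goals
      apply Continuous.intervalIntegrable
      fun_prop
  have hle : Real.pi * δ ≤ Real.pi * (α + 1) :=
    mul_le_mul_of_nonneg_left (by linarith) Real.pi_pos.le
  refine hle.trans ?_
  rw [gapCenter_add_one_mul hδ h₁ h₂, ← h_integral]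
  refine arcIntegral_mono (u := fun t => t + 1)
    (v := fun t => t * arcWeight t + 1 * arcWeight t) (by fun_prop)
    (continuousOn_id_mul_arcWeight.add (continuousOn_const.mul continuousOn_arcWeight))
    hδ h₁ h₂ (fun t ht => ?_) Real.pi_pos.le
  have ht1 : t ∈ Ioo (-1 : ℝ) 1 := ⟨by linarith [ht.1], by linarith [ht.2]⟩
  nlinarith [one_le_arcWeight ht1, ht1.1]

theorem tendsto_gapCenter (hδ : 0 < δ) (hδ₁ : δ < 1) :
    Tendsto (fun α => gapCenter δ α + 1) (𝓝[>] (δ - 1)) (𝓝 0) := by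
  have hW := tendsto_arcIntegral_arcWeight hδ hδ₁
  have hup := hW.const_div_atTop (Real.pi * (2 / (1 - δ)))
  refine squeeze_zero' ?_ ?_ hup
  · filter_upwards [eventually_center_mem hδ₁] with α hα
    have := gapCenter_mem (δ := δ) (α := α) hδ (by linarith [hα.1]) (by linarith [hα.2])
    linarith [this.1, hα.1]
  · filter_upwards [eventually_center_mem hδ₁] with α hα
    have h₁ : -1 < α - δ := by linarith [hα.1]
    have h₂ : α + δ < 1 := by linarith [hα.2]
    rw [le_div_iff₀ (arcIntegral_arcWeight_pos hδ h₁ h₂ Real.pi_pos)]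
    exact gapCenter_add_one_mul_le hδ h₁ h₂ hα.2.le

/-- Let W be the integral of w, so that c' - 1 is the integral of (t - c) w' divided by W. The main
part of (t - c) w' is (1 + c)(1 - t) w³/2. By convexity the integral of w³ is at least W³/π², and 1
+ c ≥ πδ/W, so c' - 1 grows at least linearly in W. -/
theorem le_gapCenterDeriv (hδ : 0 < δ) (h₁ : -1 < α - δ) (h₂ : α + δ < 1) (hα : α ≤ 0) :
    δ * (1 - δ) / (2 * Real.pi) * arcIntegral arcWeight δ α 0 - (1 / (1 - δ) + 1 / 2)
      ≤ gapCenterDeriv δ α - 1 := by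
  have hδ1 : 0 < 1 - δ := by linarith
  have hpi := Real.pi_pos
  have hW := arcIntegral_arcWeight_pos hδ h₁ h₂ hpi
  have hA := le_gapCenter_add_one_mul hδ h₁ h₂
  have hcm := gapCenter_mem hδ h₁ h₂
  rw [gapCenterDeriv, add_sub_cancel_left, le_div_iff₀ hW]
  set W := arcIntegral arcWeight δ α 0 with hWdef
  set c := gapCenter δ α with hcdef
  -- The least coefficient of w³ on the gap, where 1 - t ≥ 1 - δ.
  set K := (1 + c) * (1 - δ) / 2 with hK
  have hK0 : 0 < K := by
    have : 0 < 1 + c := by linarith [hcm.1]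
    positivity
  -- The mean of w over the arc, at which the tangent to the cube is taken.
  set l := W / Real.pi with hl
  have hl0 : 0 < l := by positivity
  have hpt : ∀ t ∈ Icc (α - δ) (α + δ),
      -(2 * K * l ^ 3) + (3 * K * l ^ 2 - (1 / (1 - δ) + 1 / 2)) * arcWeight t
        ≤ t * arcWeightDeriv t + -c * arcWeightDeriv t := by
    intro t ht
    have ht1 : t ∈ Ioo (-1 : ℝ) 1 := ⟨by linarith [ht.1], by linarith [ht.2]⟩
    have hw := arcWeight_pos ht1
    have p1 : 0 < 1 - t := by linarith [ht1.2]
    have p2 : 0 < 1 + t := by linarith [ht1.1]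
    have p3 : 1 - δ ≤ 1 - t := by linarith [ht.2]
    have hw2 : arcWeight t ^ 2 * ((1 - t) * (1 + t)) = 1 := by
      rw [arcWeight_sq ht1, show 1 - t ^ 2 = (1 - t) * (1 + t) by ring]
      field_simp
    -- Tangent line inequality for the cube at l: the difference is (w + 2l)(w - l)².
    have hw3 : 3 * l ^ 2 * arcWeight t - 2 * l ^ 3 ≤ arcWeight t ^ 3 := by
      nlinarith [mul_nonneg (by positivity : 0 ≤ arcWeight t + 2 * l) (sq_nonneg (arcWeight t - l))]
    -- Partial fractions of t(t - c)/(1 - t²): only the pole at t = -1 keeps a factor w³, and the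
    -- rest is a bounded multiple of w.
    have hmain : t * arcWeightDeriv t + -c * arcWeightDeriv t
        = (1 + c) * (1 - t) / 2 * arcWeight t ^ 3
          + ((t - c) / (2 * (1 - t)) - 1 / 2) * arcWeight t := by
      rw [arcWeightDeriv]
      have : arcWeight t ^ 3 = arcWeight t / ((1 - t) * (1 + t)) := by
        rw [eq_div_iff (by positivity)]
        linear_combination arcWeight t * hw2
      rw [this]
      field_simp
      ring
    have hcl : -(1 / (1 - δ)) ≤ (t - c) / (2 * (1 - t)) := by
      have h3 : -2 ≤ t - c := by linarith [ht1.1, hcm.2]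
      have h4 : -(1 / (1 - δ)) ≤ -2 / (2 * (1 - t)) := by
        have : 1 / (1 - t) ≤ 1 / (1 - δ) := one_div_le_one_div_of_le hδ1 p3
        have e : -2 / (2 * (1 - t)) = -(1 / (1 - t)) := by
          field_simp
        rw [e]
        linarith
      exact h4.trans (div_le_div_of_nonneg_right h3 (by linarith))
    have hfirst : K * (3 * l ^ 2 * arcWeight t - 2 * l ^ 3)
        ≤ (1 + c) * (1 - t) / 2 * arcWeight t ^ 3 := by
      refine (mul_le_mul_of_nonneg_left hw3 hK0.le).trans ?_
      refine mul_le_mul_of_nonneg_right ?_ (by positivity)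
      rw [hK]
      have : 0 < 1 + c := by linarith [hcm.1]
      nlinarith
    have hsecond : (-(1 / (1 - δ)) - 1 / 2) * arcWeight t
        ≤ ((t - c) / (2 * (1 - t)) - 1 / 2) * arcWeight t :=
      mul_le_mul_of_nonneg_right (by linarith) hw.le
    rw [hmain]
    linarith
  have h_integral := arcIntegral_mono
    (u := fun t => -(2 * K * l ^ 3) + (3 * K * l ^ 2 - (1 / (1 - δ) + 1 / 2)) * arcWeight t)
    (v := fun t => t * arcWeightDeriv t + -c * arcWeightDeriv t)
    (continuousOn_const.add (continuousOn_const.mul continuousOn_arcWeight))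
    (continuousOn_id_mul_arcWeightDeriv.add (continuousOn_const.mul continuousOn_arcWeightDeriv))
    hδ h₁ h₂ hpt hpi.le
  rw [arcIntegral_add_const_mul continuousOn_id_mul_arcWeightDeriv continuousOn_arcWeightDeriv
      hδ h₁ h₂, arcIntegral_add_const_mul (u := fun _ => -(2 * K * l ^ 3)) continuousOn_const
      continuousOn_arcWeight hδ h₁ h₂, arcIntegral_const, ← hWdef] at h_integral
  have hWl : W = Real.pi * l := by
    rw [hl]
    field_simp
  have hAl : δ ≤ (c + 1) * l := by
    rw [hWl] at hA
    have : Real.pi * δ ≤ Real.pi * ((c + 1) * l) := by linarith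
    exact le_of_mul_le_mul_left this hpi
  have hKl : δ * (1 - δ) / 2 ≤ K * l := by
    rw [hK]
    nlinarith
  have e1 : δ * (1 - δ) / (2 * Real.pi) * W = δ * (1 - δ) / 2 * l := by
    rw [hWl]
    field_simp
  rw [e1]
  have e2 : δ * (1 - δ) / 2 * l * W ≤ K * l * l * W := by
    refine mul_le_mul_of_nonneg_right (mul_le_mul_of_nonneg_right hKl hl0.le) hW.le
  have e3 : Real.pi * -(2 * K * l ^ 3) + 3 * K * l ^ 2 * W = K * l * l * W := by
    rw [hWl]
    ring
  linarith

theorem tendsto_gapCenterDeriv (hδ : 0 < δ) (hδ₁ : δ < 1) :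
    Tendsto (fun α => gapCenterDeriv δ α - 1) (𝓝[>] (δ - 1)) atTop := by
  have hk : 0 < δ * (1 - δ) / (2 * Real.pi) := by
    have : 0 < 1 - δ := by linarith
    have := Real.pi_pos
    positivity
  have h := tendsto_atTop_add_const_right _ (-(1 / (1 - δ) + 1 / 2))
    ((tendsto_arcIntegral_arcWeight hδ hδ₁).const_mul_atTop hk)
  refine tendsto_atTop_mono' _ ?_ h
  filter_upwards [eventually_center_mem hδ₁] with α hα
  exact le_gapCenterDeriv hδ (by linarith [hα.1]) (by linarith [hα.2]) hα.2.le

end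

/-! ### Variation and Green function at a fixed point as the left interval shrinks -/

section

variable {δ α : ℝ}

theorem arcIntegral_zero_sub {v : ℝ → ℝ} (hv : ContinuousOn v (Ioo (-1) 1)) (hδ : 0 < δ)
    (h₁ : -1 < α - δ) (h₂ : α + δ < 1) (φ : ℝ) :
    arcIntegral v δ α 0 - arcIntegral v δ α φ = ∫ θ in (0 : ℝ)..φ, v (α + δ * Real.cos θ) := by
  have hc := continuous_comp_arc hv hδ h₁ h₂
  rw [arcIntegral, arcIntegral, sub_eq_iff_eq_add]
  exact (intervalIntegral.integral_add_adjacent_intervals (hc.intervalIntegrable _ _)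
    (hc.intervalIntegrable _ _)).symm

/-- A bound independent of α for the part of the gap to the right of x; only the part near -1
degenerates in the limit. -/
theorem arcWeight_le {x t : ℝ} (hx : -1 < x) (hxt : x ≤ t) (ht : t ≤ δ) (hδ₁ : δ < 1) :
    arcWeight t ≤ (√((1 - δ) * (1 + x)))⁻¹ := by
  rw [arcWeight]
  refine inv_anti₀ (Real.sqrt_pos.2 (mul_pos (by linarith) (by linarith))) (Real.sqrt_le_sqrt ?_)
  rw [show 1 - t ^ 2 = (1 - t) * (1 + t) by ring]
  exact mul_le_mul (by linarith) (by linarith) (by linarith) (by linarith)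

theorem add_mul_cos_arccos {x : ℝ} (hδ : 0 < δ) (hx : x ∈ Icc (α - δ) (α + δ)) :
    α + δ * Real.cos (Real.arccos ((x - α) / δ)) = x := by
  rw [Real.cos_arccos, mul_div_cancel₀ _ hδ.ne']
  · ring
  · rw [le_div_iff₀ hδ]
    linarith [hx.1]
  · rw [div_le_iff₀ hδ]
    linarith [hx.2]

theorem le_add_mul_cos {x θ : ℝ} (hδ : 0 < δ) (hx : x ∈ Icc (α - δ) (α + δ))
    (hθ : θ ∈ Icc 0 (Real.arccos ((x - α) / δ))) : x ≤ α + δ * Real.cos θ := by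
  have h := Real.cos_le_cos_of_nonneg_of_le_pi hθ.1 (Real.arccos_le_pi _) hθ.2
  rw [← add_mul_cos_arccos hδ hx]
  nlinarith

theorem arccos_mem_Ioo {x : ℝ} (hδ : 0 < δ) (hx : x ∈ Ioo (α - δ) (α + δ)) :
    Real.arccos ((x - α) / δ) ∈ Ioo 0 Real.pi := by
  obtain ⟨hy1, hy2⟩ := neg_one_lt_and_lt_one_of_mem_gap hδ hx
  exact ⟨Real.arccos_pos.2 hy2, Real.arccos_lt_pi.2 hy1⟩

/-- The integral part of the variation vanishes at φ = 0, so it is minus an integral over [0, φ],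
where t ≥ x keeps the weight and its derivative bounded. The only unbounded contribution is then c'
- 1, entering with a negative sign. -/
theorem gapVariation_le {x : ℝ} (hδ : 0 < δ) (h₁ : -1 < α - δ) (h₂ : α + δ < 1) (hα : α ≤ 0)
    (hx : x ∈ Ioo (α - δ) (α + δ)) :
    gapVariation δ α (Real.arccos ((x - α) / δ)) ≤
      2 * (√((1 - δ) * (1 + x)))⁻¹ / (δ * Real.sin (Real.arccos ((x - α) / δ))) +
        -(Real.arccos ((x - α) / δ) *
          ((gapCenterDeriv δ α - 1) - 2 * (√((1 - δ) * (1 + x)))⁻¹ ^ 3)) := by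
  have hx' := Ioo_subset_Icc_self hx
  have hφ := arccos_mem_Ioo hδ hx
  have hle := fun θ hθ => le_add_mul_cos (θ := θ) hδ hx' hθ
  have hxφ := add_mul_cos_arccos hδ hx'
  set φ := Real.arccos ((x - α) / δ) with hφdef
  set L := (√((1 - δ) * (1 + x)))⁻¹ with hL
  have hx1 : -1 < x := by linarith [hx.1]
  have hcm := gapCenter_mem hδ h₁ h₂
  have hc' := one_le_gapCenterDeriv hδ h₁ h₂
  have hsin : 0 < Real.sin φ := Real.sin_pos_of_pos_of_lt_pi hφ.1 hφ.2
  have hwx := arcWeight_pos (t := x) ⟨hx1, by linarith [hx.2]⟩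
  have hL0 : 0 < L := inv_pos.2 (Real.sqrt_pos.2 (mul_pos (by linarith) (by linarith)))
  rw [gapVariation, hxφ]
  refine add_le_add ?_ ?_
  · refine div_le_div_of_nonneg_right ?_ (by positivity)
    have hwL := arcWeight_le hx1 le_rfl (by linarith [hx.2] : x ≤ δ) (by linarith)
    refine mul_le_mul ?_ hwL hwx.le zero_le_two
    linarith [hx.2, hcm.1]
  · have hW := arcIntegral_arcWeight_pos hδ h₁ h₂ Real.pi_pos
    have h0 : (gapCenterDeriv δ α - 1) * arcIntegral arcWeight δ α 0 +
        gapCenter δ α * arcIntegral arcWeightDeriv δ α 0 -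
        arcIntegral (fun t => t * arcWeightDeriv t) δ α 0 = 0 := by
      rw [gapCenterDeriv]
      field_simp
      ring
    have e1 := arcIntegral_zero_sub continuousOn_arcWeight hδ h₁ h₂ φ
    have e2 := arcIntegral_zero_sub continuousOn_arcWeightDeriv hδ h₁ h₂ φ
    have e3 := arcIntegral_zero_sub continuousOn_id_mul_arcWeightDeriv hδ h₁ h₂ φ
    have c1 := continuous_comp_arc continuousOn_arcWeight hδ h₁ h₂
    have c2 := continuous_comp_arc continuousOn_arcWeightDeriv hδ h₁ h₂
    have c3 := continuous_comp_arc continuousOn_id_mul_arcWeightDeriv hδ h₁ h₂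
    have hsum : ∫ θ in (0 : ℝ)..φ, ((gapCenterDeriv δ α - 1) * arcWeight (α + δ * Real.cos θ) +
        gapCenter δ α * arcWeightDeriv (α + δ * Real.cos θ) -
        (α + δ * Real.cos θ) * arcWeightDeriv (α + δ * Real.cos θ))
        = (gapCenterDeriv δ α - 1) * (arcIntegral arcWeight δ α 0 - arcIntegral arcWeight δ α φ) +
        gapCenter δ α * (arcIntegral arcWeightDeriv δ α 0 - arcIntegral arcWeightDeriv δ α φ) -
        (arcIntegral (fun t => t * arcWeightDeriv t) δ α 0 -
          arcIntegral (fun t => t * arcWeightDeriv t) δ α φ) := by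
      rw [e1, e2, e3, intervalIntegral.integral_sub, intervalIntegral.integral_add,
        intervalIntegral.integral_const_mul, intervalIntegral.integral_const_mul]
      · exact (c1.intervalIntegrable _ _).const_mul _
      · exact (c2.intervalIntegrable _ _).const_mul _
      · exact ((c1.intervalIntegrable _ _).const_mul _).add
          ((c2.intervalIntegrable _ _).const_mul _)
      · exact c3.intervalIntegrable _ _
    have hlow : φ * ((gapCenterDeriv δ α - 1) - 2 * L ^ 3) ≤
        ∫ θ in (0 : ℝ)..φ, ((gapCenterDeriv δ α - 1) * arcWeight (α + δ * Real.cos θ) +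
        gapCenter δ α * arcWeightDeriv (α + δ * Real.cos θ) -
        (α + δ * Real.cos θ) * arcWeightDeriv (α + δ * Real.cos θ)) := by
      have hconst : ∫ _ in (0 : ℝ)..φ, ((gapCenterDeriv δ α - 1) - 2 * L ^ 3)
          = φ * ((gapCenterDeriv δ α - 1) - 2 * L ^ 3) := by
        rw [intervalIntegral.integral_const, sub_zero, smul_eq_mul]
      rw [← hconst]
      refine intervalIntegral.integral_mono_on hφ.1.le intervalIntegrable_const
        ((((c1.const_mul _).add (c2.const_mul _)).sub c3).intervalIntegrable _ _) fun θ hθ => ?_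
      have hxt := hle θ hθ
      have ht := add_mul_cos_mem_Ioo hδ h₁ h₂ θ
      have ht' := add_mul_cos_mem_Icc hδ α θ
      set t := α + δ * Real.cos θ with htdef
      have hw1 := one_le_arcWeight ht
      have hw0 := arcWeight_pos ht
      have hwL := arcWeight_le hx1 hxt (by linarith [ht'.2] : t ≤ δ) (by linarith)
      have hd : |(gapCenter δ α - t) * arcWeightDeriv t| ≤ 2 * L ^ 3 := by
        have ha : |gapCenter δ α - t| ≤ 2 := by
          rw [abs_le]
          constructor <;> linarith [hcm.1, hcm.2, ht.1, ht.2]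
        have hb : |arcWeightDeriv t| ≤ L ^ 3 := by
          rw [arcWeightDeriv, abs_mul, abs_of_pos (pow_pos hw0 3)]
          have ht1 : |t| ≤ 1 := abs_le.2 ⟨ht.1.le, ht.2.le⟩
          calc |t| * arcWeight t ^ 3 ≤ 1 * L ^ 3 :=
                mul_le_mul ht1 (pow_le_pow_left₀ hw0.le hwL 3) (by positivity) zero_le_one
            _ = L ^ 3 := one_mul _
        rw [abs_mul]
        exact mul_le_mul ha hb (abs_nonneg _) zero_le_two
      have hm : gapCenterDeriv δ α - 1 ≤ (gapCenterDeriv δ α - 1) * arcWeight t :=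
        le_mul_of_one_le_right (by linarith) hw1
      linarith [(abs_le.1 hd).1]
    linarith

theorem eventually_mem_gap {x : ℝ} (hx : x ∈ Ioo (-1) (-1 + 2 * δ)) :
    ∀ᶠ α in 𝓝[>] (δ - 1), x ∈ Ioo (α - δ) (α + δ) := by
  have e1 : ∀ᶠ α : ℝ in 𝓝 (δ - 1), α - δ < x :=
    (by fun_prop : Continuous fun α : ℝ => α - δ).continuousAt.eventually
      (gt_mem_nhds (by linarith [hx.1]))
  have e2 : ∀ᶠ α : ℝ in 𝓝 (δ - 1), x < α + δ :=
    (by fun_prop : Continuous fun α : ℝ => α + δ).continuousAt.eventually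
      (lt_mem_nhds (by linarith [hx.2]))
  exact (e1.and e2).filter_mono nhdsWithin_le_nhds

theorem tendsto_arccos_left (δ x : ℝ) : Tendsto (fun α => Real.arccos ((x - α) / δ)) (𝓝[>] (δ - 1))
    (𝓝 (Real.arccos ((x - (δ - 1)) / δ))) :=
  (Continuous.tendsto (by fun_prop) _).mono_left nhdsWithin_le_nhds

/-- Every point left of `-1 + 2δ` is eventually left of the zero of the variation. -/
theorem eventually_gapVariation_neg {x : ℝ} (hδ : 0 < δ) (hδ₁ : δ < 1)
    (hx : x ∈ Ioo (-1) (-1 + 2 * δ)) :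
    ∀ᶠ α in 𝓝[>] (δ - 1), gapVariation δ α (Real.arccos ((x - α) / δ)) < 0 := by
  set L := (√((1 - δ) * (1 + x)))⁻¹ with hL
  have hφ0 : Real.arccos ((x - (δ - 1)) / δ) ∈ Ioo 0 Real.pi :=
    arccos_mem_Ioo hδ ⟨by linarith [hx.1], by linarith [hx.2]⟩
  have hφ := tendsto_arccos_left δ x
  have hsin : 0 < Real.sin (Real.arccos ((x - (δ - 1)) / δ)) :=
    Real.sin_pos_of_pos_of_lt_pi hφ0.1 hφ0.2
  have hfirst := (tendsto_const_nhds (x := 2 * L)).div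
    (((Real.continuous_sin.tendsto _).comp hφ).const_mul δ) (mul_pos hδ hsin).ne'
  have hsecond := tendsto_neg_atTop_atBot.comp (hφ.pos_mul_atTop hφ0.1
    (tendsto_atTop_add_const_right _ (-(2 * L ^ 3)) (tendsto_gapCenterDeriv hδ hδ₁)))
  have hbot := (hfirst.add_atBot hsecond).eventually_lt_atBot 0
  filter_upwards [hbot, eventually_mem_gap hx, eventually_center_mem hδ₁] with α hα hgap hmem
  refine (gapVariation_le hδ (by linarith [hmem.1]) (by linarith [hmem.2]) hmem.2.le hgap).trans_lt
    ?_
  rw [← hL]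
  simpa [sub_eq_add_neg] using hα

/-- The limit of the density of the Green function as the left interval shrinks to a point. -/
noncomputable def limitWeight (δ t : ℝ) : ℝ := √((1 + t) / max (1 - t) (1 - δ))

/-- The maximum in the denominator is inactive for t ≤ δ. It only provides continuity on the whole
line, so that limits may be taken with the gap reaching -1. -/
theorem continuous_limitWeight (hδ₁ : δ < 1) : Continuous (limitWeight δ) := by
  refine Real.continuous_sqrt.comp (Continuous.div (by fun_prop) (by fun_prop) fun t => ?_)
  exact (lt_max_of_lt_right (by linarith)).ne'

theorem limitWeight_eq {t : ℝ} (ht : t ∈ Ioo (-1 : ℝ) 1) (htδ : t ≤ δ) :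
    limitWeight δ t = (t + 1) * arcWeight t := by
  have p1 : 0 < 1 - t := by linarith [ht.2]
  have p2 : 0 < 1 + t := by linarith [ht.1]
  have hw := arcWeight_pos ht
  rw [limitWeight, max_eq_left (by linarith)]
  refine (Real.sqrt_eq_iff_mul_self_eq_of_pos (mul_pos (by linarith) hw)).2 ?_
  rw [← pow_two]
  rw [mul_pow, arcWeight_sq ht, show 1 - t ^ 2 = (1 - t) * (1 + t) by ring]
  field_simp
  ring

/-- At x = δ - 1 + δ cos φ the argument of arcosh is (δ - x)/(1 - δ), so this is the one-interval
Green function in the angular variable of the limiting gap. -/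
theorem integral_limitWeight {φ : ℝ} (hδ : 0 < δ) (hδ₁ : δ < 1) (hφ : φ ∈ Icc 0 Real.pi) :
    ∫ θ in (0 : ℝ)..φ, limitWeight δ (δ - 1 + δ * Real.cos θ)
      = Real.arcosh ((1 - δ * Real.cos φ) / (1 - δ)) := by
  have hδ' : 0 < 1 - δ := by linarith
  have hone : ∀ θ, 1 ≤ (1 - δ * Real.cos θ) / (1 - δ) := fun θ => by
    rw [one_le_div hδ']
    nlinarith [Real.cos_le_one θ]
  have hcont : ContinuousOn (fun θ => Real.arcosh ((1 - δ * Real.cos θ) / (1 - δ))) (Icc 0 φ) :=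
    Real.continuousOn_arcosh.comp (by fun_prop) fun θ _ => hone θ
  have h := intervalIntegral.integral_eq_sub_of_hasDerivAt_of_le hφ.1 hcont
    (f' := fun θ => limitWeight δ (δ - 1 + δ * Real.cos θ)) (fun θ hθ => ?_)
    (((continuous_limitWeight hδ₁).comp (by fun_prop)).intervalIntegrable _ _)
  · rw [h, Real.cos_zero, mul_one, div_self hδ'.ne', Real.arcosh_zero, sub_zero]
  · have hsin : 0 < Real.sin θ := Real.sin_pos_of_pos_of_lt_pi hθ.1 (hθ.2.trans_le hφ.2)
    have hsq := Real.sin_sq_add_cos_sq θ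
    have hc1 : Real.cos θ < 1 := by nlinarith [Real.cos_le_one θ]
    have hc2 : -1 < Real.cos θ := by nlinarith [Real.neg_one_le_cos θ]
    set C := Real.cos θ with hC
    have hu : 1 < (1 - δ * C) / (1 - δ) := by
      rw [one_lt_div hδ']
      nlinarith
    have hlin : HasDerivAt (fun θ => (1 - δ * Real.cos θ) / (1 - δ))
        (δ * Real.sin θ / (1 - δ)) θ := by
      refine ((((Real.hasDerivAt_cos θ).const_mul δ).const_sub 1).div_const (1 - δ)).congr_deriv ?_
      ring
    refine ((Real.hasDerivAt_arcosh hu).comp θ hlin).congr_deriv ?_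
    have hu2 : 0 < ((1 - δ * C) / (1 - δ)) ^ 2 - 1 := by nlinarith
    rw [inv_mul_eq_iff_eq_mul₀ (Real.sqrt_pos.2 hu2).ne', limitWeight, ← Real.sqrt_mul hu2.le,
      max_eq_left (by nlinarith)]
    symm
    refine (Real.sqrt_eq_iff_mul_self_eq_of_pos (by positivity)).2 ?_
    rw [← pow_two]
    have hS : Real.sin θ ^ 2 = (1 - C) * (1 + C) := by linear_combination hsq
    have p : 1 - (δ - 1 + δ * C) ≠ 0 := by nlinarith
    rw [div_pow, mul_pow, hS]
    field_simp
    ring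

/-- The Green functions of two intervals converge to that of one interval as the left interval
shrinks to a point. -/
theorem tendsto_greenTwo {x : ℝ} (hδ : 0 < δ) (hδ₁ : δ < 1) (hx : x ∈ Ioo (-1) (-1 + 2 * δ)) :
    Tendsto (fun α => greenTwo α δ x) (𝓝[>] (δ - 1)) (𝓝 (greenOne δ x)) := by
  have hδ' : 0 < 1 - δ := by linarith
  set L := (√((1 - δ) * (1 + x)))⁻¹ with hL
  have hφ := tendsto_arccos_left δ x
  set φ₀ := Real.arccos ((x - (δ - 1)) / δ) with hφ₀
  have hid : Tendsto (fun α : ℝ => α) (𝓝[>] (δ - 1)) (𝓝 (δ - 1)) :=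
    tendsto_id.mono_left nhdsWithin_le_nhds
  have hJ := continuous_arcIntegral (continuous_limitWeight hδ₁) δ
  -- The Green function is the integral of (t - c) w over [0, φ]. Writing t - c = (t + 1) - (c + 1)
  -- leaves a part continuous up to the limit and an error that vanishes, since c → -1 and w is
  -- bounded on [0, φ].
  have hmain : Tendsto (fun α => arcIntegral (limitWeight δ) δ α 0 -
      arcIntegral (limitWeight δ) δ α (Real.arccos ((x - α) / δ))) (𝓝[>] (δ - 1))
      (𝓝 (arcIntegral (limitWeight δ) δ (δ - 1) 0 - arcIntegral (limitWeight δ) δ (δ - 1) φ₀)) :=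
    ((hJ.tendsto (δ - 1, 0)).comp (hid.prodMk_nhds tendsto_const_nhds)).sub
      ((hJ.tendsto (δ - 1, φ₀)).comp (hid.prodMk_nhds hφ))
  have hlimit : arcIntegral (limitWeight δ) δ (δ - 1) 0 -
      arcIntegral (limitWeight δ) δ (δ - 1) φ₀ = greenOne δ x := by
    have hc : Continuous fun θ => limitWeight δ (δ - 1 + δ * Real.cos θ) :=
      (continuous_limitWeight hδ₁).comp (by fun_prop)
    have h1 : arcIntegral (limitWeight δ) δ (δ - 1) 0 - arcIntegral (limitWeight δ) δ (δ - 1) φ₀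
        = ∫ θ in (0 : ℝ)..φ₀, limitWeight δ (δ - 1 + δ * Real.cos θ) := by
      rw [arcIntegral, arcIntegral, sub_eq_iff_eq_add]
      exact (intervalIntegral.integral_add_adjacent_intervals (hc.intervalIntegrable _ _)
        (hc.intervalIntegrable _ _)).symm
    have h2 := add_mul_cos_arccos (α := δ - 1) (x := x) hδ
      ⟨by linarith [hx.1], by linarith [hx.2]⟩
    rw [h1, integral_limitWeight hδ hδ₁ ⟨Real.arccos_nonneg _, Real.arccos_le_pi _⟩,
      greenOne_eq hδ₁ (by linarith [hx.2]), max_eq_right]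
    · congr 2
      linarith
    · rw [one_le_div hδ']
      linarith [hx.2]
  have herr : Tendsto (fun α => (gapCenter δ α + 1) * ∫ θ in
      (0 : ℝ)..Real.arccos ((x - α) / δ), arcWeight (α + δ * Real.cos θ)) (𝓝[>] (δ - 1)) (𝓝 0) := by
    have hup : Tendsto (fun α => (gapCenter δ α + 1) * (Real.pi * L)) (𝓝[>] (δ - 1)) (𝓝 0) := by
      simpa using (tendsto_gapCenter hδ hδ₁).mul_const (Real.pi * L)
    refine squeeze_zero' ?_ ?_ hup
    all_goals
      filter_upwards [eventually_mem_gap hx, eventually_center_mem hδ₁] with α hgap hmem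
      have h₁ : -1 < α - δ := by linarith [hmem.1]
      have h₂ : α + δ < 1 := by linarith [hmem.2]
      have hc0 : 0 ≤ gapCenter δ α + 1 := by linarith [(gapCenter_mem hδ h₁ h₂).1]
      have hφm := arccos_mem_Ioo hδ hgap
    · exact mul_nonneg hc0 (intervalIntegral.integral_nonneg hφm.1.le fun θ _ =>
        (arcWeight_pos (add_mul_cos_mem_Ioo hδ h₁ h₂ θ)).le)
    · refine mul_le_mul_of_nonneg_left ?_ hc0
      have hL0 : 0 < L := inv_pos.2 (Real.sqrt_pos.2 (mul_pos hδ' (by linarith [hx.1])))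
      have hle : ∫ θ in (0 : ℝ)..Real.arccos ((x - α) / δ), arcWeight (α + δ * Real.cos θ)
          ≤ ∫ _ in (0 : ℝ)..Real.arccos ((x - α) / δ), L := by
        refine intervalIntegral.integral_mono_on hφm.1.le
          ((continuous_comp_arc continuousOn_arcWeight hδ h₁ h₂).intervalIntegrable _ _)
          intervalIntegrable_const fun θ hθ => ?_
        refine arcWeight_le hx.1 (le_add_mul_cos hδ (Ioo_subset_Icc_self hgap) hθ) ?_ hδ₁
        linarith [(add_mul_cos_mem_Icc hδ α θ).2, hmem.2]
      refine hle.trans ?_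
      rw [intervalIntegral.integral_const, sub_zero, smul_eq_mul]
      exact mul_le_mul_of_nonneg_right hφm.2.le hL0.le
  have hlim := hmain.sub herr
  rw [hlimit, sub_zero] at hlim
  refine hlim.congr' ?_
  filter_upwards [eventually_mem_gap hx, eventually_center_mem hδ₁] with α hgap hmem
  have h₁ : -1 < α - δ := by linarith [hmem.1]
  have h₂ : α + δ < 1 := by linarith [hmem.2]
  rw [greenTwo_eq_gapGreen hδ h₁ h₂ ⟨hx.1.le, by linarith [hx.2]⟩]
  set φ := Real.arccos ((x - α) / δ) with hφdef
  have hcongr : ∀ ψ, arcIntegral (limitWeight δ) δ α ψ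
      = arcIntegral (fun t => t * arcWeight t + 1 * arcWeight t) δ α ψ := fun ψ =>
    arcIntegral_congr (lo := α - δ) (hi := α + δ) (fun t ht => by
      rw [limitWeight_eq ⟨by linarith [ht.1], by linarith [ht.2]⟩ (by linarith [ht.2, hmem.2])]
      ring) hδ le_rfl le_rfl ψ
  rw [← arcIntegral_zero_sub continuousOn_arcWeight hδ h₁ h₂, hcongr, hcongr,
    arcIntegral_add_const_mul continuousOn_id_mul_arcWeight continuousOn_arcWeight hδ h₁ h₂,
    arcIntegral_add_const_mul continuousOn_id_mul_arcWeight continuousOn_arcWeight hδ h₁ h₂,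
    gapGreen, ← gapCenter_mul hδ h₁ h₂]
  ring

end

/-! ### The symmetric gap -/

section

variable {δ : ℝ}

theorem arcIntegral_eq_zero_of_odd {v : ℝ → ℝ} (hv : ∀ t, v (-t) = -v t) (δ : ℝ) :
    arcIntegral v δ 0 0 = 0 := by
  have h := intervalIntegral.integral_comp_sub_left (a := 0) (b := Real.pi)
    (fun θ => v (0 + δ * Real.cos θ)) Real.pi
  have e : ∀ θ, v (0 + δ * Real.cos (Real.pi - θ)) = -v (0 + δ * Real.cos θ) := fun θ => by
    rw [Real.cos_pi_sub, ← hv]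
    ring_nf
  simp only [e, sub_self, sub_zero, intervalIntegral.integral_neg] at h
  rw [arcIntegral]
  linarith

theorem two_mul_arcIntegral_half_of_even {v : ℝ → ℝ} (hc : ContinuousOn v (Ioo (-1) 1))
    (hv : ∀ t, v (-t) = v t) (hδ : 0 < δ) (hδ₁ : δ < 1) :
    2 * arcIntegral v δ 0 (Real.pi / 2) = arcIntegral v δ 0 0 := by
  have h := intervalIntegral.integral_comp_sub_left (a := 0) (b := Real.pi / 2)
    (fun θ => v (0 + δ * Real.cos θ)) Real.pi
  have e : ∀ θ, v (0 + δ * Real.cos (Real.pi - θ)) = v (0 + δ * Real.cos θ) := fun θ => by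
    rw [Real.cos_pi_sub, ← hv]
    ring_nf
  have e2 : Real.pi - Real.pi / 2 = Real.pi / 2 := by ring
  simp only [e, sub_zero, e2] at h
  have h0 := arcIntegral_zero_sub (α := 0) hc hδ (by linarith) (by linarith) (Real.pi / 2)
  rw [h, ← arcIntegral] at h0
  linarith

theorem arcWeight_neg (t : ℝ) : arcWeight (-t) = arcWeight t := by
  simp [arcWeight]

theorem gapCenter_zero (δ : ℝ) : gapCenter δ 0 = 0 := by
  rw [gapCenter, arcIntegral_eq_zero_of_odd (fun t => by rw [arcWeight_neg]; ring), zero_div]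

/-- By symmetry c = 0 and the integrals from π/2 are half of those from 0, where the integral part
of the variation vanishes. -/
theorem gapVariation_zero_half_pi (hδ : 0 < δ) (hδ₁ : δ < 1) :
    gapVariation δ 0 (Real.pi / 2) = 0 := by
  have hW := arcIntegral_arcWeight_pos (α := 0) hδ (by linarith) (by linarith) Real.pi_pos
  have e1 := two_mul_arcIntegral_half_of_even continuousOn_arcWeight arcWeight_neg hδ hδ₁
  have e2 := two_mul_arcIntegral_half_of_even continuousOn_id_mul_arcWeightDeriv
    (fun t => by rw [arcWeightDeriv, arcWeightDeriv, arcWeight_neg]; ring) hδ hδ₁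
  have h0 : (gapCenterDeriv δ 0 - 1) * arcIntegral arcWeight δ 0 0 =
      arcIntegral (fun t => t * arcWeightDeriv t) δ 0 0 := by
    rw [gapCenterDeriv, gapCenter_zero]
    field_simp
    ring
  rw [gapVariation, Real.cos_pi_div_two, gapCenter_zero]
  rw [← e1, ← e2] at h0
  have : (gapCenterDeriv δ 0 - 1) * arcIntegral arcWeight δ 0 (Real.pi / 2) =
      arcIntegral (fun t => t * arcWeightDeriv t) δ 0 (Real.pi / 2) := by linarith
  rw [this]
  ring

theorem greenTwo_zero_zero (hδ : 0 < δ) (hδ₁ : δ < 1) :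
    greenTwo 0 δ 0 = 1 / 2 * Real.log ((1 + δ) / (1 - δ)) := by
  have hm : 0 < 1 - δ := by linarith
  have hp : 0 < 1 + δ := by linarith
  have hr : 0 < 1 - δ ^ 2 := by nlinarith
  rw [greenTwo_eq_gapGreen hδ (by linarith) (by linarith) ⟨by linarith, by linarith⟩]
  simp only [sub_self, zero_div, Real.arccos_zero]
  rw [gapGreen_eq_integral hδ (by linarith) (by linarith), gapCenter_zero]
  set r := √(1 - δ ^ 2) with hrdef
  have hr0 : 0 < r := Real.sqrt_pos.2 hr
  have hr2 : r ^ 2 = 1 - δ ^ 2 := Real.sq_sqrt hr.le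
  have h_integral : ∫ θ in (Real.pi / 2)..Real.pi,
      (0 - (0 + δ * Real.cos θ)) * arcWeight (0 + δ * Real.cos θ)
      = -Real.arsinh (δ * Real.sin Real.pi / r) -
        -Real.arsinh (δ * Real.sin (Real.pi / 2) / r) := by
    refine intervalIntegral.integral_eq_sub_of_hasDerivAt
      -- Here 1 - δ² cos² θ = r² + δ² sin² θ, which makes arsinh the primitive.
      (f := fun θ => -Real.arsinh (δ * Real.sin θ / r)) (fun θ _ => ?_) ?_
    · have h1 := ((((Real.hasDerivAt_sin θ).const_mul δ).div_const r).arsinh).neg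
      refine h1.congr_deriv ?_
      have hsq := Real.sin_sq_add_cos_sq θ
      have hpos := one_sub_sq_pos (add_mul_cos_mem_Ioo (α := 0) hδ (by linarith) (by linarith) θ)
      have e : 1 + (δ * Real.sin θ / r) ^ 2 = (1 - (0 + δ * Real.cos θ) ^ 2) / r ^ 2 := by
        field_simp
        rw [hr2]
        linear_combination δ ^ 2 * hsq
      rw [e, Real.sqrt_div hpos.le, Real.sqrt_sq hr0.le, arcWeight]
      have hs := Real.sqrt_pos.2 hpos
      simp only [smul_eq_mul]
      field_simp
      ring
    · have hc := continuous_comp_arc (α := 0) continuousOn_arcWeight hδ (by linarith) (by linarith)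
      exact (Continuous.mul (by fun_prop) hc).intervalIntegrable _ _
  rw [h_integral, Real.sin_pi, Real.sin_pi_div_two, mul_zero, zero_div, Real.arsinh_zero, mul_one,
    Real.arsinh]
  have e1 : 1 + (δ / r) ^ 2 = (1 / r) ^ 2 := by
    field_simp
    rw [hr2]
    ring
  have e2 : δ / r + 1 / r = (1 + δ) / r := by ring
  rw [e1, Real.sqrt_sq (by positivity), e2, Real.log_div hp.ne' hr0.ne',
    Real.log_div hp.ne' hm.ne', hrdef, Real.log_sqrt hr.le,
    show 1 - δ ^ 2 = (1 - δ) * (1 + δ) by ring, Real.log_mul hm.ne' hp.ne']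
  ring

end

/-! ### The envelope -/

theorem greenOne_nonneg {δ x : ℝ} (hδ : δ < 1) (hx : x ≤ 1) : 0 ≤ greenOne δ x := by
  rw [greenOne_eq hδ hx]
  exact Real.arcosh_nonneg (le_max_left _ _)

theorem greenOne_le_greenOne {δ δ' x : ℝ} (h : δ ≤ δ') (hδ' : δ' < 1) (hx : x ≤ 1) :
    greenOne δ x ≤ greenOne δ' x := by
  rw [greenOne_eq (h.trans_lt hδ') hx, greenOne_eq hδ' hx,
    Real.arcosh_le_arcosh (lt_max_of_lt_left one_pos) (lt_max_of_lt_left one_pos)]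
  refine max_le_max_left 1 ?_
  rw [div_le_div_iff₀ (by linarith) (by linarith)]
  nlinarith

theorem tendsto_greenOne {ι : Type*} {l : Filter ι} {d y : ι → ℝ} {d₀ y₀ : ℝ}
    (hd : Tendsto d l (𝓝 d₀)) (hy : Tendsto y l (𝓝 y₀)) (hd₀ : d₀ < 1) (hy₀ : y₀ < 1) :
    Tendsto (fun i => greenOne (d i) (y i)) l (𝓝 (greenOne d₀ y₀)) := by
  have harg : Tendsto (fun i => max 1 ((d i - y i) / (1 - d i))) l
      (𝓝 (max 1 ((d₀ - y₀) / (1 - d₀)))) :=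
    tendsto_const_nhds.max ((hd.sub hy).div (hd.const_sub 1) (by linarith))
  have hw : Tendsto (fun i => max 1 ((d i - y i) / (1 - d i))) l
      (𝓝[Ici 1] (max 1 ((d₀ - y₀) / (1 - d₀)))) :=
    tendsto_nhdsWithin_iff.2 ⟨harg, Eventually.of_forall fun i => mem_Ici.2 (le_max_left _ _)⟩
  have hc := (Real.continuousOn_arcosh (max 1 ((d₀ - y₀) / (1 - d₀)))
    (mem_Ici.2 (le_max_left _ _))).tendsto
  rw [greenOne_eq hd₀ hy₀.le]
  refine (hc.comp hw).congr' ?_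
  filter_upwards [hd.eventually (gt_mem_nhds hd₀), hy.eventually (gt_mem_nhds hy₀)] with i h1 h2
  exact (greenOne_eq h1 h2.le).symm

section

variable {δ : ℝ}

theorem continuousAt_greenTwo {α x : ℝ} (hδ : 0 < δ) (h₁ : -1 < α - δ) (h₂ : α + δ < 1)
    (hx : x ∈ Icc (-1 : ℝ) 1) : ContinuousAt (fun β => greenTwo β δ x) α := by
  have hpair : ContinuousAt (fun β => (β, Real.arccos ((x - β) / δ))) α := by
    fun_prop
  have hI : ∀ {v : ℝ → ℝ}, ContinuousOn v (Ioo (-1) 1) →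
      ContinuousAt (fun β => arcIntegral v δ β (Real.arccos ((x - β) / δ))) α := fun {v} hv =>
    ContinuousAt.comp (f := fun β => (β, Real.arccos ((x - β) / δ)))
      (g := fun p : ℝ × ℝ => arcIntegral v δ p.1 p.2)
      (continuousAt_arcIntegral hv hδ h₁ h₂ _) hpair
  have hG : ContinuousAt (fun β => gapGreen δ β (Real.arccos ((x - β) / δ))) α :=
    ((hasDerivAt_gapCenter hδ h₁ h₂).continuousAt.mul (hI continuousOn_arcWeight)).sub
      (hI continuousOn_id_mul_arcWeight)
  refine hG.congr ?_
  have e1 : ∀ᶠ β : ℝ in 𝓝 α, -1 < β - δ :=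
    (by fun_prop : Continuous fun β : ℝ => β - δ).continuousAt.eventually (lt_mem_nhds h₁)
  have e2 : ∀ᶠ β : ℝ in 𝓝 α, β + δ < 1 :=
    (by fun_prop : Continuous fun β : ℝ => β + δ).continuousAt.eventually (gt_mem_nhds h₂)
  filter_upwards [e1, e2] with β hβ1 hβ2
  exact (greenTwo_eq_gapGreen hδ hβ1 hβ2 hx).symm

/-- The variation of the Green function increases through the gap. -/
theorem strictMonoOn_gapVariation_arccos {α : ℝ} (hδ : 0 < δ) (h₁ : -1 < α - δ)
    (h₂ : α + δ < 1) :
    StrictMonoOn (fun x => gapVariation δ α (Real.arccos ((x - α) / δ)))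
      (Ioo (α - δ) (α + δ)) := by
  intro x hx y hy hxy
  refine strictAntiOn_gapVariation hδ h₁ h₂ (arccos_mem_Ioo hδ hy) (arccos_mem_Ioo hδ hx) ?_
  refine Real.arccos_lt_arccos (neg_one_lt_and_lt_one_of_mem_gap hδ hx).1.le ?_
    (neg_one_lt_and_lt_one_of_mem_gap hδ hy).2.le
  exact div_lt_div_of_pos_right (by linarith) hδ

theorem exists_zero_in_gap {α : ℝ} (hδ : 0 < δ) (h₁ : -1 < α - δ) (h₂ : α + δ < 1) :
    ∃ x ∈ Ioo (α - δ) (α + δ), gapVariation δ α (Real.arccos ((x - α) / δ)) = 0 := by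
  obtain ⟨φ, hφ, h⟩ := exists_gapVariation_eq_zero hδ h₁ h₂
  have hsin : 0 < Real.sin φ := Real.sin_pos_of_pos_of_lt_pi hφ.1 hφ.2
  have hsq := Real.sin_sq_add_cos_sq φ
  have hc1 : Real.cos φ < 1 := by nlinarith [Real.cos_le_one φ]
  have hc2 : -1 < Real.cos φ := by nlinarith [Real.neg_one_le_cos φ]
  refine ⟨α + δ * Real.cos φ, ⟨by nlinarith, by nlinarith⟩, ?_⟩
  rw [add_sub_cancel_left, mul_div_cancel_left₀ _ hδ.ne', Real.arccos_cos hφ.1.le hφ.2.le, h]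

theorem isGapCritical_iff {α x : ℝ} (hδ : 0 < δ) (h₁ : -1 < α - δ) (h₂ : α + δ < 1) :
    IsGapCritical δ α x ↔
      x ∈ Ioo (α - δ) (α + δ) ∧ gapVariation δ α (Real.arccos ((x - α) / δ)) = 0 := by
  refine and_congr_right fun hx => ?_
  have h := hasDerivAt_greenTwo hδ h₁ h₂ hx
  exact ⟨fun h' => h.unique h', fun h' => h' ▸ h⟩

theorem isGapCritical_zero_zero (hδ : 0 < δ) (hδ₁ : δ < 1) : IsGapCritical δ 0 0 := by
  rw [isGapCritical_iff hδ (by linarith) (by linarith)]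
  refine ⟨⟨by linarith, by linarith⟩, ?_⟩
  rw [sub_self, zero_div, Real.arccos_zero, gapVariation_zero_half_pi hδ hδ₁]

theorem greenTwo_le_of_mem {α x : ℝ} (hδ : 0 < δ) (hδ₁ : δ < 1) (hα : α ∈ Ioc (δ - 1) 0)
    (hx : x ≤ 1) : greenTwo α δ x ≤ greenOne ((1 + δ) / 2) x :=
  (greenTwo_le_greenOne hδ (by linarith [hα.1]) (by linarith [hα.2]) x).trans
    (greenOne_le_greenOne (by linarith [hα.2]) (by linarith) hx)

theorem bddAbove_greenTwo {x : ℝ} (hδ : 0 < δ) (hδ₁ : δ < 1) (hx : x ≤ 1) :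
    BddAbove ((fun α => greenTwo α δ x) '' Ioc (δ - 1) 0) := by
  refine ⟨greenOne ((1 + δ) / 2) x, ?_⟩
  rintro _ ⟨α, hα, rfl⟩
  exact greenTwo_le_of_mem hδ hδ₁ hα hx

theorem greenTwo_le_Phi {α x : ℝ} (hδ : 0 < δ) (hδ₁ : δ < 1) (hα : α ∈ Ioc (δ - 1) 0)
    (hx : x ≤ 1) : greenTwo α δ x ≤ Phi δ x :=
  le_csSup (bddAbove_greenTwo hδ hδ₁ hx) ⟨α, hα, rfl⟩

/-- The one-interval value belongs to the excluded parameter α = δ - 1, so it bounds the supremum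
from below only as a limit. -/
theorem greenOne_le_Phi {x : ℝ} (hδ : 0 < δ) (hδ₁ : δ < 1) (hx : x ∈ Ioc (-1 : ℝ) 0) :
    greenOne δ x ≤ Phi δ x := by
  rcases lt_or_ge x (-1 + 2 * δ) with h | h
  · refine le_of_tendsto (tendsto_greenTwo hδ hδ₁ ⟨hx.1, h⟩) ?_
    filter_upwards [eventually_center_mem hδ₁] with α hα
    exact greenTwo_le_Phi hδ hδ₁ ⟨hα.1, hα.2.le⟩ (by linarith [hx.2])
  · have h0 : greenOne δ x = 0 := by
      rw [greenOne_eq hδ₁ (by linarith [hx.2]), max_eq_left, Real.arcosh_zero]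
      rw [div_le_one (by linarith)]
      linarith
    rw [h0]
    exact (greenTwo_nonneg hδ (by linarith) (by linarith) x).trans
      (greenTwo_le_Phi hδ hδ₁ ⟨by linarith, le_rfl⟩ (by linarith [hx.2]))

theorem mem_gap_of_greenTwo_pos {α x : ℝ} (hδ : 0 < δ) (h₁ : -1 < α - δ) (h₂ : α + δ < 1)
    (hx : x ∈ Icc (-1 : ℝ) 1) (hpos : 0 < greenTwo α δ x) : x ∈ Ioo (α - δ) (α + δ) := by
  by_contra h
  exact hpos.ne' (greenTwo_eq_zero hδ h₁ h₂ ⟨hx, h⟩)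

/-- If the supremum exceeds the Green function of one interval, it is attained. -/
theorem exists_greenTwo_eq_Phi {x : ℝ} (hδ : 0 < δ) (hδ₁ : δ < 1) (hx : x ∈ Ioc (-1 : ℝ) 0)
    (hlt : greenOne δ x < Phi δ x) : ∃ α ∈ Ioc (δ - 1) 0, greenTwo α δ x = Phi δ x := by
  have hx1 : x ≤ 1 := by linarith [hx.2]
  have hlim : Tendsto (fun α => greenOne ((1 + α + δ) / 2) x) (𝓝[>] (δ - 1))
      (𝓝 (greenOne δ x)) := by
    refine tendsto_greenOne ?_ tendsto_const_nhds hδ₁ (by linarith [hx.2])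
    have hc : Continuous fun α : ℝ => (1 + α + δ) / 2 := by fun_prop
    have := (hc.tendsto (δ - 1)).mono_left (nhdsWithin_le_nhds (s := Ioi (δ - 1)))
    convert this using 2
    ring
  obtain ⟨m, hm1, hm2⟩ := exists_between hlt
  -- For α < u the one-interval majorant stays below m < Φ, so only the compact range [min u 0, 0]
  -- matters.
  obtain ⟨u, hu, hsub⟩ := mem_nhdsGT_iff_exists_Ioo_subset.1 (hlim.eventually (gt_mem_nhds hm1))
  have hu' : δ - 1 < min u 0 := lt_min hu (by linarith)
  obtain ⟨α, hα, hmax⟩ := (isCompact_Icc (a := min u 0) (b := 0)).exists_isMaxOn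
    ⟨0, min_le_right _ _, le_rfl⟩ (f := fun α => greenTwo α δ x) fun α hα =>
      (continuousAt_greenTwo hδ (by linarith [hα.1]) (by linarith [hα.2])
        ⟨hx.1.le, hx1⟩).continuousWithinAt
  have hαm : α ∈ Ioc (δ - 1) 0 := ⟨hu'.trans_le hα.1, hα.2⟩
  refine ⟨α, hαm, le_antisymm (greenTwo_le_Phi hδ hδ₁ hαm hx1) ?_⟩
  have hle : Phi δ x ≤ max m (greenTwo α δ x) := by
    refine csSup_le ⟨_, α, hαm, rfl⟩ ?_
    rintro _ ⟨β, hβ, rfl⟩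
    rcases lt_or_ge β (min u 0) with h | h
    · refine le_max_of_le_left ((greenTwo_le_greenOne hδ (by linarith [hβ.1])
        (by linarith [hβ.2]) x).trans (le_of_lt ?_))
      exact hsub ⟨hβ.1, h.trans_le (min_le_left _ _)⟩
    · exact le_max_of_le_right (hmax ⟨h, hβ.2⟩)
  rcases le_max_iff.1 hle with h | h
  · linarith
  · exact h

/-- Where the supremum is attained, the point is critical. -/
theorem isGapCritical_of_greenTwo_eq_Phi {α x : ℝ} (hδ : 0 < δ) (hδ₁ : δ < 1)
    (hα : α ∈ Ioc (δ - 1) 0) (hx : x ∈ Ioc (-1 : ℝ) 0) (hpos : 0 < Phi δ x)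
    (heq : greenTwo α δ x = Phi δ x) : IsGapCritical δ α x := by
  have hx1 : x ≤ 1 := by linarith [hx.2]
  have h₁ : -1 < α - δ := by linarith [hα.1]
  have h₂ : α + δ < 1 := by linarith [hα.2]
  have hgap := mem_gap_of_greenTwo_pos hδ h₁ h₂ ⟨hx.1.le, hx1⟩ (heq ▸ hpos)
  have hd := hasDerivAt_greenTwo hδ h₁ h₂ hgap
  rcases hα.2.lt_or_eq with hα0 | rfl
  · have hmax : IsLocalMax (fun β => greenTwo β δ x) α := by
      filter_upwards [Ioo_mem_nhds hα.1 hα0] with β hβ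
      exact (greenTwo_le_Phi hδ hδ₁ ⟨hβ.1, hβ.2.le⟩ hx1).trans_eq heq.symm
    exact (isGapCritical_iff hδ h₁ h₂).2 ⟨hgap, hmax.hasDerivAt_eq_zero hd⟩
  -- At the end point α = 0 only left slopes are available, and they give a nonnegative derivative.
  -- For x < 0 the derivative would be negative, by monotonicity in x and its zero at x = 0.
  · have hslope := (hasDerivAt_iff_tendsto_slope.1 hd).mono_left
      (nhdsWithin_mono (0 : ℝ) fun β (hβ : β ∈ Iio (0 : ℝ)) => ne_of_lt hβ)
    have hnn : 0 ≤ gapVariation δ 0 (Real.arccos ((x - 0) / δ)) := by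
      refine ge_of_tendsto hslope ?_
      filter_upwards [Ioo_mem_nhdsLT hα.1] with β hβ
      rw [slope_def_field]
      refine div_nonneg_of_nonpos ?_ (by linarith [hβ.2])
      have := (greenTwo_le_Phi hδ hδ₁ ⟨hβ.1, hβ.2.le⟩ hx1).trans_eq heq.symm
      linarith
    have hcrit := isGapCritical_zero_zero hδ hδ₁
    have h0 := ((isGapCritical_iff hδ h₁ h₂).1 hcrit)
    rcases hx.2.lt_or_eq with hx0 | rfl
    · have := strictMonoOn_gapVariation_arccos hδ h₁ h₂ hgap h0.1 hx0
      simp only [h0.2] at this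
      linarith
    · exact hcrit

theorem tendsto_Phi (hδ : 0 < δ) (hδ₁ : δ < 1) :
    Tendsto (Phi δ) (𝓝[>] (-1)) (𝓝 (greenOne δ (-1))) := by
  have hid : Tendsto (fun x : ℝ => x) (𝓝[>] (-1)) (𝓝 (-1)) :=
    tendsto_id.mono_left nhdsWithin_le_nhds
  have hlow : Tendsto (fun x => greenOne δ x) (𝓝[>] (-1)) (𝓝 (greenOne δ (-1))) :=
    tendsto_greenOne tendsto_const_nhds hid hδ₁ (by norm_num)
  -- If x lies in the gap then α - δ < x, so the right interval contains [x + 2δ, 1]. Its left end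
  -- is -1 + 2d with d = δ + (1 + x)/2, a majorant uniform in α.
  have hup : Tendsto (fun x => greenOne (δ + (1 + x) / 2) x) (𝓝[>] (-1))
      (𝓝 (greenOne δ (-1))) := by
    refine tendsto_greenOne ?_ hid hδ₁ (by norm_num)
    have hc : Continuous fun x : ℝ => δ + (1 + x) / 2 := by fun_prop
    have := (hc.tendsto (-1)).mono_left (nhdsWithin_le_nhds (s := Ioi (-1)))
    simpa using this
  refine tendsto_of_tendsto_of_tendsto_of_le_of_le' hlow hup ?_ ?_
  · filter_upwards [Ioo_mem_nhdsGT (show (-1 : ℝ) < 0 by norm_num)] with x hx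
    exact greenOne_le_Phi hδ hδ₁ ⟨hx.1, hx.2.le⟩
  · filter_upwards [Ioo_mem_nhdsGT (show (-1 : ℝ) < 0 by norm_num),
      Ioo_mem_nhdsGT (show (-1 : ℝ) < 1 - 2 * δ by linarith)] with x hx hx'
    have hx1 : x ≤ 1 := by linarith [hx.2]
    have hd : δ + (1 + x) / 2 < 1 := by linarith [hx'.2]
    refine csSup_le ⟨_, 0, ⟨by linarith, le_rfl⟩, rfl⟩ ?_
    rintro _ ⟨α, hα, rfl⟩
    have h₁ : -1 < α - δ := by linarith [hα.1]
    have h₂ : α + δ < 1 := by linarith [hα.2]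
    by_cases hgap : x ∈ Ioo (α - δ) (α + δ)
    · exact (greenTwo_le_greenOne hδ h₁ h₂ x).trans
        (greenOne_le_greenOne (by linarith [hgap.1]) hd hx1)
    · simp only [greenTwo_eq_zero hδ h₁ h₂ ⟨⟨hx.1.le, hx1⟩, hgap⟩]
      exact greenOne_nonneg hd hx1

/-- The critical points converge to the end point of the limit interval. -/
theorem tendsto_critical {x₀ : ℝ → ℝ} (hδ : 0 < δ) (hδ₁ : δ < 1)
    (hx₀ : ∀ α ∈ Ioc (δ - 1) 0, IsGapCritical δ α (x₀ α)) :
    Tendsto x₀ (𝓝[>] (δ - 1)) (𝓝 (-1 + 2 * δ)) := by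
  refine tendsto_order.2 ⟨fun y hy => ?_, fun y hy => ?_⟩
  -- At z the variation is eventually negative, so by monotonicity the zero lies to the right of z.
  -- The maximum with -1 keeps z in the range where this is known.
  · obtain ⟨z, hz1, hz2⟩ := exists_between (max_lt hy (show (-1 : ℝ) < -1 + 2 * δ by linarith))
    have hz : z ∈ Ioo (-1) (-1 + 2 * δ) := ⟨(le_max_right _ _).trans_lt hz1, hz2⟩
    filter_upwards [eventually_gapVariation_neg hδ hδ₁ hz, eventually_mem_gap hz,
      eventually_center_mem hδ₁] with α hneg hgap hmem
    have h₁ : -1 < α - δ := by linarith [hmem.1]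
    have h₂ : α + δ < 1 := by linarith [hmem.2]
    have hc := (isGapCritical_iff hδ h₁ h₂).1 (hx₀ α ⟨hmem.1, hmem.2.le⟩)
    refine ((le_max_left _ _).trans_lt hz1).trans ?_
    by_contra! hle
    have := (strictMonoOn_gapVariation_arccos hδ h₁ h₂).monotoneOn hc.1 hgap hle
    simp only [hc.2] at this
    linarith
  · have hev : ∀ᶠ α : ℝ in 𝓝[>] (δ - 1), α + δ < y :=
      ((by fun_prop : Continuous fun α : ℝ => α + δ).continuousAt.eventually
        (gt_mem_nhds (by linarith))).filter_mono nhdsWithin_le_nhds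
    filter_upwards [hev, eventually_center_mem hδ₁] with α hα hmem
    exact (hx₀ α ⟨hmem.1, hmem.2.le⟩).1.2.trans hα

/-- Squeezed under the Green function of the right interval, which is jointly continuous in interval
and point and vanishes at the limiting end point. -/
theorem tendsto_greenTwo_critical {x₀ : ℝ → ℝ} (hδ : 0 < δ) (hδ₁ : δ < 1)
    (hx₀ : ∀ α ∈ Ioc (δ - 1) 0, IsGapCritical δ α (x₀ α)) :
    Tendsto (fun α => greenTwo α δ (x₀ α)) (𝓝[>] (δ - 1)) (𝓝 0) := by
  have hup : Tendsto (fun α => greenOne ((1 + α + δ) / 2) (x₀ α)) (𝓝[>] (δ - 1))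
      (𝓝 (greenOne δ (-1 + 2 * δ))) := by
    refine tendsto_greenOne ?_ (tendsto_critical hδ hδ₁ hx₀) hδ₁ (by linarith)
    have hc : Continuous fun α : ℝ => (1 + α + δ) / 2 := by fun_prop
    have := (hc.tendsto (δ - 1)).mono_left (nhdsWithin_le_nhds (s := Ioi (δ - 1)))
    convert this using 2
    ring
  have h0 : greenOne δ (-1 + 2 * δ) = 0 := by
    rw [greenOne_eq hδ₁ (by linarith), max_eq_left, Real.arcosh_zero]
    rw [div_le_one (by linarith)]
    linarith
  rw [h0] at hup
  refine squeeze_zero' ?_ ?_ hup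
  all_goals
    filter_upwards [eventually_center_mem hδ₁] with α hmem
    have h₁ : -1 < α - δ := by linarith [hmem.1]
    have h₂ : α + δ < 1 := by linarith [hmem.2]
  · exact greenTwo_nonneg hδ h₁ h₂ _
  · exact greenTwo_le_greenOne hδ h₁ h₂ _

end

end RemezEnvelope

theorem mainTheorem6 (δ : ℝ) (hδ₀ : 0 < δ) (hδ₁ : δ < 1) :
    -- the explicit form of the first curve
    (∀ x ∈ Set.Icc (-1 : ℝ) 0, x ≤ -1 + 2 * δ →
      RemezEnvelope.greenOne δ x =
        Real.log ((δ - x) / (1 - δ) + Real.sqrt (((δ - x) / (1 - δ)) ^ 2 - 1))) ∧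
    (∀ x ∈ Set.Icc (-1 : ℝ) 0, -1 + 2 * δ ≤ x → RemezEnvelope.greenOne δ x = 0) ∧
    ∃ x₀ : ℝ → ℝ,
      -- `x₀ α` is the unique solution in the gap of `∂_α G_{α,δ}(x) = 0`
      (∀ α ∈ Set.Ioc (δ - 1) 0, ∀ x : ℝ, RemezEnvelope.IsGapCritical δ α x ↔ x = x₀ α) ∧
      -- `Φ_δ` is the upper envelope of the two curves
      (∀ x ∈ Set.Ioc (-1 : ℝ) 0,
        IsGreatest
          (insert (RemezEnvelope.greenOne δ x)
            ((fun α => RemezEnvelope.greenTwo α δ (x₀ α)) '' {α ∈ Set.Ioc (δ - 1) 0 | x₀ α = x}))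
          (RemezEnvelope.Phi δ x)) ∧
      -- at the left end point the envelope is the first curve, in the sense of a limit
      Filter.Tendsto (RemezEnvelope.Phi δ) (nhdsWithin (-1) (Set.Ioi (-1)))
        (nhds (RemezEnvelope.greenOne δ (-1))) ∧
      -- the end points of the second curve
      x₀ 0 = 0 ∧
      RemezEnvelope.greenTwo 0 δ (x₀ 0) = 1 / 2 * Real.log ((1 + δ) / (1 - δ)) ∧
      Filter.Tendsto x₀ (nhdsWithin (-1 + δ) (Set.Ioi (-1 + δ))) (nhds (-1 + 2 * δ)) ∧
      Filter.Tendsto (fun α => RemezEnvelope.greenTwo α δ (x₀ α))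
        (nhdsWithin (-1 + δ) (Set.Ioi (-1 + δ))) (nhds 0) := by
  open RemezEnvelope in
  have hδ' : 0 < 1 - δ := by linarith
  refine ⟨fun x hx hxB => ?_, fun x hx hxB => ?_, ?_⟩
  · rw [greenOne_eq hδ₁ (by linarith [hx.2]), max_eq_right, Real.arcosh]
    rw [one_le_div hδ']
    linarith
  · rw [greenOne_eq hδ₁ (by linarith [hx.2]), max_eq_left, Real.arcosh_zero]
    rw [div_le_one hδ']
    linarith
  -- The implication makes x₀ a total function, with arbitrary values outside the parameter range.
  have hex : ∀ α, ∃ x, α ∈ Ioc (δ - 1) 0 → IsGapCritical δ α x := by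
    intro α
    by_cases hα : α ∈ Ioc (δ - 1) 0
    · have h₁ : -1 < α - δ := by linarith [hα.1]
      have h₂ : α + δ < 1 := by linarith [hα.2]
      obtain ⟨x, hx, h⟩ := exists_zero_in_gap hδ₀ h₁ h₂
      exact ⟨x, fun _ => (isGapCritical_iff hδ₀ h₁ h₂).2 ⟨hx, h⟩⟩
    · exact ⟨0, fun h => absurd h hα⟩
  choose x₀ hx₀ using hex
  have huniq : ∀ α ∈ Ioc (δ - 1) 0, ∀ x, IsGapCritical δ α x ↔ x = x₀ α := by
    intro α hα x
    have h₁ : -1 < α - δ := by linarith [hα.1]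
    have h₂ : α + δ < 1 := by linarith [hα.2]
    refine ⟨fun hx => ?_, fun hx => hx ▸ hx₀ α hα⟩
    have hx' := (isGapCritical_iff hδ₀ h₁ h₂).1 hx
    have hy' := (isGapCritical_iff hδ₀ h₁ h₂).1 (hx₀ α hα)
    exact (strictMonoOn_gapVariation_arccos hδ₀ h₁ h₂).injOn hx'.1 hy'.1 (hx'.2.trans hy'.2.symm)
  have hx00 : x₀ 0 = 0 :=
    ((huniq 0 ⟨by linarith, le_rfl⟩ 0).1 (isGapCritical_zero_zero hδ₀ hδ₁)).symm
  have hfilter : -1 + δ = δ - 1 := by ring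
  refine ⟨x₀, huniq, fun x hx => ⟨?_, ?_⟩, tendsto_Phi hδ₀ hδ₁, hx00, ?_, ?_, ?_⟩
  -- Either the first curve already gives the supremum, or the supremum is attained at some α and x
  -- is then the critical point of that gap.
  · rcases (greenOne_le_Phi hδ₀ hδ₁ hx).eq_or_lt with h | h
    · exact Or.inl h.symm
    · obtain ⟨α, hα, heq⟩ := exists_greenTwo_eq_Phi hδ₀ hδ₁ hx h
      have hpos : 0 < Phi δ x := (greenOne_nonneg hδ₁ (by linarith [hx.2])).trans_lt h
      have hcrit := isGapCritical_of_greenTwo_eq_Phi hδ₀ hδ₁ hα hx hpos heq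
      have hxα := (huniq α hα x).1 hcrit
      exact Or.inr ⟨α, ⟨hα, hxα.symm⟩, by simp only [← hxα, heq]⟩
  · rintro _ (rfl | ⟨α, ⟨hα, rfl⟩, rfl⟩)
    · exact greenOne_le_Phi hδ₀ hδ₁ hx
    · exact greenTwo_le_Phi hδ₀ hδ₁ hα (by linarith [hx.2])
  · rw [hx00, greenTwo_zero_zero hδ₀ hδ₁]
  · rw [hfilter]
    exact tendsto_critical hδ₀ hδ₁ hx₀
  · rw [hfilter]
    exact tendsto_greenTwo_critical hδ₀ hδ₁ hx₀
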